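/- All vector spaces and tensor products are over $\mathbb{C}$. A \emph{braided quantum group} $G=(\mathcal A,\{\phi,\epsilon,\kappa,\sigma\})$ consists of a unital associative complex algebra $\mathcal A$ with product $m\colon\mathcal A\otimes\mathcal A\to\mathcal A$ and unit $1$, a coassociative coproduct $\phi\colon\mathcal A\to\mathcal A\otimes\mathcal A$ with counit $\epsilon\colon\mathcal A\to\mathbb C$, and bijective linear maps $\kappa\colon\mathcal A\to\mathcal A$ and $\sigma\colon\mathcal A\otimes\mathcal A\to\mathcal A\otimes\mathcal A$ such that \begin{align*} \sigma(m\otimes\mathrm{id})&=(\mathrm{id}\otimes m)(\sigma\otimes\mathrm{id})(\mathrm{id}\otimes\sigma),\\ \sigma(\mathrm{id}\otimes m)&=(m\otimes\mathrm{id})(\mathrm{id}\otimes\sigma)(\sigma\otimes\mathrm{id}),\\ \phi m&=(m\otimes m)(\mathrm{id}\otimes\sigma\otimes\mathrm{id})(\phi\otimes\phi),\\ (\sigma\otimes\mathrm{id}^2)(\mathrm{id}\otimes\phi\otimes\mathrm{id})(\sigma^{-1}\otimes\mathrm{id})(\mathrm{id}\otimes\phi)&=(\mathrm{id}^2\otimes\sigma)(\mathrm{id}\otimes\phi\otimes\mathrm{id})(\mathrm{id}\otimes\sigma^{-1})(\phi\otimes\mathrm{id}),\\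 m(\mathrm{id}\otimes\kappa)\phi&=m(\kappa\otimes\mathrm{id})\phi=1\epsilon . \end{align*} Proposition. Let $G=(\mathcal A,\{\phi,\epsilon,\kappa,\sigma\})$ be a braided quantum group, and define $$\tau=(\mathrm{id}^2\otimes\epsilon)(\mathrm{id}\otimes\sigma^{-1})(\phi\otimes\mathrm{id})\sigma\colon\mathcal A\otimes\mathcal A\to\mathcal A\otimes\mathcal A .$$ Then $\tau$ is bijective. For each $n\in\mathbb Z$ put $$\sigma_n=(\sigma\tau^{-1})^{n-1}\sigma,\qquad m_n=m\sigma_n^{-1}\sigma,\qquad \kappa_n=(\epsilon\otimes\kappa)\sigma_n^{-1}\sigma\phi .$$ Then for every $n\in\mathbb Z$ one also has $\kappa_n=(\kappa\otimes\epsilon)\sigma_n^{-1}\sigma\phi$, and, if $\mathcal A_n$ denotes the vector space $\mathcal A$ with the product $m_n$ and the unit $1$, then $G_n=(\mathcal A_n,\{\phi,\epsilon,\kappa_n,\sigma_n\})$ is a braided quantum group. In particular, $G_0$ has braiding $\sigma_0=\tau$, and its counit is multiplicative: $\epsilon m_0=\epsilon\otimes\epsilon$. -/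

import Mathlib

open scoped TensorProduct

noncomputable section

namespace BraidedQG

variable {A : Type*} [AddCommGroup A] [Module ℂ A]

/-- `f ⊗ id` acting on the first two factors of `A ⊗ (A ⊗ W)`, for `f : A ⊗ A → A ⊗ A`. -/
def onFirstTwo (W : Type*) [AddCommGroup W] [Module ℂ W] (f : A ⊗[ℂ] A →ₗ[ℂ] A ⊗[ℂ] A) :
    A ⊗[ℂ] (A ⊗[ℂ] W) →ₗ[ℂ] A ⊗[ℂ] (A ⊗[ℂ] W) :=
  (TensorProduct.assoc ℂ A A W).toLinearMap ∘ₗ f.rTensor W ∘ₗ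
    (TensorProduct.assoc ℂ A A W).symm.toLinearMap

/-- `m ⊗ id : A ⊗ (A ⊗ A) → A ⊗ A`. -/
def mulLeft (m : A ⊗[ℂ] A →ₗ[ℂ] A) : A ⊗[ℂ] (A ⊗[ℂ] A) →ₗ[ℂ] A ⊗[ℂ] A :=
  m.rTensor A ∘ₗ (TensorProduct.assoc ℂ A A A).symm.toLinearMap

/-- `φ ⊗ id : A ⊗ A → A ⊗ (A ⊗ A)`. -/
def comulLeft (φ : A →ₗ[ℂ] A ⊗[ℂ] A) : A ⊗[ℂ] A →ₗ[ℂ] A ⊗[ℂ] (A ⊗[ℂ] A) :=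
  (TensorProduct.assoc ℂ A A A).toLinearMap ∘ₗ φ.rTensor A

/-- `id ⊗ f ⊗ id` acting on the two middle factors of `(A ⊗ A) ⊗ (A ⊗ A)`. -/
def onMiddle (f : A ⊗[ℂ] A →ₗ[ℂ] A ⊗[ℂ] A) :
    (A ⊗[ℂ] A) ⊗[ℂ] (A ⊗[ℂ] A) →ₗ[ℂ] (A ⊗[ℂ] A) ⊗[ℂ] (A ⊗[ℂ] A) :=
  (TensorProduct.assoc ℂ A A (A ⊗[ℂ] A)).symm.toLinearMap ∘ₗ
    (onFirstTwo A f).lTensor A ∘ₗ (TensorProduct.assoc ℂ A A (A ⊗[ℂ] A)).toLinearMap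

/-- `(A, {φ, ε, κ, σ})` is a braided quantum group, where the complex vector space `A` carries the
product `m` and the unit element `one`. The structure maps are explicit arguments because several
products on one vector space are considered. -/
structure IsBraidedQuantumGroup (m : A ⊗[ℂ] A →ₗ[ℂ] A) (one : A) (φ : A →ₗ[ℂ] A ⊗[ℂ] A)
    (ε : A →ₗ[ℂ] ℂ) (κ : A →ₗ[ℂ] A) (σ : A ⊗[ℂ] A ≃ₗ[ℂ] A ⊗[ℂ] A) : Prop where
  /-- `m (m ⊗ id) = m (id ⊗ m)` -/
  mul_assoc : m ∘ₗ mulLeft m = m ∘ₗ m.lTensor A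
  one_mul : ∀ a : A, m (one ⊗ₜ[ℂ] a) = a
  mul_one : ∀ a : A, m (a ⊗ₜ[ℂ] one) = a
  /-- `(φ ⊗ id) φ = (id ⊗ φ) φ` -/
  coassoc : comulLeft φ ∘ₗ φ = φ.lTensor A ∘ₗ φ
  /-- `(ε ⊗ id) φ = id` -/
  counit_left : (TensorProduct.lid ℂ A).toLinearMap ∘ₗ ε.rTensor A ∘ₗ φ = LinearMap.id
  /-- `(id ⊗ ε) φ = id` -/
  counit_right : (TensorProduct.rid ℂ A).toLinearMap ∘ₗ ε.lTensor A ∘ₗ φ = LinearMap.id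
  antipode_bijective : Function.Bijective κ
  /-- `σ (m ⊗ id) = (id ⊗ m) (σ ⊗ id) (id ⊗ σ)` -/
  braiding_mul_left : σ.toLinearMap ∘ₗ mulLeft m =
    m.lTensor A ∘ₗ onFirstTwo A σ.toLinearMap ∘ₗ σ.toLinearMap.lTensor A
  /-- `σ (id ⊗ m) = (m ⊗ id) (id ⊗ σ) (σ ⊗ id)` -/
  braiding_mul_right : σ.toLinearMap ∘ₗ m.lTensor A =
    mulLeft m ∘ₗ σ.toLinearMap.lTensor A ∘ₗ onFirstTwo A σ.toLinearMap
  /-- `φ m = (m ⊗ m) (id ⊗ σ ⊗ id) (φ ⊗ φ)` -/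
  comul_mul : φ ∘ₗ m =
    TensorProduct.map m m ∘ₗ onMiddle σ.toLinearMap ∘ₗ TensorProduct.map φ φ
  /-- `(σ ⊗ id²) (id ⊗ φ ⊗ id) (σ⁻¹ ⊗ id) (id ⊗ φ) = (id² ⊗ σ) (id ⊗ φ ⊗ id) (id ⊗ σ⁻¹) (φ ⊗ id)` -/
  braiding_comul :
    onFirstTwo (A ⊗[ℂ] A) σ.toLinearMap ∘ₗ (comulLeft φ).lTensor A ∘ₗ
        onFirstTwo A σ.symm.toLinearMap ∘ₗ φ.lTensor A =
      (σ.toLinearMap.lTensor A).lTensor A ∘ₗ (comulLeft φ).lTensor A ∘ₗ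
        σ.symm.toLinearMap.lTensor A ∘ₗ comulLeft φ
  /-- `m (id ⊗ κ) φ = 1 ε` -/
  antipode_right : ∀ a : A, m (κ.lTensor A (φ a)) = ε a • one
  /-- `m (κ ⊗ id) φ = 1 ε` -/
  antipode_left : ∀ a : A, m (κ.rTensor A (φ a)) = ε a • one

/-- The secondary flip-over operator `τ = (id² ⊗ ε) (id ⊗ σ⁻¹) (φ ⊗ id) σ`. -/
def secondaryFlip (φ : A →ₗ[ℂ] A ⊗[ℂ] A) (ε : A →ₗ[ℂ] ℂ) (σ : A ⊗[ℂ] A ≃ₗ[ℂ] A ⊗[ℂ] A) :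
    A ⊗[ℂ] A →ₗ[ℂ] A ⊗[ℂ] A :=
  ((TensorProduct.rid ℂ A).toLinearMap ∘ₗ ε.lTensor A).lTensor A ∘ₗ
    σ.symm.toLinearMap.lTensor A ∘ₗ comulLeft φ ∘ₗ σ.toLinearMap

/-- `σₙ = (σ τ⁻¹)ⁿ⁻¹ σ` for an integer `n`; the product of linear automorphisms is composition. -/
def braidingSeq (σ τ : A ⊗[ℂ] A ≃ₗ[ℂ] A ⊗[ℂ] A) (n : ℤ) : A ⊗[ℂ] A ≃ₗ[ℂ] A ⊗[ℂ] A :=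
  (σ * τ⁻¹) ^ (n - 1) * σ

/-- `mₙ = m σₙ⁻¹ σ`. -/
def mulSeq (m : A ⊗[ℂ] A →ₗ[ℂ] A) (σ τ : A ⊗[ℂ] A ≃ₗ[ℂ] A ⊗[ℂ] A) (n : ℤ) :
    A ⊗[ℂ] A →ₗ[ℂ] A :=
  m ∘ₗ (braidingSeq σ τ n).symm.toLinearMap ∘ₗ σ.toLinearMap

/-- `κₙ = (ε ⊗ κ) σₙ⁻¹ σ φ`. -/
def antipodeSeq (φ : A →ₗ[ℂ] A ⊗[ℂ] A) (ε : A →ₗ[ℂ] ℂ) (κ : A →ₗ[ℂ] A)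
    (σ τ : A ⊗[ℂ] A ≃ₗ[ℂ] A ⊗[ℂ] A) (n : ℤ) : A →ₗ[ℂ] A :=
  (TensorProduct.lid ℂ A).toLinearMap ∘ₗ TensorProduct.map ε κ ∘ₗ
    (braidingSeq σ τ n).symm.toLinearMap ∘ₗ σ.toLinearMap ∘ₗ φ

/-- `(κ ⊗ ε) σₙ⁻¹ σ φ`. -/
def antipodeSeq' (φ : A →ₗ[ℂ] A ⊗[ℂ] A) (ε : A →ₗ[ℂ] ℂ) (κ : A →ₗ[ℂ] A)
    (σ τ : A ⊗[ℂ] A ≃ₗ[ℂ] A ⊗[ℂ] A) (n : ℤ) : A →ₗ[ℂ] A :=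
  (TensorProduct.rid ℂ A).toLinearMap ∘ₗ TensorProduct.map κ ε ∘ₗ
    (braidingSeq σ τ n).symm.toLinearMap ∘ₗ σ.toLinearMap ∘ₗ φ

end BraidedQG

end

/-! Everything is governed by one automorphism K of A⊗A. Call (id⊗x⊗id)(φ⊗φ) the twist by a form x
on A⊗A. By coassociativity a twist commutes with φ⊗id and id⊗φ, so products of twists can be
computed on their forms. Let K be the twist by k = (ε⊗ε)σ. Applying counits to the axioms gives eK =
ε⊗ε for e = εm (`coform_twist`), so the twist K' by e is a left inverse of K. It turns out to be
two-sided, with τ = σK'. This makes τ bijective and gives σₙ = τKⁿ, σₙ⁻¹σ = K¹⁻ⁿ, mₙ = m₀K⁻ⁿ with m₀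
= mK, and κₙ = κN¹⁻ⁿ with N = (ε⊗id)Kφ. The whole family is thus G₀ = (m₀, τ) deformed by powers of
K.

Two things remain. G₀ must be well behaved: εm₀ = ε⊗ε, m₀ is associative, and τ is natural for φ and
m₀. And K must behave like a bicharacter over G₀: K₁₂(id⊗m₀) = (id⊗m₀)K₁₃K₁₂ and its mirror image
(`twist_mul_zero_right`, `twist_mul_zero_left`). Here K₁₃ has two candidates, P = τ₂₃⁻¹K₁₂τ₂₃ and Q
= τ₁₂⁻¹K₂₃τ₁₂. The crux is P = Q (`left_eq_right`): it makes K₁₂, K₁₃, K₂₃ commute pairwise and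
leads to their sliding through τ. The antipode inverts K in either leg (`twist_antipode_right`,
`twist_antipode_left`), and Kφ = φN (`twist_comul`). All these rules pass to integer powers, and the
axioms of Gₙ follow (`deform`).

The computations take place in a monoid M with an endomorphism s, where x stands for x⊗id and s x
for id⊗x; associators vanish and the interchange law becomes a commutation rule. The model is M =
End W for a space W with A⊗W ≅ W (`exists_reservoir`), which represents the maps in question
faithfully (`isBraidedQuantumGroup_iff`). -/

namespace BraidedQG

/-! ### Strict tensor calculus in a monoid with a shift -/

section Interchange

variable {M : Type*} [Monoid M]

/-- `x` acts on the first `k` strands and produces `l` strands, where the endomorphism `s` of `M`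
stands for adding a strand on the left. -/
class Local (s : M →* M) (k : ℕ) (l : outParam ℕ) (x : M) : Prop where
  comm : ∀ y, x * (⇑s)^[k] y = (⇑s)^[l] y * x

instance Local.shift (s : M →* M) (k l : ℕ) (x : M) [h : Local s k l x] :
    Local s (k + 1) (l + 1) (s x) where
  comm y := by
    rw [Function.iterate_succ_apply', Function.iterate_succ_apply', ← map_mul, h.comm, map_mul]

theorem Local.comm_assoc {s : M →* M} {k l : ℕ} {x : M} (h : Local s k l x) (y z : M) :
    x * ((⇑s)^[k] y * z) = (⇑s)^[l] y * (x * z) := by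
  rw [← mul_assoc, h.comm, mul_assoc]

/-- One conjunction, so that `simp only [interchange s]` receives a whole rewriting system: products
associate to the right, and a shifted factor moves left past any x whose input strands it avoids.
Each depth is written with explicit nested `s` so that it matches syntactically; the last two
clauses unfold the iterates that appear on the right. -/
theorem interchange (s : M →* M) :
    (∀ a b c : M, a * b * c = a * (b * c)) ∧ (∀ a : M, 1 * a = a) ∧ (∀ a : M, a * 1 = a) ∧
    (∀ a b : M, s (a * b) = s a * s b) ∧ s 1 = 1 ∧
    (∀ (l : ℕ) (x : M) [Local s 0 l x] (y : M), x * y = (⇑s)^[l] y * x) ∧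
    (∀ (l : ℕ) (x : M) [Local s 0 l x] (y z : M), x * (y * z) = (⇑s)^[l] y * (x * z)) ∧
    (∀ (l : ℕ) (x : M) [Local s 1 l x] (y : M), x * s y = (⇑s)^[l] y * x) ∧
    (∀ (l : ℕ) (x : M) [Local s 1 l x] (y z : M), x * (s y * z) = (⇑s)^[l] y * (x * z)) ∧
    (∀ (l : ℕ) (x : M) [Local s 2 l x] (y : M), x * s (s y) = (⇑s)^[l] y * x) ∧
    (∀ (l : ℕ) (x : M) [Local s 2 l x] (y z : M),
      x * (s (s y) * z) = (⇑s)^[l] y * (x * z)) ∧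
    (∀ (l : ℕ) (x : M) [Local s 3 l x] (y : M), x * s (s (s y)) = (⇑s)^[l] y * x) ∧
    (∀ (l : ℕ) (x : M) [Local s 3 l x] (y z : M),
      x * (s (s (s y)) * z) = (⇑s)^[l] y * (x * z)) ∧
    (∀ (l : ℕ) (x : M) [Local s 4 l x] (y : M), x * s (s (s (s y))) = (⇑s)^[l] y * x) ∧
    (∀ (l : ℕ) (x : M) [Local s 4 l x] (y z : M),
      x * (s (s (s (s y))) * z) = (⇑s)^[l] y * (x * z)) ∧
    (∀ (l : ℕ) (x : M) [Local s 5 l x] (y : M), x * s (s (s (s (s y)))) = (⇑s)^[l] y * x) ∧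
    (∀ (l : ℕ) (x : M) [Local s 5 l x] (y z : M),
      x * (s (s (s (s (s y)))) * z) = (⇑s)^[l] y * (x * z)) ∧
    (∀ y : M, (⇑s)^[0] y = y) ∧ (∀ (l : ℕ) (y : M), (⇑s)^[l + 1] y = s ((⇑s)^[l] y)) :=
  ⟨mul_assoc, one_mul, mul_one, map_mul s, map_one s,
    fun _ _ h => h.comm, fun _ _ h => h.comm_assoc, fun _ _ h => h.comm, fun _ _ h => h.comm_assoc,
    fun _ _ h => h.comm, fun _ _ h => h.comm_assoc, fun _ _ h => h.comm, fun _ _ h => h.comm_assoc,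
    fun _ _ h => h.comm, fun _ _ h => h.comm_assoc, fun _ _ h => h.comm, fun _ _ h => h.comm_assoc,
    fun _ => rfl, fun l y => Function.iterate_succ_apply' s l y⟩

/-- Cancellation at shift depths 0, 1 and 2, each also with a trailing factor, as simp rules for
right-associated products. -/
theorem cancel (s : M →* M) {x y : M} (h : x * y = 1) :
    (x * y = 1 ∧ ∀ z, x * (y * z) = z) ∧ (s x * s y = 1 ∧ ∀ z, s x * (s y * z) = z) ∧
    (s (s x) * s (s y) = 1 ∧ ∀ z, s (s x) * (s (s y) * z) = z) := by
  have (x y : M) (h : x * y = 1) : x * y = 1 ∧ ∀ z, x * (y * z) = z :=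
    ⟨h, fun z => by rw [← mul_assoc, h, one_mul]⟩
  exact ⟨this _ _ h, this _ _ (by rw [← map_mul, h, map_one]),
    this _ _ (by rw [← map_mul, ← map_mul, h, map_one, map_one])⟩

theorem sandwich {x y : M} (h : x = y) (a b : M) : a * x * b = a * y * b := by rw [h]

end Interchange

end BraidedQG

namespace BraidedQG

set_option linter.unusedSectionVars false

/-! ### Axioms in the strict calculus; behaviour of the unit -/

section Units

variable {M : Type*} [Monoid M]

/-- The axioms of a braided quantum group in a strict calculus, where the endomorphism `s` of `M`
adds a strand on the left, except for the bijectivity of the antipode. -/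
structure StrictBraided (s : M →* M) (m η φ ε κ σ σ' : M) : Prop where
  inv_right : σ * σ' = 1
  inv_left : σ' * σ = 1
  assoc : m * m = m * s m
  unit_left : m * η = 1
  unit_right : m * s η = 1
  coassoc : φ * φ = s φ * φ
  counit_left : ε * φ = 1
  counit_right : s ε * φ = 1
  braiding_mul_left : σ * m = s m * σ * s σ
  braiding_mul_right : σ * s m = m * s σ * σ
  comul_mul : φ * m = m * s (s m) * s σ * φ * s φ
  braiding_comul : σ * s φ * σ' * s φ = s (s σ) * s φ * s σ' * φ
  antipode_right : m * s κ * φ = η * ε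
  antipode_left : m * κ * φ = η * ε

variable {s : M →* M} {m η φ ε κ σ σ' : M}
  [Local s 2 1 m] [Local s 0 1 η] [Local s 1 2 φ] [Local s 1 0 ε] [Local s 1 1 κ]
  [Local s 2 2 σ] [Local s 2 2 σ']

namespace StrictBraided

/-- Putting 1 in the first slot of `braiding_mul_left` gives (id⊗m)(σ⊗id)(1⊗σ(x)) = σ(x). Since σ is
invertible, (id⊗m)(σ⊗id)(1⊗y) = y for all y, and y = a⊗1 gives the claim. -/
theorem braiding_one_left (h : StrictBraided s m η φ ε κ σ σ') : σ * η = s η := by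
  have h₁ : s m * σ * η = 1 :=
    calc s m * σ * η = s m * σ * η * σ * σ' := by
          simpa only [interchange s] using (sandwich h.inv_right (s m * σ * η) 1).symm
      _ = σ * m * η * σ' := by
          simpa only [interchange s] using (sandwich h.braiding_mul_left 1 (η * σ')).symm
      _ = σ * σ' := by simpa only [interchange s] using sandwich h.unit_left σ σ'
      _ = 1 := h.inv_right
  calc σ * η = s m * s (s η) * σ * η := by
        simpa only [interchange s] using (sandwich (congrArg s h.unit_right) 1 (σ * η)).symm
    _ = s m * σ * η * s η := by simp only [interchange s]
    _ = s η := by rw [h₁, one_mul]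

theorem braiding_one_right (h : StrictBraided s m η φ ε κ σ σ') : σ * s η = η := by
  have h₁ : m * s σ * s (s η) = 1 :=
    calc m * s σ * s (s η) = m * s σ * s (s η) * σ * σ' := by
          simpa only [interchange s] using (sandwich h.inv_right (m * s σ * s (s η)) 1).symm
      _ = σ * s m * s (s η) * σ' := by
          simpa only [interchange s] using
            (sandwich h.braiding_mul_right 1 (s (s η) * σ')).symm
      _ = σ * σ' := by
          simpa only [interchange s] using sandwich (congrArg s h.unit_right) σ σ'
      _ = 1 := h.inv_right
  calc σ * s η = m * η * σ * s η := by
        simpa only [interchange s] using (sandwich h.unit_left 1 (σ * s η)).symm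
    _ = m * s σ * s (s η) * η := by simp only [interchange s]
    _ = η := by rw [h₁, one_mul]

/-- In the braided product on A⊗A, φ(1)φ(a) = φ(a). Multiplying on the right by an antipode leg and
using a₁⊗a₂κ(a₃) = a⊗1 gives φ(1)(a⊗1) = a⊗1; now take a = 1. -/
theorem comul_one (h : StrictBraided s m η φ ε κ σ σ') : φ * η = s η * η := by
  have h₀ : m * s (s m) * s σ * (φ * η) * φ = φ :=
    calc m * s (s m) * s σ * (φ * η) * φ = φ * m * η := by
          simpa only [interchange s] using (sandwich h.comul_mul 1 η).symm
      _ = φ := by simpa only [interchange s] using sandwich h.unit_left φ 1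
  have h₁ : s m * s (s κ) * φ * φ = s η := 
    calc s m * s (s κ) * φ * φ = s m * s (s κ) * s φ * φ := by
          simpa only [interchange s] using sandwich h.coassoc (s m * s (s κ)) 1
      _ = s η * s ε * φ := by
          simpa only [interchange s] using sandwich (congrArg s h.antipode_right) 1 φ
      _ = s η := by simpa only [interchange s] using sandwich h.counit_right (s η) 1
  have h₂ : m * s σ * (φ * η) = s η :=
    calc m * s σ * (φ * η) = m * s (s m) * s (s (s η)) * s σ * (φ * η) := by
          simpa only [interchange s] using
            (sandwich (congrArg (fun x => s (s x)) h.unit_right) m (s σ * (φ * η))).symm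
      _ = m * s (s m) * s σ * φ * η * s η := by simp only [interchange s]
      _ = m * s (s m) * s σ * φ * η * s m * s (s κ) * φ * φ := by
          simpa only [interchange s] using
            (sandwich h₁ (m * s (s m) * s σ * φ * η) 1).symm
      _ = m * s (s m) * s (s (s m)) * s (s (s (s κ))) * s σ * φ * η * φ * φ := by
          simp only [interchange s]
      _ = m * s (s m) * s (s m) * s (s (s (s κ))) * s σ * φ * η * φ * φ := by
          simpa only [interchange s] using
            (sandwich (congrArg (fun x => s (s x)) h.assoc) m
              (s (s (s (s κ))) * s σ * φ * η * φ * φ)).symm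
      _ = s m * s (s κ) * φ * φ := by
          simpa only [interchange s] using sandwich h₀ (s m * s (s κ)) φ
      _ = s η := h₁
  calc φ * η = m * η * φ * η := by rw [h.unit_left, one_mul]
    _ = m * s η * φ * η := by rw [h.unit_left, h.unit_right]
    _ = m * s σ * s (s η) * φ * η := by
        simpa only [interchange s] using
          (sandwich (congrArg s h.braiding_one_right) m (φ * η)).symm
    _ = m * s σ * (φ * η) * η := by simp only [interchange s]
    _ = s η * η := by rw [h₂]

theorem counit_one (h : StrictBraided s m η φ ε κ σ σ') : ε * η = 1 :=
  calc ε * η = m * η * ε * η := by rw [h.unit_left, one_mul]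
    _ = m * ε * (s η * η) := by simp only [interchange s]
    _ = m * ε * (φ * η) := by rw [h.comul_one]
    _ = m * η := by simpa only [interchange s] using sandwich h.counit_left m η
    _ = 1 := h.unit_left

end StrictBraided

end Units

end BraidedQG

namespace BraidedQG

set_option linter.unusedSectionVars false

/-! ### The forms k and e, and the relation eK = ε⊗ε -/

section Flip

variable {M : Type*} [Monoid M]

/-- The secondary flip `τ`, with the forms `k = (ε ⊗ ε) σ` and `e = ε m` and the operators
`K = (id ⊗ k ⊗ id) (φ ⊗ φ)` and `K' = (id ⊗ e ⊗ id) (φ ⊗ φ)`. -/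
structure FlipData (s : M →* M) (m φ ε σ σ' k e K K' τ τ' : M) : Prop where
  form_eq : k = ε * ε * σ
  coform_eq : e = ε * m
  twist_eq : K = s k * φ * s φ
  cotwist_eq : K' = s e * φ * s φ
  flip_eq : τ = s (s ε) * s σ' * φ * σ
  coflip_eq : τ' = K * σ'

variable {s : M →* M} {m η φ ε κ σ σ' k e K K' τ τ' : M}
  [Local s 2 1 m] [Local s 0 1 η] [Local s 1 2 φ] [Local s 1 0 ε] [Local s 1 1 κ]
  [Local s 2 2 σ] [Local s 2 2 σ'] [Local s 2 0 k] [Local s 2 0 e]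
  [Local s 2 2 K] [Local s 2 2 K'] [Local s 2 2 τ] [Local s 2 2 τ']

namespace StrictBraided

/-- Only counits applied to `braiding_comul`: on the second output strand they collapse its right
side to φ⊗id, on the last input they remove the inner coproduct. The form k measures how far the
counit is from passing through σ. -/
theorem braiding_counit_right (h : StrictBraided s m η φ ε κ σ σ')
    (d : FlipData s m φ ε σ σ' k e K K' τ τ') : s ε * σ = k * s φ := by
  have h₁ : s ε * σ * s φ * σ' * s φ = φ :=
    calc s ε * σ * s φ * σ' * s φ = s ε * s (s σ) * s φ * s σ' * φ := by
          simpa only [interchange s] using sandwich h.braiding_comul (s ε) 1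
      _ = s σ * s σ' * φ := by
          simpa only [interchange s] using
            sandwich (congrArg s h.counit_left) (s σ) (s σ' * φ)
      _ = φ := by simpa only [interchange s] using sandwich (congrArg s h.inv_right) 1 φ
  have h₂ : s ε * σ * s φ * σ' = φ * s ε :=
    calc s ε * σ * s φ * σ' = s ε * σ * s φ * σ' * (s (s ε) * s φ) := by
          simpa only [interchange s] using
            (sandwich (congrArg s h.counit_right) (s ε * σ * s φ * σ') 1).symm
      _ = s (s ε) * (s ε * σ * s φ * σ' * s φ) := by simp only [interchange s]
      _ = φ * s ε := by rw [h₁]; simp only [interchange s]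
  calc s ε * σ = ε * φ * s ε * σ := by rw [h.counit_left, one_mul]
    _ = ε * (s ε * σ * s φ * σ') * σ := by rw [h₂]; simp only [mul_assoc]
    _ = ε * ε * σ * s φ := by
        simpa only [interchange s] using sandwich h.inv_left (ε * s ε * σ * s φ) 1
    _ = k * s φ := by rw [d.form_eq]

theorem braiding_counit_left (h : StrictBraided s m η φ ε κ σ σ')
    (d : FlipData s m φ ε σ σ' k e K K' τ τ') : ε * σ = s k * φ := by
  have h₁ : s (s ε) * s (s σ) * s φ * s σ' * φ = s φ :=
    calc s (s ε) * s (s σ) * s φ * s σ' * φ = s (s ε) * σ * s φ * σ' * s φ := by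
          simpa only [interchange s] using (sandwich h.braiding_comul (s (s ε)) 1).symm
      _ = σ * σ' * s φ := by
          simpa only [interchange s] using
            sandwich (congrArg s h.counit_right) σ (σ' * s φ)
      _ = s φ := by rw [h.inv_right, one_mul]
  have h₂ : s ε * s σ * φ * σ' = φ * ε :=
    calc s ε * s σ * φ * σ' = s ε * s σ * φ * σ' * (ε * φ) := by
          rw [h.counit_left, mul_one]
      _ = ε * (s (s ε) * s (s σ) * s φ * s σ' * φ) := by simp only [interchange s]
      _ = φ * ε := by rw [h₁]; simp only [interchange s]
  calc ε * σ = s ε * φ * ε * σ := by rw [h.counit_right, one_mul]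
    _ = s ε * (s ε * s σ * φ * σ') * σ := by rw [h₂]; simp only [mul_assoc]
    _ = s ε * s ε * s σ * φ := by
        simpa only [interchange s] using sandwich h.inv_left (s ε * s ε * s σ * φ) 1
    _ = s k * φ := by rw [d.form_eq]; simp only [map_mul]

/-- A counit on the first strand of `braiding_comul`: by `braiding_counit_left` the counit, σ and
the following coproduct combine into K. -/
theorem braiding_comul_left (h : StrictBraided s m η φ ε κ σ σ')
    (d : FlipData s m φ ε σ σ' k e K K' τ τ') : s σ * φ = K * σ' * s φ * σ := by
  have h₁ : s σ * φ * σ' = K * σ' * s φ :=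
    calc s σ * φ * σ' = s σ * φ * σ' * (ε * φ) := by rw [h.counit_left, mul_one]
      _ = ε * s (s σ) * s φ * s σ' * φ := by simp only [interchange s]
      _ = ε * σ * s φ * σ' * s φ := by
          simpa only [interchange s] using (sandwich h.braiding_comul ε 1).symm
      _ = K * σ' * s φ := by rw [h.braiding_counit_left d, d.twist_eq]
  rw [← h₁, mul_assoc, h.inv_left, mul_one]

theorem twist_eq' (d : FlipData s m φ ε σ σ' k e K K' τ τ') : K = s k * s (s φ) * φ := by
  rw [d.twist_eq]; simp only [interchange s]

theorem cotwist_eq' (d : FlipData s m φ ε σ σ' k e K K' τ τ') : K' = s e * s (s φ) * φ := by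
  rw [d.cotwist_eq]; simp only [interchange s]

theorem braiding_comul_right (h : StrictBraided s m η φ ε κ σ σ')
    (d : FlipData s m φ ε σ σ' k e K K' τ τ') : σ * s φ = s K * s σ' * φ * σ := by
  have h₁ : σ * s φ * σ' = s K * s σ' * φ :=
    calc σ * s φ * σ' = σ * s φ * σ' * (s (s ε) * s φ) := by
          simpa only [interchange s] using
            (sandwich (congrArg s h.counit_right) (σ * s φ * σ') 1).symm
      _ = s (s (s ε)) * (σ * s φ * σ' * s φ) := by simp only [interchange s]
      _ = s (s (s ε)) * s (s σ) * s φ * s σ' * φ := by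
          rw [h.braiding_comul]; simp only [mul_assoc]
      _ = s (s k) * s (s (s φ)) * s φ * s σ' * φ := by
          simpa only [interchange s] using
            sandwich (congrArg (fun x => s (s x)) (h.braiding_counit_right d)) 1
              (s φ * s σ' * φ)
      _ = s K * s σ' * φ := by rw [twist_eq' d]; simp only [map_mul]
  rw [← h₁, mul_assoc, h.inv_left, mul_one]

/-- The Galois map a⊗b ↦ ab₁⊗b₂ is undone by a⊗b ↦ aκ(b₁)⊗b₂. This is the means of cancelling m,
which is not injective by itself. -/
theorem mul_comul_left_inv (h : StrictBraided s m η φ ε κ σ σ') :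
    m * s κ * s φ * (m * s φ) = 1 :=
  calc m * s κ * s φ * (m * s φ) = m * m * s (s κ) * s (s φ) * s φ := by
        simp only [interchange s]
    _ = m * s m * s (s κ) * s (s φ) * s φ := by rw [h.assoc]
    _ = m * s m * s (s κ) * s φ * s φ := by
        simpa only [interchange s] using
          (sandwich (congrArg s h.coassoc) (m * s m * s (s κ)) 1).symm
    _ = m * s η * s ε * s φ := by
        simpa only [interchange s] using
          sandwich (congrArg s h.antipode_right) m (s φ)
    _ = s ε * s φ := by rw [h.unit_right, one_mul]
    _ = 1 := by rw [← map_mul, h.counit_left, map_one]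

theorem comul_mul_left_inv (h : StrictBraided s m η φ ε κ σ σ') :
    s m * s κ * φ * (s m * φ) = 1 :=
  calc s m * s κ * φ * (s m * φ) = s m * s (s m) * s κ * φ * φ := by
        simp only [interchange s]
    _ = s m * s m * s κ * φ * φ := by
        simpa only [interchange s] using
          (sandwich (congrArg s h.assoc) 1 (s κ * φ * φ)).symm
    _ = s m * s m * s κ * s φ * φ := by
        simpa only [interchange s] using sandwich h.coassoc (s m * s m * s κ) 1
    _ = s m * s η * s ε * φ := by
        simpa only [interchange s] using
          sandwich (congrArg s h.antipode_left) (s m) φ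
    _ = s ε * φ := by rw [← map_mul, h.unit_left, map_one, one_mul]
    _ = 1 := h.counit_right

/-- A counit on the first leg of φm gives m = mX, with X the operator in question. As X commutes
with id⊗φ, X also fixes the Galois map (m⊗id)(id⊗φ) under right composition, and that map is
injective. -/
theorem coform_counit_left (h : StrictBraided s m η φ ε κ σ σ')
    (d : FlipData s m φ ε σ σ' k e K K' τ τ') : e * s σ * φ * s φ = 1 := by
  have h₁ : m = m * (e * s σ * φ * s φ) :=
    calc m = ε * φ * m := by rw [h.counit_left, one_mul]
      _ = ε * m * s (s m) * s σ * φ * s φ := by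
          simpa only [interchange s] using sandwich h.comul_mul ε 1
      _ = e * s (s m) * s σ * φ * s φ := by rw [d.coform_eq]
      _ = m * (e * s σ * φ * s φ) := by simp only [interchange s]
  have h₂ : m * s φ * (e * s σ * φ * s φ) = m * s φ :=
    calc m * s φ * (e * s σ * φ * s φ) = m * e * s σ * φ * s (s φ) * s φ := by
          simp only [interchange s]
      _ = m * e * s σ * φ * s φ * s φ := by
          simpa only [interchange s] using
            (sandwich (congrArg s h.coassoc) (m * e * s σ * φ) 1).symm
      _ = m * s φ := by
          simpa only [interchange s] using (sandwich h₁ 1 (s φ)).symm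
  calc e * s σ * φ * s φ
      = m * s κ * s φ * (m * s φ) * (e * s σ * φ * s φ) := by
        rw [h.mul_comul_left_inv, one_mul]
    _ = m * s κ * s φ * (m * s φ) := by rw [mul_assoc, h₂]
    _ = 1 := h.mul_comul_left_inv

theorem coform_counit_right (h : StrictBraided s m η φ ε κ σ σ')
    (d : FlipData s m φ ε σ σ' k e K K' τ τ') : s (s e) * s σ * φ * s φ = 1 := by
  have h₁ : m = m * (s (s e) * s σ * φ * s φ) :=
    calc m = s ε * φ * m := by rw [h.counit_right, one_mul]
      _ = m * s (s (ε * m)) * s σ * φ * s φ := by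
          simpa only [interchange s] using sandwich h.comul_mul (s ε) 1
      _ = m * (s (s e) * s σ * φ * s φ) := by
          rw [d.coform_eq]; simp only [mul_assoc]
  have h₂ : s m * φ * (s (s e) * s σ * φ * s φ) = s m * φ :=
    calc s m * φ * (s (s e) * s σ * φ * s φ)
        = s m * s (s (s e)) * s (s σ) * s (s (s φ)) * φ * φ := by
          simp only [interchange s]
      _ = s m * s (s (s e)) * s (s σ) * s (s (s φ)) * s φ * φ := by
          simpa only [interchange s] using
            sandwich h.coassoc (s m * s (s (s e)) * s (s σ) * s (s (s φ))) 1
      _ = s m * φ := by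
          simpa only [interchange s] using (sandwich (congrArg s h₁) 1 φ).symm
  calc s (s e) * s σ * φ * s φ
      = s m * s κ * φ * (s m * φ) * (s (s e) * s σ * φ * s φ) := by
        rw [h.comul_mul_left_inv, one_mul]
    _ = s m * s κ * φ * (s m * φ) := by rw [mul_assoc, h₂]
    _ = 1 := h.comul_mul_left_inv

theorem coform_twist_braiding (h : StrictBraided s m η φ ε κ σ σ')
    (d : FlipData s m φ ε σ σ' k e K K' τ τ') : e * K * σ' * s φ * σ = s ε := by
  have h₁ : e * K * σ' * s φ * σ * s φ = 1 := by
    rw [← h.coform_counit_left d]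
    simpa only [interchange s] using (sandwich (h.braiding_comul_left d) e (s φ)).symm
  calc e * K * σ' * s φ * σ = e * K * σ' * s φ * σ * (s (s ε) * s φ) := by
        simpa only [interchange s] using
          (sandwich (congrArg s h.counit_right) (e * K * σ' * s φ * σ) 1).symm
    _ = s ε * (e * K * σ' * s φ * σ * s φ) := by simp only [interchange s]
    _ = s ε := by rw [h₁, mul_one]

/-- The forms e and k are inverse to each other under convolution. Inserting (id⊗ε)φ in the second
strand between σ⁻¹ and σ produces the left side of `coform_twist_braiding`. -/
theorem coform_twist (h : StrictBraided s m η φ ε κ σ σ')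
    (d : FlipData s m φ ε σ σ' k e K K' τ τ') : e * K = ε * ε :=
  calc e * K = e * K * σ' * σ := by
        rw [mul_assoc _ σ', h.inv_left, mul_one]
    _ = e * K * σ' * (s ε * s φ) * σ := by
        rw [← map_mul s ε, h.counit_left, map_one, mul_one]
    _ = ε * (e * K * σ' * s φ * σ) := by
        have : e * K * σ' * (s (s ε) * s φ) * σ = ε * (e * K * σ' * s φ * σ) := by
          simp only [interchange s]
        rw [← this, ← map_mul s ε, h.counit_left, ← map_mul s (s ε), h.counit_right]
    _ = ε * ε := by rw [h.coform_twist_braiding d]; simp only [interchange s]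

/-- Counterpart of `braiding_counit_right` for σ⁻¹; it is what makes τσ⁻¹ a twist. -/
theorem coform_twist_inv (h : StrictBraided s m η φ ε κ σ σ')
    (d : FlipData s m φ ε σ σ' k e K K' τ τ') : ε * ε * σ' * s φ = s ε * σ' :=
  calc ε * ε * σ' * s φ = e * K * σ' * s φ * (σ * σ') := by
        rw [h.coform_twist d, h.inv_right, mul_one]
    _ = s ε * σ' := by rw [← mul_assoc, h.coform_twist_braiding d]

end StrictBraided

end Flip

end BraidedQG

namespace BraidedQG

set_option linter.unusedSectionVars false

/-! ### Invertibility of K and τ; colinearity of twists -/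

section FlipProps

variable {M : Type*} [Monoid M]

variable {s : M →* M} {m η φ ε κ σ σ' k e K K' τ τ' : M}
  [Local s 2 1 m] [Local s 0 1 η] [Local s 1 2 φ] [Local s 1 0 ε] [Local s 1 1 κ]
  [Local s 2 2 σ] [Local s 2 2 σ'] [Local s 2 0 k] [Local s 2 0 e]
  [Local s 2 2 K] [Local s 2 2 K'] [Local s 2 2 τ] [Local s 2 2 τ']

/-- A twist consumes only the inner legs of φ⊗φ, so by coassociativity the outer legs can still be
split before or after it. -/
theorem comul_twist {x : M} [Local s 2 0 x] (hφ : φ * φ = s φ * φ) :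
    φ * (s x * φ * s φ) = s (s x * φ * s φ) * φ :=
  calc φ * (s x * φ * s φ) = s (s x) * (φ * φ) * s φ := by simp only [interchange s]
    _ = s (s x) * (s φ * φ) * s φ := by rw [hφ]
    _ = s (s x * φ * s φ) * φ := by simp only [interchange s]

theorem shift_comul_twist {x : M} [Local s 2 0 x] (hφ : φ * φ = s φ * φ) :
    s φ * (s x * φ * s φ) = s x * φ * s φ * s φ :=
  calc s φ * (s x * φ * s φ) = s x * φ * s (s φ * φ) := by simp only [interchange s]
    _ = s x * φ * s φ * s φ := by rw [← hφ, map_mul]; simp only [mul_assoc]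

theorem counit_twist {x : M} [Local s 2 0 x] (hε : ε * φ = 1) :
    ε * (s x * φ * s φ) = x * s φ :=
  calc ε * (s x * φ * s φ) = x * (ε * φ) * s φ := by simp only [interchange s]
    _ = x * s φ := by rw [hε, mul_one]

theorem shift_counit_twist {x : M} [Local s 2 0 x] (hε : s ε * φ = 1) :
    s ε * (s x * φ * s φ) = s x * φ :=
  calc s ε * (s x * φ * s φ) = s x * φ * s (s ε * φ) := by simp only [interchange s]
    _ = s x * φ := by rw [hε, map_one, mul_one]

namespace StrictBraided

/-- K moves inwards through φ⊗φ, so K'K is the twist by eK = ε⊗ε, which is the identity. -/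
theorem cotwist_mul_twist (h : StrictBraided s m η φ ε κ σ σ')
    (d : FlipData s m φ ε σ σ' k e K K' τ τ') : K' * K = 1 :=
  calc K' * K = s e * φ * (s φ * K) := by rw [d.cotwist_eq]; simp only [mul_assoc]
    _ = s e * φ * (K * s φ) := by rw [d.twist_eq, shift_comul_twist h.coassoc]
    _ = s e * (φ * K) * s φ := by simp only [mul_assoc]
    _ = s e * (s K * φ) * s φ := by rw [d.twist_eq, comul_twist h.coassoc]
    _ = s (e * K) * φ * s φ := by simp only [map_mul, mul_assoc]
    _ = s ε * s ε * φ * s φ := by rw [h.coform_twist d, map_mul]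
    _ = s ε * (s ε * φ) * s φ := by simp only [mul_assoc]
    _ = s (ε * φ) := by rw [h.counit_right, mul_one, map_mul]
    _ = 1 := by rw [h.counit_left, map_one]

/-- Inserting K'K on the last two strands lets `braiding_comul_right` absorb σ⁻¹, leaving a formula
for τ in which only σ occurs. -/
theorem flip_eq_coform (h : StrictBraided s m η φ ε κ σ σ')
    (d : FlipData s m φ ε σ σ' k e K K' τ τ') : τ = s (s e) * s φ * σ * s φ :=
  calc τ = s (s ε) * s (K' * K) * s σ' * φ * σ := by
        rw [h.cotwist_mul_twist d, map_one, mul_one, d.flip_eq]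
    _ = s (s ε * K') * (s K * s σ' * φ * σ) := by simp only [map_mul, mul_assoc]
    _ = s (s e * φ) * (σ * s φ) := by
        rw [d.cotwist_eq, shift_counit_twist h.counit_right, h.braiding_comul_right d]
    _ = s (s e) * s φ * σ * s φ := by simp only [map_mul, mul_assoc]

theorem coflip_mul_flip (h : StrictBraided s m η φ ε κ σ σ')
    (d : FlipData s m φ ε σ σ' k e K K' τ τ') : τ' * τ = 1 :=
  calc τ' * τ = K * σ' * (s (s e) * s φ * σ * s φ) := by
        rw [d.coflip_eq, h.flip_eq_coform d]
    _ = s (s e) * (K * σ' * s φ * σ) * s φ := by simp only [interchange s]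
    _ = 1 := by
        rw [← h.braiding_comul_left d, ← h.coform_counit_right d]
        simp only [mul_assoc]

/-- So far K has only a left inverse K'. The identity τ'τ = 1 with τ' = Kσ⁻¹ exhibits σ⁻¹τ as a
right inverse, so the two coincide; K and τ become invertible on both sides. -/
theorem cotwist_eq_inv_mul_flip (h : StrictBraided s m η φ ε κ σ σ')
    (d : FlipData s m φ ε σ σ' k e K K' τ τ') : K' = σ' * τ := by
  refine left_inv_eq_right_inv (h.cotwist_mul_twist d) ?_
  rw [← mul_assoc, ← d.coflip_eq, h.coflip_mul_flip d]

theorem twist_mul_cotwist (h : StrictBraided s m η φ ε κ σ σ')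
    (d : FlipData s m φ ε σ σ' k e K K' τ τ') : K * K' = 1 := by
  rw [h.cotwist_eq_inv_mul_flip d, ← mul_assoc, ← d.coflip_eq, h.coflip_mul_flip d]

theorem flip_eq_mul_cotwist (h : StrictBraided s m η φ ε κ σ σ')
    (d : FlipData s m φ ε σ σ' k e K K' τ τ') : τ = σ * K' := by
  rw [h.cotwist_eq_inv_mul_flip d, ← mul_assoc, h.inv_right, one_mul]

theorem braiding_eq_flip_mul_twist (h : StrictBraided s m η φ ε κ σ σ')
    (d : FlipData s m φ ε σ σ' k e K K' τ τ') : σ = τ * K := by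
  rw [h.flip_eq_mul_cotwist d, mul_assoc, h.cotwist_mul_twist d, mul_one]

theorem flip_mul_coflip (h : StrictBraided s m η φ ε κ σ σ')
    (d : FlipData s m φ ε σ σ' k e K K' τ τ') : τ * τ' = 1 := by
  rw [d.coflip_eq, ← mul_assoc, ← h.braiding_eq_flip_mul_twist d, h.inv_right]

theorem comul_twist_eq (h : StrictBraided s m η φ ε κ σ σ')
    (d : FlipData s m φ ε σ σ' k e K K' τ τ') : φ * K = s K * φ := by
  rw [d.twist_eq, comul_twist h.coassoc]

theorem shift_comul_twist_eq (h : StrictBraided s m η φ ε κ σ σ')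
    (d : FlipData s m φ ε σ σ' k e K K' τ τ') : s φ * K = K * s φ := by
  rw [d.twist_eq, shift_comul_twist h.coassoc]

theorem comul_cotwist_eq (h : StrictBraided s m η φ ε κ σ σ')
    (d : FlipData s m φ ε σ σ' k e K K' τ τ') : φ * K' = s K' * φ := by
  rw [d.cotwist_eq, comul_twist h.coassoc]

theorem shift_comul_cotwist_eq (h : StrictBraided s m η φ ε κ σ σ')
    (d : FlipData s m φ ε σ σ' k e K K' τ τ') : s φ * K' = K' * s φ := by
  rw [d.cotwist_eq, shift_comul_twist h.coassoc]

theorem shift_comul_braiding (h : StrictBraided s m η φ ε κ σ σ')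
    (d : FlipData s m φ ε σ σ' k e K K' τ τ') : s φ * σ = τ * s σ * φ :=
  calc s φ * σ = τ * τ' * s φ * σ := by rw [h.flip_mul_coflip d, one_mul]
    _ = τ * (K * σ' * s φ * σ) := by rw [d.coflip_eq]; simp only [mul_assoc]
    _ = τ * s σ * φ := by rw [← h.braiding_comul_left d, mul_assoc]

theorem comul_braiding (h : StrictBraided s m η φ ε κ σ σ')
    (d : FlipData s m φ ε σ σ' k e K K' τ τ') : φ * σ = s τ * σ * s φ :=
  calc φ * σ = s (τ * τ') * φ * σ := by
        rw [h.flip_mul_coflip d, map_one, one_mul]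
    _ = s τ * (s K * s σ' * φ * σ) := by
        rw [d.coflip_eq]; simp only [map_mul, mul_assoc]
    _ = s τ * σ * s φ := by rw [← h.braiding_comul_right d, mul_assoc]

theorem shift_comul_flip (h : StrictBraided s m η φ ε κ σ σ')
    (d : FlipData s m φ ε σ σ' k e K K' τ τ') : s φ * τ = τ * s τ * φ :=
  calc s φ * τ = s φ * σ * K' := by rw [h.flip_eq_mul_cotwist d, ← mul_assoc]
    _ = τ * s σ * (φ * K') := by rw [h.shift_comul_braiding d, mul_assoc]
    _ = τ * s (σ * K') * φ := by
        rw [h.comul_cotwist_eq d, map_mul]; simp only [mul_assoc]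
    _ = τ * s τ * φ := by rw [← h.flip_eq_mul_cotwist d]

theorem comul_flip (h : StrictBraided s m η φ ε κ σ σ')
    (d : FlipData s m φ ε σ σ' k e K K' τ τ') : φ * τ = s τ * τ * s φ :=
  calc φ * τ = φ * σ * K' := by rw [h.flip_eq_mul_cotwist d, ← mul_assoc]
    _ = s τ * σ * (s φ * K') := by rw [h.comul_braiding d, mul_assoc]
    _ = s τ * (σ * K') * s φ := by
        rw [h.shift_comul_cotwist_eq d]; simp only [mul_assoc]
    _ = s τ * τ * s φ := by rw [← h.flip_eq_mul_cotwist d]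

theorem counit_coflip (h : StrictBraided s m η φ ε κ σ σ')
    (d : FlipData s m φ ε σ σ' k e K K' τ τ') : ε * τ' = s ε := by
  rw [d.coflip_eq, d.twist_eq, ← mul_assoc, counit_twist h.counit_left,
    ← h.braiding_counit_right d, mul_assoc, h.inv_right, mul_one]

theorem shift_counit_coflip (h : StrictBraided s m η φ ε κ σ σ')
    (d : FlipData s m φ ε σ σ' k e K K' τ τ') : s ε * τ' = ε := by
  rw [d.coflip_eq, d.twist_eq, ← mul_assoc, shift_counit_twist h.counit_right,
    ← h.braiding_counit_left d, mul_assoc, h.inv_right, mul_one]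

theorem counit_flip (h : StrictBraided s m η φ ε κ σ σ')
    (d : FlipData s m φ ε σ σ' k e K K' τ τ') : ε * τ = s ε :=
  calc ε * τ = s ε * τ' * τ := by rw [h.shift_counit_coflip d]
    _ = s ε := by rw [mul_assoc, h.coflip_mul_flip d, mul_one]

theorem shift_counit_flip (h : StrictBraided s m η φ ε κ σ σ')
    (d : FlipData s m φ ε σ σ' k e K K' τ τ') : s ε * τ = ε := by
  rw [← h.counit_coflip d, mul_assoc, h.coflip_mul_flip d, mul_one]

/-- Being the twist by (ε⊗ε)σ⁻¹, the operator τσ⁻¹ is colinear on both sides, and its inverse στ⁻¹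
inherits this. -/
theorem flip_mul_inv (h : StrictBraided s m η φ ε κ σ σ')
    (d : FlipData s m φ ε σ σ' k e K K' τ τ') :
    τ * σ' = s (ε * ε * σ') * φ * s φ :=
  calc τ * σ' = s (s ε * σ') * φ * (σ * σ') := by
        rw [d.flip_eq]; simp only [map_mul, mul_assoc]
    _ = s (ε * ε * σ' * s φ) * φ := by
        rw [h.inv_right, mul_one, h.coform_twist_inv d]
    _ = s (ε * ε * σ') * φ * s φ := by simp only [interchange s]

theorem comul_flip_inv (h : StrictBraided s m η φ ε κ σ σ')
    (d : FlipData s m φ ε σ σ' k e K K' τ τ') : φ * (σ * τ') = s (σ * τ') * φ := by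
  have : Local s 2 0 (ε * ε * σ') := ⟨fun y => by simp only [interchange s]⟩
  have h₁ : φ * (τ * σ') = s (τ * σ') * φ := by
    rw [h.flip_mul_inv d, comul_twist h.coassoc]
  have h₂ : τ * σ' * (σ * τ') = 1 := by
    rw [mul_assoc, ← mul_assoc σ', h.inv_left, one_mul,
      h.flip_mul_coflip d]
  have h₃ : σ * τ' * (τ * σ') = 1 := by
    rw [mul_assoc, ← mul_assoc τ', h.coflip_mul_flip d, one_mul,
      h.inv_right]
  calc φ * (σ * τ') = s (σ * τ' * (τ * σ')) * φ * (σ * τ') := by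
        rw [h₃, map_one, one_mul]
    _ = s (σ * τ') * (s (τ * σ') * φ) * (σ * τ') := by
        rw [map_mul]; simp only [mul_assoc]
    _ = s (σ * τ') * φ * (τ * σ' * (σ * τ')) := by
        rw [← h₁]; simp only [mul_assoc]
    _ = s (σ * τ') * φ := by rw [h₂, mul_one]

theorem shift_comul_flip_inv (h : StrictBraided s m η φ ε κ σ σ')
    (d : FlipData s m φ ε σ σ' k e K K' τ τ') : s φ * (σ * τ') = σ * τ' * s φ := by
  have : Local s 2 0 (ε * ε * σ') := ⟨fun y => by simp only [interchange s]⟩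
  have h₁ : s φ * (τ * σ') = τ * σ' * s φ := by
    rw [h.flip_mul_inv d, shift_comul_twist h.coassoc]
  have h₂ : τ * σ' * (σ * τ') = 1 := by
    rw [mul_assoc, ← mul_assoc σ', h.inv_left, one_mul,
      h.flip_mul_coflip d]
  calc s φ * (σ * τ') = σ * τ' * (τ * σ' * s φ) * (σ * τ') := by
        simp only [mul_assoc, cancel s h.inv_right, cancel s (h.coflip_mul_flip d)]
    _ = σ * τ' * s φ * (τ * σ' * (σ * τ')) := by
        rw [← h₁]; simp only [mul_assoc]
    _ = σ * τ' * s φ := by rw [h₂, mul_one]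

/-- The factorisation σ = τK puts K on the two middle strands. Colinearity of στ⁻¹ gives a second
way through the coproduct, and comparing the two shows that on the image of φ⊗φ the factor may sit
on strands 1 and 2, after τ. -/
theorem twist_flip_comul (h : StrictBraided s m η φ ε κ σ σ')
    (d : FlipData s m φ ε σ σ' k e K K' τ τ') :
    K * s τ * φ * s φ = s σ * φ * s φ :=
  calc K * s τ * φ * s φ = τ' * τ * K * (τ' * τ) * s τ * φ * s φ := by
        rw [h.coflip_mul_flip d, one_mul, mul_one]
    _ = τ' * (τ * K) * τ' * (τ * s τ * φ) * s φ := by simp only [mul_assoc]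
    _ = τ' * σ * τ' * (s φ * τ) * s φ := by
        rw [← h.braiding_eq_flip_mul_twist d, h.shift_comul_flip d]
    _ = τ' * (σ * τ' * s φ) * τ * s φ := by simp only [mul_assoc]
    _ = τ' * (s φ * σ) * (τ' * τ) * s φ := by
        rw [← h.shift_comul_flip_inv d]; simp only [mul_assoc]
    _ = (τ' * τ) * s σ * φ * s φ := by
        rw [h.shift_comul_braiding d]
        simp only [mul_assoc, one_mul, cancel s (h.coflip_mul_flip d)]
    _ = s σ * φ * s φ := by rw [h.coflip_mul_flip d, one_mul]

theorem shift_twist_flip_comul (h : StrictBraided s m η φ ε κ σ σ')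
    (d : FlipData s m φ ε σ σ' k e K K' τ τ') :
    s (s K) * s τ * φ * s φ = s σ * φ * s φ := by
  have h₁ : s K * τ * s φ = σ * s φ :=
    calc s K * τ * s φ = s (τ' * τ) * s K * s (τ' * τ) * τ * s φ := by
          rw [h.coflip_mul_flip d, map_one, one_mul, mul_one]
      _ = s τ' * s (τ * K) * s τ' * (s τ * τ * s φ) := by
          simp only [map_mul, mul_assoc]
      _ = s τ' * (s (σ * τ') * φ) * τ := by
          rw [← h.braiding_eq_flip_mul_twist d, ← h.comul_flip d, map_mul]
          simp only [mul_assoc]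
      _ = s τ' * (φ * σ) * (τ' * τ) := by
          rw [← h.comul_flip_inv d]; simp only [mul_assoc]
      _ = s (τ' * τ) * σ * s φ := by
          rw [h.coflip_mul_flip d, h.comul_braiding d, map_one]
          simp only [mul_assoc, cancel s (h.coflip_mul_flip d), mul_one,
            one_mul]
      _ = σ * s φ := by rw [h.coflip_mul_flip d, map_one, one_mul]
  simpa only [interchange s] using sandwich (congrArg s h₁) 1 φ

end StrictBraided

end FlipProps

end BraidedQG

namespace BraidedQG

set_option linter.unusedSectionVars false

/-! ### The product m₀, multiplicativity of e, and twists across a strand -/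

section Slide

variable {M : Type*} [Monoid M]

/-- The product `m₀ = m K` and the conjugates of the twists by the secondary flip on three
strands. -/
structure SlideData (s : M →* M) (m K K' τ τ' m₀ P P' Q Q' : M) : Prop where
  mul_eq : m₀ = m * K
  left_eq : P = s τ' * K * s τ
  left_inv_eq : P' = s τ' * K' * s τ
  right_eq : Q = τ' * s K * τ
  right_inv_eq : Q' = τ' * s K' * τ

variable {s : M →* M} {m η φ ε κ σ σ' k e K K' τ τ' m₀ P P' Q Q' : M}
  [Local s 2 1 m] [Local s 0 1 η] [Local s 1 2 φ] [Local s 1 0 ε] [Local s 1 1 κ]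
  [Local s 2 2 σ] [Local s 2 2 σ'] [Local s 2 0 k] [Local s 2 0 e]
  [Local s 2 2 K] [Local s 2 2 K'] [Local s 2 2 τ] [Local s 2 2 τ']
  [Local s 2 1 m₀] [Local s 3 3 P] [Local s 3 3 P'] [Local s 3 3 Q] [Local s 3 3 Q']

namespace StrictBraided

theorem comul_comul_twist (h : StrictBraided s m η φ ε κ σ σ')
    (d : FlipData s m φ ε σ σ' k e K K' τ τ') : φ * s φ * K = s K * φ * s φ := by
  rw [mul_assoc, h.shift_comul_twist_eq d, ← mul_assoc, h.comul_twist_eq d]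

theorem mul_eq_mul_cotwist (h : StrictBraided s m η φ ε κ σ σ')
    (d : FlipData s m φ ε σ σ' k e K K' τ τ') (c : SlideData s m K K' τ τ' m₀ P P' Q Q') :
    m = m₀ * K' := by
  rw [c.mul_eq, mul_assoc, h.twist_mul_cotwist d, mul_one]

theorem counit_mul_zero (h : StrictBraided s m η φ ε κ σ σ')
    (d : FlipData s m φ ε σ σ' k e K K' τ τ') (c : SlideData s m K K' τ τ' m₀ P P' Q Q') :
    ε * m₀ = ε * ε := by
  rw [c.mul_eq, ← mul_assoc, ← d.coform_eq, h.coform_twist d]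

theorem counit_cotwist (h : StrictBraided s m η φ ε κ σ σ')
    (d : FlipData s m φ ε σ σ' k e K K' τ τ') : ε * ε * K' = e := by
  rw [← h.coform_twist d, mul_assoc, h.twist_mul_cotwist d, mul_one]

/-- Two factors K are needed for m₀⊗m₀. One comes from replacing σ₂₃ by K₁₂τ₂₃. The other is the K
inside m₀: it passes φ⊗φ to the middle, rebuilds σ = τK there, and leaves again as K₃₄. -/
theorem comul_mul_zero (h : StrictBraided s m η φ ε κ σ σ')
    (d : FlipData s m φ ε σ σ' k e K K' τ τ') (c : SlideData s m K K' τ τ' m₀ P P' Q Q') :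
    φ * m₀ = m₀ * s (s m₀) * s τ * φ * s φ :=
  calc φ * m₀ = m * s (s m) * s σ * (φ * s φ * K) := by
        rw [c.mul_eq, ← mul_assoc, h.comul_mul]; simp only [mul_assoc]
    _ = m * s (s m) * (K * s τ * φ * s φ) * K := by
        rw [h.twist_flip_comul d]; simp only [mul_assoc]
    _ = m * s (s m) * K * s τ * (s K * φ * s φ) := by
        rw [← h.comul_comul_twist d]; simp only [mul_assoc]
    _ = m * s (s m) * K * (s σ * φ * s φ) := by
        rw [h.braiding_eq_flip_mul_twist d]; simp only [map_mul, mul_assoc]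
    _ = m * s (s m) * K * (s (s K) * s τ * φ * s φ) := by rw [h.shift_twist_flip_comul d]
    _ = m₀ * s (s m₀) * s τ * φ * s φ := by rw [c.mul_eq]; simp only [interchange s]

theorem comul_braiding' (h : StrictBraided s m η φ ε κ σ σ')
    (d : FlipData s m φ ε σ σ' k e K K' τ τ') : φ * σ = s σ * τ * s φ :=
  calc φ * σ = φ * (σ * τ') * τ := by
        simp only [mul_assoc, cancel s (h.coflip_mul_flip d), mul_one]
    _ = s (σ * τ') * (φ * τ) := by rw [h.comul_flip_inv d, mul_assoc]
    _ = s σ * τ * s φ := by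
        rw [h.comul_flip d]
        simp only [map_mul, mul_assoc, cancel s (h.coflip_mul_flip d)]

theorem shift_comul_braiding' (h : StrictBraided s m η φ ε κ σ σ')
    (d : FlipData s m φ ε σ σ' k e K K' τ τ') : s φ * σ = σ * s τ * φ :=
  calc s φ * σ = s φ * (σ * τ') * τ := by
        simp only [mul_assoc, cancel s (h.coflip_mul_flip d), mul_one]
    _ = σ * τ' * (s φ * τ) := by rw [h.shift_comul_flip_inv d, mul_assoc]
    _ = σ * s τ * φ := by
        rw [h.shift_comul_flip d]
        simp only [mul_assoc, cancel s (h.coflip_mul_flip d)]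

/-- The form `ε m` is multiplicative in its second argument. -/
theorem coform_mul_right (h : StrictBraided s m η φ ε κ σ σ')
    (d : FlipData s m φ ε σ σ' k e K K' τ τ') (c : SlideData s m K K' τ τ' m₀ P P' Q Q') :
    e * s m₀ = e * s e * φ * s τ := by
  have h₁ : e * ε * σ * s φ = ε * ε :=
    calc e * ε * σ * s φ = e * K := by
          rw [mul_assoc e, h.braiding_counit_left d, d.twist_eq]; simp only [mul_assoc]
      _ = ε * ε := h.coform_twist d
  have h₂ : ε * σ * m = m * s k * φ * s σ :=
    calc ε * σ * m = m * (ε * σ) * s σ := by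
          simpa only [interchange s] using sandwich h.braiding_mul_left ε 1
      _ = m * s k * φ * s σ := by rw [h.braiding_counit_left d]; simp only [mul_assoc]
  -- The auxiliary operator B = `s m * σ * s φ` contracts to m₀ under ε on its first strand. Here B
  -- is paired with e and k; the next two facts move φ and K' through it.
  have h₃ : e * s k * φ * s (s m * σ * s φ) = e * s (s ε) :=
    calc e * s k * φ * s (s m * σ * s φ) = ε * (m * s m) * s k * φ * s σ * s (s φ) := by
          rw [d.coform_eq]; simp only [interchange s]
      _ = e * (m * s k * φ * s σ) * s (s φ) := by
          rw [← h.assoc, d.coform_eq]; simp only [mul_assoc]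
      _ = e * ε * σ * s φ * m := by rw [← h₂]; simp only [interchange s]
      _ = e * s (s ε) := by rw [h₁, d.coform_eq]; simp only [interchange s]
  have h₄ : φ * (s m * σ * s φ) = s (s m * σ * s φ) * τ * s φ :=
    calc φ * (s m * σ * s φ) = s (s m) * (φ * σ) * s φ := by simp only [interchange s]
      _ = s (s m) * s σ * τ * s (φ * φ) := by
          rw [h.comul_braiding' d, map_mul]; simp only [mul_assoc]
      _ = s (s m * σ * s φ) * τ * s φ := by rw [h.coassoc]; simp only [interchange s]
  have h₅ : K' * s (s m * σ * s φ) = s (s m * σ * s φ) * s e * φ * s τ * s (s φ) :=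
    calc K' * s (s m * σ * s φ) = s e * φ * s (φ * (s m * σ * s φ)) := by
          rw [d.cotwist_eq]; simp only [map_mul, mul_assoc]
      _ = s (s m * σ * s φ) * s e * φ * s τ * s (s φ) := by
          rw [h₄]; simp only [interchange s]
  calc e * s m₀ = e * s (m * (s k * φ * s φ)) := by rw [c.mul_eq, d.twist_eq]
    _ = e * s (m * (ε * σ) * s φ) := by
        rw [h.braiding_counit_left d]; simp only [mul_assoc]
    _ = e * (s ε * (K * K')) * s (s m * σ * s φ) := by
        rw [h.twist_mul_cotwist d]; simp only [interchange s]
    _ = e * (s ε * K) * (K' * s (s m * σ * s φ)) := by simp only [mul_assoc]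
    _ = e * s k * φ * s (s m * σ * s φ) * (s e * φ * s τ * s (s φ)) := by
        rw [h₅, d.twist_eq, shift_counit_twist h.counit_right]; simp only [mul_assoc]
    _ = e * s e * φ * s τ * s (s (s ε * φ)) := by
        rw [h₃]; simp only [interchange s]
    _ = e * s e * φ * s τ := by
        rw [h.counit_right, map_one, map_one, mul_one]

/-- The form `ε m` is multiplicative in its first argument. -/
theorem coform_mul_left (h : StrictBraided s m η φ ε κ σ σ')
    (d : FlipData s m φ ε σ σ' k e K K' τ τ') (c : SlideData s m K K' τ τ' m₀ P P' Q Q') :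
    e * m₀ = e * s e * s (s φ) * τ := by
  have h₁ : e * s (s ε) * s σ * φ = ε * ε :=
    calc e * s (s ε) * s σ * φ = e * s (s ε * σ) * φ := by
          simp only [map_mul, mul_assoc]
      _ = e * K := by
          rw [h.braiding_counit_right d, twist_eq' d]; simp only [map_mul, mul_assoc]
      _ = ε * ε := h.coform_twist d
  have h₂ : s ε * σ * s m = m * s (k * s φ) * σ :=
    calc s ε * σ * s m = m * s (s ε * σ) * σ := by
          simpa only [interchange s] using sandwich h.braiding_mul_right (s ε) 1
      _ = m * s (k * s φ) * σ := by rw [h.braiding_counit_right d]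
  -- The mirror operator `m * s σ * φ` contracts to m₀ under ε on its second strand.
  have h₃ : e * s k * s (s φ) * (m * s σ * φ) = e * ε :=
    calc e * s k * s (s φ) * (m * s σ * φ)
        = ε * (m * m) * s (s k) * s (s (s φ)) * s σ * φ := by
          rw [d.coform_eq]; simp only [interchange s]
      _ = e * s (m * s (k * s φ) * σ) * φ := by
          rw [h.assoc, d.coform_eq]; simp only [map_mul, mul_assoc]
      _ = e * s (s ε) * s σ * φ * s m := by rw [← h₂]; simp only [interchange s]
      _ = e * ε := by rw [h₁, d.coform_eq]; simp only [interchange s]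
  have h₄ : s φ * (m * s σ * φ) = m * s σ * φ * s τ * φ :=
    calc s φ * (m * s σ * φ) = m * s (s φ * σ) * φ := by simp only [interchange s]
      _ = m * s σ * s (s τ) * (s φ * φ) := by
          rw [h.shift_comul_braiding' d]; simp only [map_mul, mul_assoc]
      _ = m * s σ * φ * s τ * φ := by rw [← h.coassoc]; simp only [interchange s]
  have h₅ : s K' * (m * s σ * φ) =
      m * s σ * φ * s (s e) * s (s (s φ)) * s τ * φ :=
    calc s K' * (m * s σ * φ) = s (s e) * s (s (s φ)) * (s φ * (m * s σ * φ)) := by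
          rw [cotwist_eq' d]; simp only [map_mul, mul_assoc]
      _ = m * s σ * φ * s (s e) * s (s (s φ)) * s τ * φ := by
          rw [h₄]; simp only [interchange s]
  calc e * m₀ = e * (m * (s k * s (s φ) * φ)) := by rw [c.mul_eq, twist_eq' d]
    _ = e * m * s (s ε * σ) * φ := by
        rw [h.braiding_counit_right d]; simp only [map_mul, mul_assoc]
    _ = e * s (ε * (K * K')) * (m * s σ * φ) := by
        rw [h.twist_mul_cotwist d]; simp only [interchange s]
    _ = e * s (ε * K) * (s K' * (m * s σ * φ)) := by simp only [map_mul, mul_assoc]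
    _ = e * s k * s (s φ) * (m * s σ * φ) * (s (s e) * s (s (s φ)) * s τ * φ) := by
        rw [h₅, d.twist_eq, counit_twist h.counit_left]; simp only [map_mul, mul_assoc]
    _ = e * s e * s (s φ) * τ * (ε * φ) := by rw [h₃]; simp only [interchange s]
    _ = e * s e * s (s φ) * τ := by rw [h.counit_left, mul_one]

/-- Conjugation of a twist of the first two strands by the secondary flip. -/
theorem conj_twist_left (h : StrictBraided s m η φ ε κ σ σ')
    (d : FlipData s m φ ε σ σ' k e K K' τ τ') {x : M} [Local s 2 0 x] :
    s τ' * (s x * φ * s φ) * s τ = s x * φ * s τ * s (s φ) :=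
  calc s τ' * (s x * φ * s φ) * s τ = s τ' * (s x * φ * s (φ * τ)) := by
        simp only [map_mul, mul_assoc]
    _ = s τ' * s τ * (s x * φ * s τ * s (s φ)) := by
        rw [h.comul_flip d]; simp only [interchange s]
    _ = s x * φ * s τ * s (s φ) := by
        rw [← map_mul, h.coflip_mul_flip d, map_one, one_mul]

/-- Conjugation of a twist of the last two strands by the secondary flip. -/
theorem conj_twist_right (h : StrictBraided s m η φ ε κ σ σ')
    (d : FlipData s m φ ε σ σ' k e K K' τ τ') {x : M} [Local s 2 0 x] :
    τ' * s (s x * φ * s φ) * τ = s (s x) * s (s (s φ)) * s τ * φ :=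
  calc τ' * s (s x * φ * s φ) * τ = τ' * (s (s x) * s (s (s φ)) * (s φ * τ)) := by
        simp only [interchange s]
    _ = τ' * τ * (s (s x) * s (s (s φ)) * s τ * φ) := by
        rw [h.shift_comul_flip d]; simp only [interchange s]
    _ = s (s x) * s (s (s φ)) * s τ * φ := by rw [h.coflip_mul_flip d, one_mul]

theorem left_eq' (h : StrictBraided s m η φ ε κ σ σ')
    (d : FlipData s m φ ε σ σ' k e K K' τ τ') (c : SlideData s m K K' τ τ' m₀ P P' Q Q') :
    P = s k * φ * s τ * s (s φ) := by
  rw [c.left_eq, d.twist_eq, h.conj_twist_left d]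

theorem left_inv_eq' (h : StrictBraided s m η φ ε κ σ σ')
    (d : FlipData s m φ ε σ σ' k e K K' τ τ') (c : SlideData s m K K' τ τ' m₀ P P' Q Q') :
    P' = s e * φ * s τ * s (s φ) := by
  rw [c.left_inv_eq, d.cotwist_eq, h.conj_twist_left d]

theorem right_eq' (h : StrictBraided s m η φ ε κ σ σ')
    (d : FlipData s m φ ε σ σ' k e K K' τ τ') (c : SlideData s m K K' τ τ' m₀ P P' Q Q') :
    Q = s (s k) * s (s (s φ)) * s τ * φ := by
  rw [c.right_eq, d.twist_eq, h.conj_twist_right d]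

theorem right_inv_eq' (h : StrictBraided s m η φ ε κ σ σ')
    (d : FlipData s m φ ε σ σ' k e K K' τ τ') (c : SlideData s m K K' τ τ' m₀ P P' Q Q') :
    Q' = s (s e) * s (s (s φ)) * s τ * φ := by
  rw [c.right_inv_eq, d.cotwist_eq, h.conj_twist_right d]

theorem left_mul_inv (h : StrictBraided s m η φ ε κ σ σ')
    (d : FlipData s m φ ε σ σ' k e K K' τ τ') (c : SlideData s m K K' τ τ' m₀ P P' Q Q') :
    P * P' = 1 := by
  rw [c.left_eq, c.left_inv_eq]
  simp only [mul_assoc, cancel s (h.flip_mul_coflip d), cancel s (h.coflip_mul_flip d),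
    cancel s (h.twist_mul_cotwist d)]

theorem left_inv_mul (h : StrictBraided s m η φ ε κ σ σ')
    (d : FlipData s m φ ε σ σ' k e K K' τ τ') (c : SlideData s m K K' τ τ' m₀ P P' Q Q') :
    P' * P = 1 := by
  rw [c.left_eq, c.left_inv_eq]
  simp only [mul_assoc, cancel s (h.flip_mul_coflip d), cancel s (h.coflip_mul_flip d),
    cancel s (h.cotwist_mul_twist d)]

theorem right_mul_inv (h : StrictBraided s m η φ ε κ σ σ')
    (d : FlipData s m φ ε σ σ' k e K K' τ τ') (c : SlideData s m K K' τ τ' m₀ P P' Q Q') :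
    Q * Q' = 1 := by
  rw [c.right_eq, c.right_inv_eq]
  simp only [mul_assoc, cancel s (h.flip_mul_coflip d), cancel s (h.coflip_mul_flip d),
    cancel s (h.twist_mul_cotwist d)]

theorem right_inv_mul (h : StrictBraided s m η φ ε κ σ σ')
    (d : FlipData s m φ ε σ σ' k e K K' τ τ') (c : SlideData s m K K' τ τ' m₀ P P' Q Q') :
    Q' * Q = 1 := by
  rw [c.right_eq, c.right_inv_eq]
  simp only [mul_assoc, cancel s (h.flip_mul_coflip d), cancel s (h.coflip_mul_flip d),
    cancel s (h.cotwist_mul_twist d)]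

/-- Multiplicativity of e lifted from the form to its twist. P' is K' acting on strands 1 and 3,
with strand 2 moved out of the way by τ. -/
theorem cotwist_mul_zero_right (h : StrictBraided s m η φ ε κ σ σ')
    (d : FlipData s m φ ε σ σ' k e K K' τ τ') (c : SlideData s m K K' τ τ' m₀ P P' Q Q') :
    K' * s m₀ = s m₀ * K' * P' :=
  calc K' * s m₀ = s e * φ * s (φ * m₀) := by
        rw [d.cotwist_eq]; simp only [map_mul, mul_assoc]
    _ = s (e * s m₀) * φ * s (s (s m₀)) * s (s τ) * s φ * s (s φ) := by
        rw [h.comul_mul_zero d c]; simp only [interchange s]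
    _ = s m₀ * s e * s (s e) * s φ * φ * s (τ * s τ * φ) * s (s φ) := by
        rw [h.coform_mul_right d c]; simp only [interchange s]
    _ = s m₀ * s e * s (s e) * (s φ * φ) * s (s φ) * s τ * s (s φ) := by
        rw [← h.shift_comul_flip d]; simp only [map_mul, mul_assoc]
    _ = s m₀ * K' * P' := by
        rw [← h.coassoc, d.cotwist_eq, h.left_inv_eq' d c]; simp only [interchange s]

theorem cotwist_mul_zero_left (h : StrictBraided s m η φ ε κ σ σ')
    (d : FlipData s m φ ε σ σ' k e K K' τ τ') (c : SlideData s m K K' τ τ' m₀ P P' Q Q') :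
    K' * m₀ = m₀ * s K' * Q' :=
  calc K' * m₀ = s e * s (s φ) * (φ * m₀) := by
        rw [cotwist_eq' d]; simp only [mul_assoc]
    _ = m₀ * s (s (e * m₀)) * s (s (s (s φ))) * s τ * φ * s φ := by
        rw [h.comul_mul_zero d c]; simp only [interchange s]
    _ = m₀ * s (s e) * s (s (s e)) * s (s (s (s φ))) * s (s (s (s φ))) *
          s (s τ * τ * s φ) * φ := by
        rw [h.coform_mul_left d c]; simp only [interchange s]
    _ = m₀ * s (s e) * s (s (s e)) * s (s (s (s (s φ * φ)))) * s φ * s τ * φ := by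
        rw [← h.comul_flip d, ← h.coassoc]; simp only [interchange s]
    _ = m₀ * s K' * Q' := by
        rw [cotwist_eq' d, h.right_inv_eq' d c]; simp only [interchange s]

end StrictBraided

end Slide

end BraidedQG

namespace BraidedQG

set_option linter.unusedSectionVars false

/-! ### The equality P = Q, naturality of τ for m₀, associativity of m₀ -/

section Transparent

variable {M : Type*} [Monoid M]

variable {s : M →* M} {m η φ ε κ σ σ' k e K K' τ τ' m₀ P P' Q Q' : M}
  [Local s 2 1 m] [Local s 0 1 η] [Local s 1 2 φ] [Local s 1 0 ε] [Local s 1 1 κ]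
  [Local s 2 2 σ] [Local s 2 2 σ'] [Local s 2 0 k] [Local s 2 0 e]
  [Local s 2 2 K] [Local s 2 2 K'] [Local s 2 2 τ] [Local s 2 2 τ']
  [Local s 2 1 m₀] [Local s 3 3 P] [Local s 3 3 P'] [Local s 3 3 Q] [Local s 3 3 Q']

/-- A twist of strands 1 and 2 meets strand 2 only through the left leg of its coproduct, so it
ignores a left-colinear y on strands 2 and 3. -/
theorem twist_commute_right {x y : M} [Local s 2 0 x] [Local s 2 2 y] (hy : φ * y = s y * φ) :
    s x * φ * s φ * s y = s y * (s x * φ * s φ) :=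
  calc s x * φ * s φ * s y = s x * φ * s (φ * y) := by simp only [map_mul, mul_assoc]
    _ = s y * (s x * φ * s φ) := by rw [hy]; simp only [interchange s]

theorem twist_commute_left {x y : M} [Local s 2 0 x] [Local s 2 2 y]
    (hy : s φ * y = y * s φ) :
    s (s x * φ * s φ) * y = y * s (s x * φ * s φ) :=
  calc s (s x * φ * s φ) * y = s (s x) * (s φ * y) * s (s φ) := by simp only [interchange s]
    _ = y * s (s x * φ * s φ) := by rw [hy]; simp only [interchange s]

namespace StrictBraided

theorem twist_mul_zero_right (h : StrictBraided s m η φ ε κ σ σ')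
    (d : FlipData s m φ ε σ σ' k e K K' τ τ') (c : SlideData s m K K' τ τ' m₀ P P' Q Q') :
    K * s m₀ = s m₀ * P * K :=
  calc K * s m₀ = K * (s m₀ * K' * P') * (P * K) := by
        simp only [mul_assoc, cancel s (h.left_inv_mul d c), cancel s (h.cotwist_mul_twist d),
          mul_one]
    _ = s m₀ * P * K := by
        rw [← h.cotwist_mul_zero_right d c]
        simp only [mul_assoc, cancel s (h.twist_mul_cotwist d)]

theorem twist_mul_zero_left (h : StrictBraided s m η φ ε κ σ σ')
    (d : FlipData s m φ ε σ σ' k e K K' τ τ') (c : SlideData s m K K' τ τ' m₀ P P' Q Q') :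
    K * m₀ = m₀ * Q * s K :=
  calc K * m₀ = K * (m₀ * s K' * Q') * (Q * s K) := by
        simp only [mul_assoc, cancel s (h.right_inv_mul d c), cancel s (h.cotwist_mul_twist d),
          mul_one]
    _ = m₀ * Q * s K := by
        rw [← h.cotwist_mul_zero_left d c]
        simp only [mul_assoc, cancel s (h.twist_mul_cotwist d)]

theorem twist_commute (h : StrictBraided s m η φ ε κ σ σ')
    (d : FlipData s m φ ε σ σ' k e K K' τ τ') : K * s K = s K * K := by
  have := twist_commute_right (x := k) (h.comul_twist_eq d)
  rwa [← d.twist_eq] at this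

theorem twist_commute_cotwist (h : StrictBraided s m η φ ε κ σ σ')
    (d : FlipData s m φ ε σ σ' k e K K' τ τ') : K * s K' = s K' * K := by
  have := twist_commute_right (x := k) (h.comul_cotwist_eq d)
  rwa [← d.twist_eq] at this

theorem cotwist_commute_twist (h : StrictBraided s m η φ ε κ σ σ')
    (d : FlipData s m φ ε σ σ' k e K K' τ τ') : K' * s K = s K * K' := by
  have := twist_commute_right (x := e) (h.comul_twist_eq d)
  rwa [← d.cotwist_eq] at this

/-- K₁₂ commutes with the colinear operator στ⁻¹ = τKτ⁻¹ on strands 2 and 3; conjugate by τ₂₃. -/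
theorem left_commute (h : StrictBraided s m η φ ε κ σ σ')
    (d : FlipData s m φ ε σ σ' k e K K' τ τ') (c : SlideData s m K K' τ τ' m₀ P P' Q Q') :
    P * s K = s K * P := by
  have : Local s 2 2 (σ * τ') := ⟨fun y => by simp only [interchange s]⟩
  have h₁ : K * s (σ * τ') = s (σ * τ') * K := by
    have := twist_commute_right (x := k) (h.comul_flip_inv d)
    rwa [← d.twist_eq] at this
  calc P * s K = s τ' * K * s (τ * K) := by
        rw [c.left_eq]; simp only [map_mul, mul_assoc]
    _ = s τ' * (K * s (σ * τ')) * s τ := by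
        rw [← h.braiding_eq_flip_mul_twist d]
        simp only [map_mul, mul_assoc, cancel s (h.coflip_mul_flip d), mul_one]
    _ = s τ' * s (τ * K) * s τ' * K * s τ := by
        rw [h₁, ← h.braiding_eq_flip_mul_twist d]; simp only [map_mul, mul_assoc]
    _ = s K * P := by
        rw [c.left_eq]; simp only [map_mul, mul_assoc, cancel s (h.coflip_mul_flip d)]

theorem right_commute (h : StrictBraided s m η φ ε κ σ σ')
    (d : FlipData s m φ ε σ σ' k e K K' τ τ') (c : SlideData s m K K' τ τ' m₀ P P' Q Q') :
    Q * K = K * Q := by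
  have : Local s 2 2 (σ * τ') := ⟨fun y => by simp only [interchange s]⟩
  have h₁ : s K * (σ * τ') = σ * τ' * s K := by
    have := twist_commute_left (x := k) (h.shift_comul_flip_inv d)
    rwa [← d.twist_eq] at this
  calc Q * K = τ' * s K * (τ * K) := by rw [c.right_eq]; simp only [mul_assoc]
    _ = τ' * (s K * (σ * τ')) * τ := by
        rw [← h.braiding_eq_flip_mul_twist d]
        simp only [mul_assoc, cancel s (h.coflip_mul_flip d), mul_one]
    _ = τ' * (τ * K) * τ' * s K * τ := by
        rw [h₁, ← h.braiding_eq_flip_mul_twist d]; simp only [mul_assoc]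
    _ = K * Q := by
        rw [c.right_eq]; simp only [mul_assoc, cancel s (h.coflip_mul_flip d)]

theorem left_commute_cotwist (h : StrictBraided s m η φ ε κ σ σ')
    (d : FlipData s m φ ε σ σ' k e K K' τ τ') (c : SlideData s m K K' τ τ' m₀ P P' Q Q') :
    P * s K' = s K' * P :=
  calc P * s K' = s K' * (s K * P) * s K' := by
        simp only [cancel s (h.cotwist_mul_twist d)]
    _ = s K' * P := by
        rw [← h.left_commute d c]
        simp only [mul_assoc, cancel s (h.twist_mul_cotwist d), mul_one]

theorem right_commute_cotwist (h : StrictBraided s m η φ ε κ σ σ')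
    (d : FlipData s m φ ε σ σ' k e K K' τ τ') (c : SlideData s m K K' τ τ' m₀ P P' Q Q') :
    Q * K' = K' * Q :=
  calc Q * K' = K' * (K * Q) * K' := by
        simp only [cancel s (h.cotwist_mul_twist d)]
    _ = K' * Q := by
        rw [← h.right_commute d c]
        simp only [mul_assoc, cancel s (h.twist_mul_cotwist d), mul_one]

theorem flip_left (h : StrictBraided s m η φ ε κ σ σ')
    (d : FlipData s m φ ε σ σ' k e K K' τ τ') (c : SlideData s m K K' τ τ' m₀ P P' Q Q') :
    s τ * P = K * s τ := by
  rw [c.left_eq]; simp only [mul_assoc, cancel s (h.flip_mul_coflip d)]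

theorem flip_left_inv (h : StrictBraided s m η φ ε κ σ σ')
    (d : FlipData s m φ ε σ σ' k e K K' τ τ') (c : SlideData s m K K' τ τ' m₀ P P' Q Q') :
    s τ * P' = K' * s τ := by
  rw [c.left_inv_eq]; simp only [mul_assoc, cancel s (h.flip_mul_coflip d)]

theorem flip_right (h : StrictBraided s m η φ ε κ σ σ')
    (d : FlipData s m φ ε σ σ' k e K K' τ τ') (c : SlideData s m K K' τ τ' m₀ P P' Q Q') :
    τ * Q = s K * τ := by
  rw [c.right_eq]; simp only [mul_assoc, cancel s (h.flip_mul_coflip d)]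

theorem flip_right_inv (h : StrictBraided s m η φ ε κ σ σ')
    (d : FlipData s m φ ε σ σ' k e K K' τ τ') (c : SlideData s m K K' τ τ' m₀ P P' Q Q') :
    τ * Q' = s K' * τ := by
  rw [c.right_inv_eq]; simp only [mul_assoc, cancel s (h.flip_mul_coflip d)]

/-- This is `braiding_mul_right` rewritten through σ = τK and m = m₀K'. The leftover P, P', Q and K'
cancel only once P = Q and the sliding of K' through τ are known. -/
theorem flip_mul_right_twisted (h : StrictBraided s m η φ ε κ σ σ')
    (d : FlipData s m φ ε σ σ' k e K K' τ τ') (c : SlideData s m K K' τ τ' m₀ P P' Q Q') :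
    τ * s m₀ * s K' * P = m₀ * s τ * P' * τ * Q := by
  have h₁ : τ * s m₀ * s K' * P * K = m₀ * s τ * P' * τ * Q * K :=
    calc τ * s m₀ * s K' * P * K = τ * s m₀ * (P * s K') * K := by
          rw [h.left_commute_cotwist d c]; simp only [mul_assoc]
      _ = τ * (s m₀ * P * K) * s K' := by
          simp only [mul_assoc, h.twist_commute_cotwist d]
      _ = (τ * K) * s (m₀ * K') := by
          rw [← h.twist_mul_zero_right d c]; simp only [map_mul, mul_assoc]
      _ = m * s σ * σ := by
          rw [← h.braiding_eq_flip_mul_twist d, ← h.mul_eq_mul_cotwist d c,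
            h.braiding_mul_right]
      _ = m₀ * (K' * s τ) * (s K * τ) * K := by
          rw [h.mul_eq_mul_cotwist d c, h.braiding_eq_flip_mul_twist d]
          simp only [map_mul, mul_assoc]
      _ = m₀ * s τ * P' * τ * Q * K := by
          rw [← h.flip_left_inv d c, ← h.flip_right d c]; simp only [mul_assoc]
  calc τ * s m₀ * s K' * P = τ * s m₀ * s K' * P * K * K' := by
        simp only [mul_assoc, cancel s (h.twist_mul_cotwist d), mul_one]
    _ = m₀ * s τ * P' * τ * Q := by
        rw [h₁]; simp only [mul_assoc, cancel s (h.twist_mul_cotwist d), mul_one]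

theorem comul_left (h : StrictBraided s m η φ ε κ σ σ')
    (d : FlipData s m φ ε σ σ' k e K K' τ τ') (c : SlideData s m K K' τ τ' m₀ P P' Q Q') :
    φ * P = s P * φ :=
  calc φ * P = s (s k) * (φ * φ) * s τ * s (s φ) := by
        rw [h.left_eq' d c]; simp only [interchange s]
    _ = s P * φ := by rw [h.coassoc, h.left_eq' d c]; simp only [interchange s]

theorem comul_right (h : StrictBraided s m η φ ε κ σ σ')
    (d : FlipData s m φ ε σ σ' k e K K' τ τ') (c : SlideData s m K K' τ τ' m₀ P P' Q Q') :
    φ * Q = s Q * φ :=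
  calc φ * Q = s (s (s k)) * s (s (s (s φ))) * s (s τ) * (φ * φ) := by
        rw [h.right_eq' d c]; simp only [interchange s]
    _ = s Q * φ := by rw [h.coassoc, h.right_eq' d c]; simp only [interchange s]

theorem comul_right_inv (h : StrictBraided s m η φ ε κ σ σ')
    (d : FlipData s m φ ε σ σ' k e K K' τ τ') (c : SlideData s m K K' τ τ' m₀ P P' Q Q') :
    φ * Q' = s Q' * φ :=
  calc φ * Q' = s (s (s e)) * s (s (s (s φ))) * s (s τ) * (φ * φ) := by
        rw [h.right_inv_eq' d c]; simp only [interchange s]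
    _ = s Q' * φ := by rw [h.coassoc, h.right_inv_eq' d c]; simp only [interchange s]

/-- Contracting the twisted naturality of τ by ε gives (id⊗e)PQ', where P = Q is not yet available.
But P and Q' are left-colinear, hence so is the map, and a left-colinear map to A is determined by
its composite with ε. -/
theorem coform_slide_right (h : StrictBraided s m η φ ε κ σ σ')
    (d : FlipData s m φ ε σ σ' k e K K' τ τ') (c : SlideData s m K K' τ τ' m₀ P P' Q Q') :
    e * s τ * τ = s e := by
  have h₁ : e * s τ * τ = s e * P * Q' :=
    calc e * s τ * τ = ε * ε * (K' * s τ) * τ * (Q * Q') := by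
          rw [h.right_mul_inv d c, mul_one, ← h.counit_cotwist d]; simp only [mul_assoc]
      _ = ε * (m₀ * s τ * P' * τ * Q) * Q' := by
          rw [← h.flip_left_inv d c, ← h.counit_mul_zero d c]; simp only [mul_assoc]
      _ = (ε * τ) * s (m₀ * K') * P * Q' := by
          rw [← h.flip_mul_right_twisted d c]; simp only [map_mul, mul_assoc]
      _ = s e * P * Q' := by
          rw [h.counit_flip d, ← h.mul_eq_mul_cotwist d c, d.coform_eq, map_mul]
  have h₂ : φ * (e * s τ * τ) = s (e * s τ * τ) * φ :=
    calc φ * (e * s τ * τ) = s (s e) * (φ * P) * Q' := by rw [h₁]; simp only [interchange s]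
      _ = s (s e) * s P * (φ * Q') := by rw [h.comul_left d c]; simp only [mul_assoc]
      _ = s (e * s τ * τ) * φ := by
          rw [h.comul_right_inv d c, h₁]; simp only [map_mul, mul_assoc]
  have h₃ : ε * (e * s τ * τ) = e * ε :=
    calc ε * (e * s τ * τ) = e * s (s ε * τ) * τ := by simp only [interchange s]
      _ = e * ε := by
          rw [h.shift_counit_flip d, mul_assoc, h.shift_counit_flip d]
  calc e * s τ * τ = s ε * φ * (e * s τ * τ) := by rw [h.counit_right, one_mul]
    _ = s (ε * (e * s τ * τ)) * φ := by
        rw [mul_assoc, h₂, map_mul s ε]; simp only [mul_assoc]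
    _ = s e * (s ε * φ) := by rw [h₃, map_mul, mul_assoc]
    _ = s e := by rw [h.counit_right, mul_one]

theorem cotwist_slide_right (h : StrictBraided s m η φ ε κ σ σ')
    (d : FlipData s m φ ε σ σ' k e K K' τ τ') (c : SlideData s m K K' τ τ' m₀ P P' Q Q') :
    K' * s τ * τ = s τ * τ * s K' :=
  calc K' * s τ * τ = s e * φ * s (φ * τ) * τ := by
        rw [d.cotwist_eq]; simp only [map_mul, mul_assoc]
    _ = s e * s (s (s τ)) * s (s τ) * φ * τ * s (s φ) := by
        rw [h.comul_flip d]; simp only [interchange s]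
    _ = s τ * s (e * s τ * τ) * τ * s φ * s (s φ) := by
        simpa only [interchange s] using
          sandwich (h.comul_flip d) (s e * s (s (s τ)) * s (s τ)) (s (s φ))
    _ = s τ * τ * s K' := by
        rw [h.coform_slide_right d c, d.cotwist_eq]; simp only [interchange s]

theorem left_inv_flip (h : StrictBraided s m η φ ε κ σ σ')
    (d : FlipData s m φ ε σ σ' k e K K' τ τ') (c : SlideData s m K K' τ τ' m₀ P P' Q Q') :
    P' * τ = τ * s K' :=
  calc P' * τ = s τ' * (K' * s τ * τ) := by rw [c.left_inv_eq]; simp only [mul_assoc]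
    _ = τ * s K' := by
        rw [h.cotwist_slide_right d c]
        simp only [mul_assoc, cancel s (h.coflip_mul_flip d)]

theorem shift_comul_left (h : StrictBraided s m η φ ε κ σ σ')
    (d : FlipData s m φ ε σ σ' k e K K' τ τ') (c : SlideData s m K K' τ τ' m₀ P P' Q Q') :
    s (s φ) * P = P * s (s φ) :=
  calc s (s φ) * P = s k * φ * s τ * s (s (s φ * φ)) := by
        rw [h.left_eq' d c]; simp only [interchange s]
    _ = P * s (s φ) := by rw [← h.coassoc, h.left_eq' d c]; simp only [interchange s]

theorem shift_comul_right (h : StrictBraided s m η φ ε κ σ σ')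
    (d : FlipData s m φ ε σ σ' k e K K' τ τ') (c : SlideData s m K K' τ τ' m₀ P P' Q Q') :
    s (s φ) * Q = Q * s (s φ) :=
  calc s (s φ) * Q = s (s k) * s (s (s (s φ * φ))) * s τ * φ := by
        rw [h.right_eq' d c]; simp only [interchange s]
    _ = Q * s (s φ) := by rw [← h.coassoc, h.right_eq' d c]; simp only [interchange s]

/-- Contracting `flip_mul_right_twisted` by id⊗ε dissolves every τ and leaves (ε⊗m)P = (ε⊗m)Q. Left
colinearity removes the ε, right colinearity completes m to the Galois map, and that map cancels. -/
theorem left_eq_right (h : StrictBraided s m η φ ε κ σ σ')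
    (d : FlipData s m φ ε σ σ' k e K K' τ τ') (c : SlideData s m K K' τ τ' m₀ P P' Q Q') :
    P = Q := by
  have h₁ : ε * s m * P = ε * s m * Q :=
    calc ε * s m * P = s ε * τ * s (m₀ * K') * P := by
          rw [h.shift_counit_flip d, ← h.mul_eq_mul_cotwist d c]
      _ = s ε * (m₀ * s τ * (P' * τ) * Q) := by
          have := h.flip_mul_right_twisted d c
          simp only [mul_assoc] at this
          simp only [map_mul, mul_assoc, this]
      _ = m₀ * s (s ε * τ) * τ * s K' * Q := by
          rw [h.left_inv_flip d c]; simp only [interchange s]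
      _ = m₀ * ε * s K' * Q := by
          rw [h.shift_counit_flip d, mul_assoc m₀, h.shift_counit_flip d]
      _ = ε * s (m₀ * K') * Q := by simp only [interchange s]
      _ = ε * s m * Q := by rw [← h.mul_eq_mul_cotwist d c]
  have h₂ : s m * P = s m * Q :=
    calc s m * P = s ε * φ * s m * P := by rw [h.counit_right, one_mul]
      _ = s ε * s (s m) * (φ * P) := by simp only [interchange s]
      _ = s (ε * s m * P) * φ := by rw [h.comul_left d c]; simp only [map_mul, mul_assoc]
      _ = s ε * s (s m) * (φ * Q) := by
          rw [h₁, h.comul_right d c]; simp only [map_mul, mul_assoc]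
      _ = s ε * φ * s m * Q := by simp only [interchange s]
      _ = s m * Q := by rw [h.counit_right, one_mul]
  have h₃ : s (m * s φ) * P = s (m * s φ) * Q :=
    calc s (m * s φ) * P = s m * P * s (s φ) := by
          rw [map_mul, mul_assoc, h.shift_comul_left d c, mul_assoc]
      _ = s (m * s φ) * Q := by
          rw [h₂, mul_assoc, ← h.shift_comul_right d c, map_mul, mul_assoc]
  calc P = s (m * s κ * s φ * (m * s φ)) * P := by
        rw [h.mul_comul_left_inv, map_one, one_mul]
    _ = s (m * s κ * s φ) * (s (m * s φ) * P) := by rw [map_mul, mul_assoc]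
    _ = Q := by
        rw [h₃, ← mul_assoc, ← map_mul, h.mul_comul_left_inv, map_one, one_mul]

theorem left_inv_eq_right_inv (h : StrictBraided s m η φ ε κ σ σ')
    (d : FlipData s m φ ε σ σ' k e K K' τ τ') (c : SlideData s m K K' τ τ' m₀ P P' Q Q') :
    P' = Q' := by
  refine _root_.left_inv_eq_right_inv (h.left_inv_mul d c) ?_
  rw [h.left_eq_right d c, h.right_mul_inv d c]

theorem flip_mul_zero_right (h : StrictBraided s m η φ ε κ σ σ')
    (d : FlipData s m φ ε σ σ' k e K K' τ τ') (c : SlideData s m K K' τ τ' m₀ P P' Q Q') :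
    τ * s m₀ = m₀ * s τ * τ :=
  calc τ * s m₀ = τ * s m₀ * s K' * P * P' * s K := by
        simp only [mul_assoc, cancel s (h.left_mul_inv d c), cancel s (h.cotwist_mul_twist d),
          mul_one]
    _ = m₀ * s τ * (P' * τ) * s K := by
        rw [h.flip_mul_right_twisted d c, ← h.left_eq_right d c]
        simp only [mul_assoc, cancel s (h.left_mul_inv d c), one_mul]
    _ = m₀ * s τ * τ := by
        rw [h.left_inv_flip d c]
        simp only [mul_assoc, cancel s (h.cotwist_mul_twist d), mul_one]

theorem flip_mul_left_twisted (h : StrictBraided s m η φ ε κ σ σ')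
    (d : FlipData s m φ ε σ σ' k e K K' τ τ') (c : SlideData s m K K' τ τ' m₀ P P' Q Q') :
    τ * m₀ * K' = s m₀ * τ * P' * s τ := by
  have h₁ : τ * m₀ * K' * (P * s K) = s m₀ * τ * P' * s τ * (P * s K) :=
    calc τ * m₀ * K' * (P * s K) = τ * m₀ * (Q * K') * s K := by
          rw [h.left_eq_right d c, h.right_commute_cotwist d c]; simp only [mul_assoc]
      _ = τ * (m₀ * Q * s K) * K' := by
          simp only [mul_assoc, h.cotwist_commute_twist d]
      _ = (τ * K) * (m₀ * K') := by
          rw [← h.twist_mul_zero_left d c]; simp only [mul_assoc]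
      _ = s m * σ * s σ := by
          rw [← h.braiding_eq_flip_mul_twist d, ← h.mul_eq_mul_cotwist d c,
            h.braiding_mul_left]
      _ = s m₀ * (s K' * τ) * (K * s τ) * s K := by
          rw [h.mul_eq_mul_cotwist d c, h.braiding_eq_flip_mul_twist d]
          simp only [map_mul, mul_assoc]
      _ = s m₀ * τ * P' * s τ * (P * s K) := by
          rw [← h.flip_right_inv d c, ← h.flip_left d c, h.left_inv_eq_right_inv d c]
          simp only [mul_assoc]
  calc τ * m₀ * K' = τ * m₀ * K' * (P * s K) * (s K' * P') := by
        simp only [mul_assoc, cancel s (h.twist_mul_cotwist d), cancel s (h.left_mul_inv d c),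
          mul_one]
    _ = s m₀ * τ * P' * s τ := by
        rw [h₁]
        simp only [mul_assoc, cancel s (h.twist_mul_cotwist d), cancel s (h.left_mul_inv d c),
          mul_one]

/-- With P' = Q' at hand a single contraction suffices, and no colinearity argument is needed. -/
theorem coform_slide_left (h : StrictBraided s m η φ ε κ σ σ')
    (d : FlipData s m φ ε σ σ' k e K K' τ τ') (c : SlideData s m K K' τ τ' m₀ P P' Q Q') :
    s e * τ * s τ = e :=
  calc s e * τ * s τ = s (ε * ε) * (s K' * τ) * s τ := by
        rw [← h.counit_cotwist d]; simp only [map_mul, mul_assoc]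
    _ = s ε * (s m₀ * τ * P' * s τ) := by
        rw [← h.flip_right_inv d c, ← h.counit_mul_zero d c, h.left_inv_eq_right_inv d c]
        simp only [map_mul, mul_assoc]
    _ = (s ε * τ) * (m₀ * K') := by
        rw [← h.flip_mul_left_twisted d c]; simp only [mul_assoc]
    _ = e := by
        rw [h.shift_counit_flip d, ← h.mul_eq_mul_cotwist d c, d.coform_eq]

theorem cotwist_slide_left (h : StrictBraided s m η φ ε κ σ σ')
    (d : FlipData s m φ ε σ σ' k e K K' τ τ') (c : SlideData s m K K' τ τ' m₀ P P' Q Q') :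
    s K' * τ * s τ = τ * s τ * K' :=
  calc s K' * τ * s τ = s (s e) * s (s (s φ)) * (s φ * τ) * s τ := by
        rw [cotwist_eq' d]; simp only [map_mul, mul_assoc]
    _ = τ * s (s e) * s τ * s (s (s φ)) * s (s τ) * φ := by
        rw [h.shift_comul_flip d]; simp only [interchange s]
    _ = τ * s (s e * τ * s τ) * s (s (s τ)) * s (s φ) * φ := by
        simpa only [interchange s] using
          sandwich (congrArg (fun x => s (s x)) (h.shift_comul_flip d)) (τ * s (s e) * s τ) φ
    _ = τ * s τ * K' := by
        rw [h.coform_slide_left d c, cotwist_eq' d]; simp only [interchange s]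

theorem left_inv_shift_flip (h : StrictBraided s m η φ ε κ σ σ')
    (d : FlipData s m φ ε σ σ' k e K K' τ τ') (c : SlideData s m K K' τ τ' m₀ P P' Q Q') :
    P' * s τ = s τ * K' :=
  calc P' * s τ = τ' * (s K' * τ * s τ) := by
        rw [h.left_inv_eq_right_inv d c, c.right_inv_eq]; simp only [mul_assoc]
    _ = s τ * K' := by
        rw [h.cotwist_slide_left d c]
        simp only [mul_assoc, cancel s (h.coflip_mul_flip d)]

theorem flip_mul_zero_left (h : StrictBraided s m η φ ε κ σ σ')
    (d : FlipData s m φ ε σ σ' k e K K' τ τ') (c : SlideData s m K K' τ τ' m₀ P P' Q Q') :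
    τ * m₀ = s m₀ * τ * s τ :=
  calc τ * m₀ = τ * m₀ * K' * K := by
        simp only [mul_assoc, cancel s (h.cotwist_mul_twist d), mul_one]
    _ = s m₀ * τ * (P' * s τ) * K := by
        rw [h.flip_mul_left_twisted d c]; simp only [mul_assoc]
    _ = s m₀ * τ * s τ := by
        rw [h.left_inv_shift_flip d c]
        simp only [mul_assoc, cancel s (h.cotwist_mul_twist d), mul_one]

theorem left_flip (h : StrictBraided s m η φ ε κ σ σ')
    (d : FlipData s m φ ε σ σ' k e K K' τ τ') (c : SlideData s m K K' τ τ' m₀ P P' Q Q') :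
    P * τ = τ * s K :=
  calc P * τ = P * (τ * s K') * s K := by
        simp only [mul_assoc, cancel s (h.cotwist_mul_twist d), mul_one]
    _ = τ * s K := by
        rw [← h.left_inv_flip d c]; simp only [cancel s (h.left_mul_inv d c)]

theorem left_shift_flip (h : StrictBraided s m η φ ε κ σ σ')
    (d : FlipData s m φ ε σ σ' k e K K' τ τ') (c : SlideData s m K K' τ τ' m₀ P P' Q Q') :
    P * s τ = s τ * K :=
  calc P * s τ = P * (s τ * K') * K := by
        simp only [mul_assoc, cancel s (h.cotwist_mul_twist d), mul_one]
    _ = s τ * K := by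
        rw [← h.left_inv_shift_flip d c]; simp only [cancel s (h.left_mul_inv d c)]

theorem left_commute_twist (h : StrictBraided s m η φ ε κ σ σ')
    (d : FlipData s m φ ε σ σ' k e K K' τ τ') (c : SlideData s m K K' τ τ' m₀ P P' Q Q') :
    P * K = K * P := by
  rw [h.left_eq_right d c, h.right_commute d c]

/-- Write m = m₀K'. Both bracketings of m, composed with the same full twist K₁₂K₁₃K₂₃, become the
corresponding bracketings of m₀, because the three factors commute. -/
theorem assoc_zero (h : StrictBraided s m η φ ε κ σ σ')
    (d : FlipData s m φ ε σ σ' k e K K' τ τ') (c : SlideData s m K K' τ τ' m₀ P P' Q Q') :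
    m₀ * m₀ = m₀ * s m₀ := by
  have h₁ : m₀ * K' * (m₀ * K') * (K * P * s K) = m₀ * m₀ :=
    calc m₀ * K' * (m₀ * K') * (K * P * s K) = m₀ * K' * (m₀ * Q * s K) := by
          rw [← h.left_eq_right d c]
          simp only [mul_assoc, cancel s (h.cotwist_mul_twist d)]
      _ = m₀ * m₀ := by
          rw [← h.twist_mul_zero_left d c]
          simp only [mul_assoc, cancel s (h.cotwist_mul_twist d)]
  have h₂ : m₀ * K' * s (m₀ * K') * (K * P * s K) = m₀ * s m₀ :=
    calc m₀ * K' * s (m₀ * K') * (K * P * s K)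
        = m₀ * K' * s m₀ * (s K' * K) * (s K * P) := by
          rw [← h.left_commute d c]; simp only [map_mul, mul_assoc]
      _ = m₀ * K' * s m₀ * (K * P) := by
          rw [← h.twist_commute_cotwist d]
          simp only [mul_assoc, cancel s (h.cotwist_mul_twist d)]
      _ = m₀ * K' * (s m₀ * P * K) := by
          rw [← h.left_commute_twist d c]; simp only [mul_assoc]
      _ = m₀ * s m₀ := by
          rw [← h.twist_mul_zero_right d c]
          simp only [mul_assoc, cancel s (h.cotwist_mul_twist d)]
  rw [← h₁, ← h₂, ← h.mul_eq_mul_cotwist d c, h.assoc]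

end StrictBraided

end Transparent

end BraidedQG

namespace BraidedQG

set_option linter.unusedSectionVars false

/-! ### K against the unit, the antipode and the coproduct -/

section Antipode

variable {M : Type*} [Monoid M]

variable {s : M →* M} {m η φ ε κ σ σ' k e K K' τ τ' m₀ P P' Q Q' : M}
  [Local s 2 1 m] [Local s 0 1 η] [Local s 1 2 φ] [Local s 1 0 ε] [Local s 1 1 κ]
  [Local s 2 2 σ] [Local s 2 2 σ'] [Local s 2 0 k] [Local s 2 0 e]
  [Local s 2 2 K] [Local s 2 2 K'] [Local s 2 2 τ] [Local s 2 2 τ']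
  [Local s 2 1 m₀] [Local s 3 3 P] [Local s 3 3 P'] [Local s 3 3 Q] [Local s 3 3 Q']

namespace StrictBraided

theorem twist_one_left (h : StrictBraided s m η φ ε κ σ σ')
    (d : FlipData s m φ ε σ σ' k e K K' τ τ') : K * η = η := by
  have h₁ : k * η = ε :=
    calc k * η = ε * ε * (σ * η) := by rw [d.form_eq]; simp only [mul_assoc]
      _ = (ε * η) * ε := by
          rw [h.braiding_one_left]
          calc ε * ε * s η = ε * s ε * s η := by simp only [interchange s]
            _ = ε * s (ε * η) := by rw [map_mul, mul_assoc]
            _ = ε * η * ε := by rw [h.counit_one, map_one, mul_one, one_mul]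
      _ = ε := by rw [h.counit_one, one_mul]
  calc K * η = s k * (φ * η) * φ := by rw [d.twist_eq]; simp only [interchange s]
    _ = s (k * η) * η * φ := by rw [h.comul_one]; simp only [map_mul, mul_assoc]
    _ = η * (ε * φ) := by rw [h₁]; simp only [interchange s]
    _ = η := by rw [h.counit_left, mul_one]

theorem twist_one_right (h : StrictBraided s m η φ ε κ σ σ')
    (d : FlipData s m φ ε σ σ' k e K K' τ τ') : K * s η = s η := by
  have h₁ : k * s η = ε :=
    calc k * s η = ε * ε * (σ * s η) := by rw [d.form_eq]; simp only [mul_assoc]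
      _ = ε * (ε * η) := by rw [h.braiding_one_right, mul_assoc]
      _ = ε := by rw [h.counit_one, mul_one]
  calc K * s η = s k * s (s (φ * η)) * φ := by
        rw [twist_eq' d]; simp only [interchange s]
    _ = s η * s (k * s η) * φ := by rw [h.comul_one]; simp only [interchange s]
    _ = s η * (s ε * φ) := by rw [h₁, mul_assoc]
    _ = s η := by rw [h.counit_right, mul_one]

theorem counit_counit_twist (h : StrictBraided s m η φ ε κ σ σ')
    (d : FlipData s m φ ε σ σ' k e K K' τ τ') : ε * ε * K = k :=
  calc ε * ε * K = ε * (k * s φ) := by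
        rw [mul_assoc, d.twist_eq, counit_twist h.counit_left]
    _ = k * s (s ε * φ) := by simp only [interchange s]
    _ = k := by rw [h.counit_right, map_one, mul_one]

/-- Contract the last two strands of `shift_twist_flip_comul` by ε⊗ε: there K₃₄ becomes k, while on
the side of σ = τK the flip dissolves into counits and K alone survives. -/
theorem twist_eq_right (h : StrictBraided s m η φ ε κ σ σ')
    (d : FlipData s m φ ε σ σ' k e K K' τ τ') : K = s (s k) * s τ * φ * s φ :=
  calc K = s (s ε) * s φ * K := by rw [← map_mul, h.counit_right, map_one, one_mul]
    _ = s (s ε) * (s ε * φ) * s φ * K := by rw [h.counit_right, mul_one]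
    _ = s (s ε * (s ε * τ)) * (φ * s φ * K) := by
        rw [h.shift_counit_flip d]; simp only [map_mul, mul_assoc]
    _ = s (s ε * s ε) * (s (τ * K) * φ * s φ) := by
        rw [h.comul_comul_twist d]; simp only [map_mul, mul_assoc]
    _ = s (s (ε * ε * K)) * s τ * φ * s φ := by
        rw [← h.braiding_eq_flip_mul_twist d, ← h.shift_twist_flip_comul d]
        simp only [map_mul, mul_assoc]
    _ = s (s k) * s τ * φ * s φ := by rw [h.counit_counit_twist d]

theorem twist_eq_left (h : StrictBraided s m η φ ε κ σ σ')
    (d : FlipData s m φ ε σ σ' k e K K' τ τ') : K = k * s τ * φ * s φ :=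
  calc K = s ε * s φ * K := by rw [← map_mul, h.counit_left, map_one, one_mul]
    _ = s ε * (ε * φ) * s φ * K := by rw [h.counit_left, mul_one]
    _ = (ε * τ) * ε * (φ * s φ * K) := by
        rw [h.counit_flip d]; simp only [mul_assoc]
    _ = ε * ε * (s (τ * K) * φ * s φ) := by
        rw [h.comul_comul_twist d]; simp only [interchange s]
    _ = ε * ε * K * s τ * φ * s φ := by
        rw [← h.braiding_eq_flip_mul_twist d, ← h.twist_flip_comul d]
        simp only [mul_assoc]
    _ = k * s τ * φ * s φ := by rw [h.counit_counit_twist d]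

/-- The equality P = Q contracted by counits on strands 1 and 3. -/
theorem form_slide (h : StrictBraided s m η φ ε κ σ σ')
    (d : FlipData s m φ ε σ σ' k e K K' τ τ') (c : SlideData s m K K' τ τ' m₀ P P' Q Q') :
    k * s τ = s k * τ :=
  calc k * s τ = k * (ε * φ) * s τ * s (s (s ε * φ)) := by
        rw [h.counit_left, h.counit_right, map_one, map_one, mul_one, mul_one]
    _ = ε * s (s ε) * P := by rw [h.left_eq' d c]; simp only [interchange s]
    _ = ε * s (s ε) * (s (s k) * s (s (s φ)) * s τ * φ) := by
        rw [h.left_eq_right d c, h.right_eq' d c]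
    _ = s k * s (s (s ε * φ)) * τ * (ε * φ) := by simp only [interchange s]
    _ = s k * τ := by
        rw [h.counit_left, h.counit_right, map_one, map_one, mul_one, mul_one]

theorem twist_eq_slide_right (h : StrictBraided s m η φ ε κ σ σ')
    (d : FlipData s m φ ε σ σ' k e K K' τ τ') (c : SlideData s m K K' τ τ' m₀ P P' Q Q') :
    K = s k * φ * s τ * s φ :=
  calc K = s (s k * τ) * φ * s φ := by
        rw [map_mul, ← h.twist_eq_right d]
    _ = s k * φ * s τ * s φ := by rw [← h.form_slide d c]; simp only [interchange s]

theorem twist_eq_slide_left (h : StrictBraided s m η φ ε κ σ σ')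
    (d : FlipData s m φ ε σ σ' k e K K' τ τ') (c : SlideData s m K K' τ τ' m₀ P P' Q Q') :
    K = s k * τ * φ * s φ := by
  rw [← h.form_slide d c, ← h.twist_eq_left d]

/-- After strand 2 is split by φ, coassociativity makes it irrelevant which half K acts on, so K₁₃
and K₁₂ agree there. -/
theorem left_shift_comul (h : StrictBraided s m η φ ε κ σ σ')
    (d : FlipData s m φ ε σ σ' k e K K' τ τ') (c : SlideData s m K K' τ τ' m₀ P P' Q Q') :
    P * s φ = K * s φ :=
  calc P * s φ = s k * φ * s τ * s (s φ * φ) := by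
        rw [h.left_eq' d c]; simp only [map_mul, mul_assoc]
    _ = s k * φ * s τ * s φ * s φ := by rw [← h.coassoc]; simp only [map_mul, mul_assoc]
    _ = K * s φ := by rw [← h.twist_eq_slide_right d c]

theorem left_comul (h : StrictBraided s m η φ ε κ σ σ')
    (d : FlipData s m φ ε σ σ' k e K K' τ τ') (c : SlideData s m K K' τ τ' m₀ P P' Q Q') :
    P * φ = s K * φ :=
  calc P * φ = s (s k) * s (s (s φ)) * s τ * (φ * φ) := by
        rw [h.left_eq_right d c, h.right_eq' d c]; simp only [mul_assoc]
    _ = s (s k * τ * φ * s φ) * φ := by rw [h.coassoc]; simp only [interchange s]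
    _ = s K * φ := by rw [← h.twist_eq_slide_left d c]

theorem left_inv_shift_comul (h : StrictBraided s m η φ ε κ σ σ')
    (d : FlipData s m φ ε σ σ' k e K K' τ τ') (c : SlideData s m K K' τ τ' m₀ P P' Q Q') :
    P' * s φ = K' * s φ :=
  calc P' * s φ = P' * (K * (K' * s φ)) := by
        simp only [cancel s (h.twist_mul_cotwist d)]
    _ = P' * (P * s φ) * K' := by
        rw [← h.shift_comul_cotwist_eq d, h.left_shift_comul d c]; simp only [mul_assoc]
    _ = K' * s φ := by
        simp only [cancel s (h.left_inv_mul d c), h.shift_comul_cotwist_eq d]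

theorem left_inv_comul (h : StrictBraided s m η φ ε κ σ σ')
    (d : FlipData s m φ ε σ σ' k e K K' τ τ') (c : SlideData s m K K' τ τ' m₀ P P' Q Q') :
    P' * φ = s K' * φ :=
  calc P' * φ = P' * (s K * (s K' * φ)) := by
        simp only [cancel s (h.twist_mul_cotwist d)]
    _ = P' * (P * φ) * K' := by
        rw [← h.comul_cotwist_eq d, h.left_comul d c]; simp only [mul_assoc]
    _ = s K' * φ := by
        simp only [cancel s (h.left_inv_mul d c), h.comul_cotwist_eq d]

/-- Splitting the strand that P jumps over makes it jump over two strands; naturality of τ for φ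
gives the formula. -/
theorem middle_comul_left (h : StrictBraided s m η φ ε κ σ σ')
    (d : FlipData s m φ ε σ σ' k e K K' τ τ') (c : SlideData s m K K' τ τ' m₀ P P' Q Q') :
    s φ * P = τ' * s P * τ * s φ := by
  have h₁ : s φ * τ' = τ' * s τ' * φ :=
    calc s φ * τ' = τ' * s τ' * (s τ * τ * s φ) * τ' := by
          simp only [mul_assoc, cancel s (h.coflip_mul_flip d)]
      _ = τ' * s τ' * φ := by
          rw [← h.comul_flip d]
          simp only [mul_assoc, cancel s (h.flip_mul_coflip d), mul_one]
  calc s φ * P = (s φ * τ') * s K * τ := by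
        rw [h.left_eq_right d c, c.right_eq]; simp only [mul_assoc]
    _ = τ' * s τ' * s (s K) * (φ * τ) := by rw [h₁]; simp only [interchange s]
    _ = τ' * s P * τ * s φ := by
        rw [h.comul_flip d, h.left_eq_right d c, c.right_eq]
        simp only [map_mul, mul_assoc]

theorem middle_comul_right (h : StrictBraided s m η φ ε κ σ σ')
    (d : FlipData s m φ ε σ σ' k e K K' τ τ') (c : SlideData s m K K' τ τ' m₀ P P' Q Q') :
    s φ * P = s (s τ') * P * s (s τ) * s φ := by
  have h₁ : φ * τ' = s τ' * τ' * s φ :=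
    calc φ * τ' = s τ' * τ' * (τ * s τ * φ) * τ' := by
          simp only [mul_assoc, cancel s (h.coflip_mul_flip d)]
      _ = s τ' * τ' * s φ := by
          rw [← h.shift_comul_flip d]
          simp only [mul_assoc, cancel s (h.flip_mul_coflip d), mul_one]
  calc s φ * P = s (φ * τ') * K * s τ := by
        rw [c.left_eq]; simp only [map_mul, mul_assoc]
    _ = s (s τ') * s τ' * K * s (s φ * τ) := by rw [h₁]; simp only [interchange s]
    _ = s (s τ') * P * s (s τ) * s φ := by
        rw [h.shift_comul_flip d, c.left_eq]; simp only [map_mul, mul_assoc]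

theorem twist_mul_right (h : StrictBraided s m η φ ε κ σ σ')
    (d : FlipData s m φ ε σ σ' k e K K' τ τ') (c : SlideData s m K K' τ τ' m₀ P P' Q Q') :
    K * s m = s m * P * K :=
  calc K * s m = (K * s m₀) * s K' := by
        rw [h.mul_eq_mul_cotwist d c]; simp only [map_mul, mul_assoc]
    _ = s m₀ * P * (K * s K') := by
        rw [h.twist_mul_zero_right d c]; simp only [mul_assoc]
    _ = s m₀ * (P * s K') * K := by
        rw [h.twist_commute_cotwist d]; simp only [mul_assoc]
    _ = s (m₀ * K') * P * K := by
        rw [h.left_commute_cotwist d c]; simp only [map_mul, mul_assoc]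
    _ = s m * P * K := by rw [← h.mul_eq_mul_cotwist d c]

theorem twist_mul_left (h : StrictBraided s m η φ ε κ σ σ')
    (d : FlipData s m φ ε σ σ' k e K K' τ τ') (c : SlideData s m K K' τ τ' m₀ P P' Q Q') :
    K * m = m * P * s K :=
  calc K * m = (K * m₀) * K' := by
        rw [h.mul_eq_mul_cotwist d c]; simp only [mul_assoc]
    _ = m₀ * Q * (s K * K') := by
        rw [h.twist_mul_zero_left d c]; simp only [mul_assoc]
    _ = m₀ * (Q * K') * s K := by
        rw [← h.cotwist_commute_twist d]; simp only [mul_assoc]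
    _ = (m₀ * K') * Q * s K := by
        rw [h.right_commute_cotwist d c]; simp only [mul_assoc]
    _ = m * P * s K := by rw [← h.mul_eq_mul_cotwist d c, h.left_eq_right d c]

/-- The argument is the one for a bicharacter, R(a, κ(b)) = R⁻¹(a, b). Multiplicativity of K and
m(id⊗κ)φ = 1ε show in `h₁` that K₁₃ with κ on its second leg produces K'; `h₂`, which is κ(b₁)(b₂c)
= ε(b)c, removes the auxiliary product. -/
theorem twist_antipode_right (h : StrictBraided s m η φ ε κ σ σ')
    (d : FlipData s m φ ε σ σ' k e K K' τ τ') (c : SlideData s m K K' τ τ' m₀ P P' Q Q') :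
    K * s κ = s κ * K' := by
  have h₁ : s m * P * s (s κ) * s φ = s η * s ε * K' :=
    calc s m * P * s (s κ) * s φ = s m * P * s (s κ) * (s φ * K) * K' := by
          simp only [mul_assoc, cancel s (h.twist_mul_cotwist d), mul_one]
      _ = (s m * P * K) * s (s κ) * s φ * K' := by
          rw [h.shift_comul_twist_eq d]; simp only [interchange s]
      _ = K * s (m * s κ * φ) * K' := by
          rw [← h.twist_mul_right d c]; simp only [map_mul, mul_assoc]
      _ = (K * s η) * s ε * K' := by
          rw [h.antipode_right]; simp only [map_mul, mul_assoc]
      _ = s η * s ε * K' := by rw [h.twist_one_right d]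
  have h₂ : s m * s κ * s (s m) * s φ = s ε :=
    calc s m * s κ * s (s m) * s φ = s (m * s m) * s κ * s φ := by
          simp only [interchange s]
      _ = s m * s (m * κ * φ) := by rw [← h.assoc]; simp only [map_mul, mul_assoc]
      _ = s (m * η) * s ε := by rw [h.antipode_left]; simp only [map_mul, mul_assoc]
      _ = s ε := by rw [h.unit_left, map_one, one_mul]
  calc K * s κ = K * s κ * s (ε * φ) := by rw [h.counit_left, map_one, mul_one]
    _ = K * s κ * (s ε * s φ) := by rw [map_mul]
    _ = K * s κ * (ε * τ) * s φ := by rw [h.counit_flip d]; simp only [mul_assoc]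
    _ = ε * s K * τ * s (s κ) * s φ := by simp only [interchange s]
    _ = s ε * (τ' * s K * τ) * s (s κ) * s φ := by
        simpa only [mul_assoc, one_mul] using
          (sandwich (h.shift_counit_coflip d) 1 (s K * τ * s (s κ) * s φ)).symm
    _ = s m * s κ * s (s m) * (s φ * P) * s (s κ) * s φ := by
        rw [← c.right_eq, ← h.left_eq_right d c, ← h₂]; simp only [mul_assoc]
    _ = s m * s κ * s (s m) * τ' * s P * τ * s (s (s κ)) * s (φ * φ) := by
        rw [h.middle_comul_left d c]; simp only [interchange s]
    _ = s m * s κ * τ' * s (s m * P * s (s κ) * s φ) * τ * s φ := by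
        rw [h.coassoc]; simp only [interchange s]
    _ = s (m * s η) * s κ * s (s ε) * (τ' * s K' * τ) * s φ := by
        rw [h₁]; simp only [interchange s]
    _ = s κ * s (s ε) * (P' * s φ) := by
        rw [h.unit_right, map_one, one_mul, ← c.right_inv_eq, ← h.left_inv_eq_right_inv d c]
        simp only [mul_assoc]
    _ = s κ * K' * s (s ε * φ) := by
        rw [h.left_inv_shift_comul d c]; simp only [interchange s]
    _ = s κ * K' := by rw [h.counit_right, map_one, mul_one]

theorem twist_antipode_left (h : StrictBraided s m η φ ε κ σ σ')
    (d : FlipData s m φ ε σ σ' k e K K' τ τ') (c : SlideData s m K K' τ τ' m₀ P P' Q Q') :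
    K * κ = κ * K' := by
  have h₁ : m * P * κ * φ = η * ε * K' :=
    calc m * P * κ * φ = m * P * κ * (φ * K) * K' := by
          simp only [mul_assoc, cancel s (h.twist_mul_cotwist d), mul_one]
      _ = (m * P * s K) * κ * φ * K' := by
          rw [h.comul_twist_eq d]; simp only [interchange s]
      _ = K * (m * κ * φ) * K' := by
          rw [← h.twist_mul_left d c]; simp only [mul_assoc]
      _ = (K * η) * ε * K' := by rw [h.antipode_left]; simp only [mul_assoc]
      _ = η * ε * K' := by rw [h.twist_one_left d]
  have h₂ : m * s κ * m * s φ = s ε :=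
    calc m * s κ * m * s φ = (m * m) * s (s κ) * s φ := by simp only [interchange s]
      _ = m * s (m * s κ * φ) := by rw [h.assoc]; simp only [map_mul, mul_assoc]
      _ = (m * s η) * s ε := by rw [h.antipode_right, map_mul, mul_assoc]
      _ = s ε := by rw [h.unit_right, one_mul]
  calc K * κ = K * κ * (s ε * φ) := by rw [h.counit_right, mul_one]
    _ = K * κ * s (s ε * τ) * φ := by
        rw [h.shift_counit_flip d]; simp only [mul_assoc]
    _ = s (s ε) * K * s τ * κ * φ := by simp only [interchange s]
    _ = s ε * (s τ' * K * s τ) * κ * φ := by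
        simpa only [map_mul, mul_assoc, one_mul] using
          (sandwich (congrArg s (h.counit_coflip d)) 1 (K * s τ * κ * φ)).symm
    _ = m * s κ * m * (s φ * P) * κ * φ := by
        rw [← c.left_eq, ← h₂]; simp only [mul_assoc]
    _ = m * s κ * m * s (s τ') * P * s (s τ) * κ * (s φ * φ) := by
        rw [h.middle_comul_right d c]; simp only [interchange s]
    _ = m * s κ * s τ' * (m * P * κ * φ) * s τ * φ := by
        rw [← h.coassoc]; simp only [interchange s]
    _ = (m * η) * κ * ε * (s τ' * K' * s τ) * φ := by rw [h₁]; simp only [interchange s]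
    _ = κ * ε * (P' * φ) := by
        rw [h.unit_left, one_mul, ← c.left_inv_eq]; simp only [mul_assoc]
    _ = κ * K' * (ε * φ) := by rw [h.left_inv_comul d c]; simp only [interchange s]
    _ = κ * K' := by rw [h.counit_left, mul_one]

/-- Both sides are kτ₂₃ applied to an iterated coproduct, differing only in which leg is split. This
is why the two formulas for κₙ agree. -/
theorem counit_twist_comul (h : StrictBraided s m η φ ε κ σ σ')
    (d : FlipData s m φ ε σ σ' k e K K' τ τ') (c : SlideData s m K K' τ τ' m₀ P P' Q Q') :
    ε * K * φ = s ε * K * φ := by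
  have h₁ : ε * K = k * s τ * s φ :=
    calc ε * K = k * (ε * φ) * s τ * s φ := by
          rw [h.twist_eq_slide_right d c]; simp only [interchange s]
      _ = k * s τ * s φ := by rw [h.counit_left, mul_one]
  have h₂ : s ε * K = k * s τ * φ :=
    calc s ε * K = s k * τ * φ * s (s ε * φ) := by
          rw [h.twist_eq_slide_left d c]; simp only [interchange s]
      _ = k * s τ * φ := by rw [h.counit_right, map_one, mul_one, h.form_slide d c]
  rw [h₁, h₂, mul_assoc, mul_assoc _ φ, h.coassoc]

/-- By colinearity Kφ is recovered from either of its contractions, and these coincide. Powers of K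
after φ thus turn into powers of N = (ε⊗id)Kφ. -/
theorem twist_comul (h : StrictBraided s m η φ ε κ σ σ')
    (d : FlipData s m φ ε σ σ' k e K K' τ τ') (c : SlideData s m K K' τ τ' m₀ P P' Q Q') :
    φ * (ε * K * φ) = K * φ :=
  calc φ * (ε * K * φ) = s (s ε) * (φ * K) * φ := by
        rw [h.counit_twist_comul d c]; simp only [interchange s]
    _ = s (s ε * K) * (φ * φ) := by
        rw [h.comul_twist_eq d]; simp only [map_mul, mul_assoc]
    _ = s (s ε * K * φ) * φ := by rw [h.coassoc]; simp only [map_mul, mul_assoc]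
    _ = s ε * s K * (s φ * φ) := by
        rw [← h.counit_twist_comul d c]; simp only [map_mul, mul_assoc]
    _ = s ε * (φ * K) * φ := by
        rw [← h.coassoc, h.comul_twist_eq d]; simp only [mul_assoc]
    _ = K * φ := by rw [← mul_assoc, h.counit_right, one_mul]

theorem twist_comul_left (h : StrictBraided s m η φ ε κ σ σ')
    (d : FlipData s m φ ε σ σ' k e K K' τ τ') (c : SlideData s m K K' τ τ' m₀ P P' Q Q') :
    ε * K * φ * φ = K * φ :=
  calc ε * K * φ * φ = s ε * K * (φ * φ) := by
        rw [h.counit_twist_comul d c]; simp only [mul_assoc]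
    _ = s ε * (s φ * K) * φ := by
        rw [h.coassoc, h.shift_comul_twist_eq d]; simp only [mul_assoc]
    _ = s (ε * φ) * K * φ := by simp only [map_mul, mul_assoc]
    _ = K * φ := by rw [h.counit_left, map_one, one_mul]

theorem cotwist_comul_mul (h : StrictBraided s m η φ ε κ σ σ')
    (d : FlipData s m φ ε σ σ' k e K K' τ τ') (c : SlideData s m K K' τ τ' m₀ P P' Q Q') :
    ε * K' * φ * (ε * K * φ) = 1 :=
  calc ε * K' * φ * (ε * K * φ) = ε * K' * (φ * (ε * K * φ)) := by simp only [mul_assoc]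
    _ = ε * φ := by
        rw [h.twist_comul d c]; simp only [mul_assoc, cancel s (h.cotwist_mul_twist d)]
    _ = 1 := h.counit_left

/-- For this order of the factors, K' first commutes past φ by colinearity; the commutation of K'₁₂
with K₂₃ then reduces it to the order already settled. -/
theorem twist_comul_mul (h : StrictBraided s m η φ ε κ σ σ')
    (d : FlipData s m φ ε σ σ' k e K K' τ τ') (c : SlideData s m K K' τ τ' m₀ P P' Q Q') :
    ε * K * φ * (ε * K' * φ) = 1 := by
  have h₁ : φ * (ε * K' * φ) = ε * K' * φ * φ :=
    calc φ * (ε * K' * φ) = ε * (s φ * K') * φ := by simp only [interchange s]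
      _ = ε * K' * (s φ * φ) := by rw [h.shift_comul_cotwist_eq d]; simp only [mul_assoc]
      _ = ε * K' * φ * φ := by rw [← h.coassoc]; simp only [mul_assoc]
  have h₂ : K * (φ * (ε * K' * φ)) = φ :=
    calc K * (φ * (ε * K' * φ)) = ε * (s K * K') * (φ * φ) := by
          rw [h₁]; simp only [interchange s]
      _ = ε * K' * (s K * φ) * φ := by
          rw [← h.cotwist_commute_twist d]
          simp only [mul_assoc]
      _ = ε * K' * φ * (K * φ) := by rw [← h.comul_twist_eq d]; simp only [mul_assoc]
      _ = (ε * K' * φ * φ) * (ε * K * φ) := by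
          rw [← h.twist_comul d c]; simp only [mul_assoc]
      _ = φ * (ε * K' * φ * (ε * K * φ)) := by rw [← h₁]; simp only [mul_assoc]
      _ = φ := by rw [h.cotwist_comul_mul d c, mul_one]
  calc ε * K * φ * (ε * K' * φ) = ε * (K * (φ * (ε * K' * φ))) := by
        simp only [mul_assoc]
    _ = 1 := by rw [h₂, h.counit_left]

end StrictBraided

end Antipode

end BraidedQG

namespace BraidedQG

set_option linter.unusedSectionVars false

/-! ### Integer powers of K and the axioms of Gₙ -/

section Deformation

variable {M : Type*} [Monoid M]

theorem zpow_slide {a b : Mˣ} {x : M} (h : (a : M) * x = x * b) (p : ℤ) :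
    ((a ^ p : Mˣ) : M) * x = x * ((b ^ p : Mˣ) : M) :=
  (SemiconjBy.units_zpow_right (a := x) (x := b) (y := a) h.symm p).symm

theorem map_val_zpow (s : M →* M) (a : Mˣ) (p : ℤ) :
    s ((a ^ p : Mˣ) : M) = ((Units.map s a ^ p : Mˣ) : M) := by
  rw [← map_zpow]; rfl

theorem val_zpow_mul_zpow (a : Mˣ) (p q : ℤ) :
    ((a ^ p : Mˣ) : M) * ((a ^ q : Mˣ) : M) = ((a ^ (p + q) : Mˣ) : M) := by
  rw [zpow_add, Units.val_mul]

theorem val_zpow_mul_neg (a : Mˣ) (p : ℤ) :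
    ((a ^ p : Mˣ) : M) * ((a ^ (-p) : Mˣ) : M) = 1 := by
  rw [val_zpow_mul_zpow, add_neg_cancel, zpow_zero, Units.val_one]

theorem val_zpow_neg_mul (a : Mˣ) (p : ℤ) :
    ((a ^ (-p) : Mˣ) : M) * ((a ^ p : Mˣ) : M) = 1 := by
  rw [val_zpow_mul_zpow, neg_add_cancel, zpow_zero, Units.val_one]

theorem val_mul_zpow {a b : Mˣ} (h : (a : M) * b = b * a) (p : ℤ) :
    (((a * b) ^ p : Mˣ) : M) = ((a ^ p : Mˣ) : M) * ((b ^ p : Mˣ) : M) := by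
  have : Commute a b := Units.ext h
  rw [this.mul_zpow, Units.val_mul]

theorem val_zpow_commute {a b : Mˣ} (h : (a : M) * b = b * a) (p q : ℤ) :
    ((a ^ p : Mˣ) : M) * ((b ^ q : Mˣ) : M) = ((b ^ q : Mˣ) : M) * ((a ^ p : Mˣ) : M) :=
  zpow_slide (zpow_slide h.symm q).symm p

theorem Local.zpow {s : M →* M} {k : ℕ} {a : Mˣ} (h : Local s k k (a : M)) (p : ℤ) :
    Local s k k ((a ^ p : Mˣ) : M) where
  comm y := (SemiconjBy.units_zpow_right (a := (⇑s)^[k] y) (x := a) (y := a) (h.comm y).symm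
    p).symm

variable {s : M →* M} {m η φ ε κ σ σ' k e K K' τ τ' m₀ P P' Q Q' : M}
  [Local s 2 1 m] [Local s 0 1 η] [Local s 1 2 φ] [Local s 1 0 ε] [Local s 1 1 κ]
  [Local s 2 2 σ] [Local s 2 2 σ'] [Local s 2 0 k] [Local s 2 0 e]
  [Local s 2 2 K] [Local s 2 2 K'] [Local s 2 2 τ] [Local s 2 2 τ']
  [Local s 2 1 m₀] [Local s 3 3 P] [Local s 3 3 P'] [Local s 3 3 Q] [Local s 3 3 Q']
  {J R N : Mˣ}

namespace StrictBraided

theorem zpow_comul (h : StrictBraided s m η φ ε κ σ σ')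
    (d : FlipData s m φ ε σ σ' k e K K' τ τ') (hJ : (J : M) = K) (p : ℤ) :
    φ * ((J ^ p : Mˣ) : M) = s ((J ^ p : Mˣ) : M) * φ := by
  rw [map_val_zpow, zpow_slide]
  simp only [Units.coe_map, hJ]
  exact (h.comul_twist_eq d).symm

theorem zpow_shift_comul (h : StrictBraided s m η φ ε κ σ σ')
    (d : FlipData s m φ ε σ σ' k e K K' τ τ') (hJ : (J : M) = K) (p : ℤ) :
    s φ * ((J ^ p : Mˣ) : M) = ((J ^ p : Mˣ) : M) * s φ := by
  rw [zpow_slide]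
  rw [hJ, h.shift_comul_twist_eq d]

/-- Since P and K commute, (PK)ᵖ = PᵖKᵖ, and the rule for p = 1 passes to all integers. -/
theorem zpow_mul_zero_right (h : StrictBraided s m η φ ε κ σ σ')
    (d : FlipData s m φ ε σ σ' k e K K' τ τ') (c : SlideData s m K K' τ τ' m₀ P P' Q Q')
    (hJ : (J : M) = K) (hR : (R : M) = P) (p : ℤ) :
    ((J ^ p : Mˣ) : M) * s m₀ = s m₀ * ((R ^ p : Mˣ) : M) * ((J ^ p : Mˣ) : M) := by
  rw [mul_assoc, ← val_mul_zpow, zpow_slide]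
  · rw [Units.val_mul, hJ, hR, h.twist_mul_zero_right d c, mul_assoc]
  · rw [hJ, hR, h.left_commute_twist d c]

theorem zpow_mul_zero_left (h : StrictBraided s m η φ ε κ σ σ')
    (d : FlipData s m φ ε σ σ' k e K K' τ τ') (c : SlideData s m K K' τ τ' m₀ P P' Q Q')
    (hJ : (J : M) = K) (hR : (R : M) = P) (p : ℤ) :
    ((J ^ p : Mˣ) : M) * m₀ = m₀ * ((R ^ p : Mˣ) : M) * s ((J ^ p : Mˣ) : M) := by
  rw [map_val_zpow, mul_assoc, ← val_mul_zpow, zpow_slide]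
  · rw [Units.val_mul, Units.coe_map, hJ, hR, h.left_eq_right d c,
      h.twist_mul_zero_left d c, mul_assoc]
  · rw [Units.coe_map, hJ, hR, h.left_commute d c]

theorem zpow_commute (h : StrictBraided s m η φ ε κ σ σ')
    (d : FlipData s m φ ε σ σ' k e K K' τ τ') (hJ : (J : M) = K) (p q : ℤ) :
    ((J ^ p : Mˣ) : M) * s ((J ^ q : Mˣ) : M) = s ((J ^ q : Mˣ) : M) * ((J ^ p : Mˣ) : M) := by
  rw [map_val_zpow, val_zpow_commute]
  rw [Units.coe_map, hJ, h.twist_commute d]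

theorem left_zpow_commute_twist (h : StrictBraided s m η φ ε κ σ σ')
    (d : FlipData s m φ ε σ σ' k e K K' τ τ') (c : SlideData s m K K' τ τ' m₀ P P' Q Q')
    (hJ : (J : M) = K) (hR : (R : M) = P) (p q : ℤ) :
    ((R ^ p : Mˣ) : M) * ((J ^ q : Mˣ) : M) = ((J ^ q : Mˣ) : M) * ((R ^ p : Mˣ) : M) := by
  rw [val_zpow_commute]
  rw [hJ, hR, h.left_commute_twist d c]

theorem left_zpow_commute (h : StrictBraided s m η φ ε κ σ σ')
    (d : FlipData s m φ ε σ σ' k e K K' τ τ') (c : SlideData s m K K' τ τ' m₀ P P' Q Q')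
    (hJ : (J : M) = K) (hR : (R : M) = P) (p q : ℤ) :
    ((R ^ p : Mˣ) : M) * s ((J ^ q : Mˣ) : M) = s ((J ^ q : Mˣ) : M) * ((R ^ p : Mˣ) : M) := by
  rw [map_val_zpow, val_zpow_commute]
  rw [Units.coe_map, hJ, hR, h.left_commute d c]

theorem zpow_shift_flip (h : StrictBraided s m η φ ε κ σ σ')
    (d : FlipData s m φ ε σ σ' k e K K' τ τ') (c : SlideData s m K K' τ τ' m₀ P P' Q Q')
    (hJ : (J : M) = K) (hR : (R : M) = P) (p : ℤ) :
    ((J ^ p : Mˣ) : M) * s τ = s τ * ((R ^ p : Mˣ) : M) := by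
  rw [zpow_slide]
  rw [hJ, hR, h.flip_left d c]

theorem shift_zpow_flip (h : StrictBraided s m η φ ε κ σ σ')
    (d : FlipData s m φ ε σ σ' k e K K' τ τ') (c : SlideData s m K K' τ τ' m₀ P P' Q Q')
    (hJ : (J : M) = K) (hR : (R : M) = P) (p : ℤ) :
    s ((J ^ p : Mˣ) : M) * τ = τ * ((R ^ p : Mˣ) : M) := by
  rw [map_val_zpow, zpow_slide]
  rw [Units.coe_map, hJ, hR, h.left_eq_right d c, h.flip_right d c]

theorem left_zpow_flip (h : StrictBraided s m η φ ε κ σ σ')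
    (d : FlipData s m φ ε σ σ' k e K K' τ τ') (c : SlideData s m K K' τ τ' m₀ P P' Q Q')
    (hJ : (J : M) = K) (hR : (R : M) = P) (p : ℤ) :
    ((R ^ p : Mˣ) : M) * τ = τ * s ((J ^ p : Mˣ) : M) := by
  rw [map_val_zpow, zpow_slide]
  rw [Units.coe_map, hJ, hR, h.left_flip d c]

theorem left_zpow_shift_flip (h : StrictBraided s m η φ ε κ σ σ')
    (d : FlipData s m φ ε σ σ' k e K K' τ τ') (c : SlideData s m K K' τ τ' m₀ P P' Q Q')
    (hJ : (J : M) = K) (hR : (R : M) = P) (p : ℤ) :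
    ((R ^ p : Mˣ) : M) * s τ = s τ * ((J ^ p : Mˣ) : M) := by
  rw [zpow_slide]
  rw [hJ, hR, h.left_shift_flip d c]

theorem zpow_one_left (h : StrictBraided s m η φ ε κ σ σ')
    (d : FlipData s m φ ε σ σ' k e K K' τ τ') (hJ : (J : M) = K) (p : ℤ) :
    ((J ^ p : Mˣ) : M) * η = η := by
  rw [zpow_slide (b := 1), one_zpow, Units.val_one, mul_one]
  rw [hJ, h.twist_one_left d, Units.val_one, mul_one]

theorem zpow_one_right (h : StrictBraided s m η φ ε κ σ σ')
    (d : FlipData s m φ ε σ σ' k e K K' τ τ') (hJ : (J : M) = K) (p : ℤ) :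
    ((J ^ p : Mˣ) : M) * s η = s η := by
  rw [zpow_slide (b := 1), one_zpow, Units.val_one, mul_one]
  rw [hJ, h.twist_one_right d, Units.val_one, mul_one]

theorem val_inv_eq (h : StrictBraided s m η φ ε κ σ σ')
    (d : FlipData s m φ ε σ σ' k e K K' τ τ') (hJ : (J : M) = K) : ((J⁻¹ : Mˣ) : M) = K' :=
  Units.inv_eq_of_mul_eq_one_left (by rw [hJ, h.cotwist_mul_twist d])

theorem zpow_antipode_right (h : StrictBraided s m η φ ε κ σ σ')
    (d : FlipData s m φ ε σ σ' k e K K' τ τ') (c : SlideData s m K K' τ τ' m₀ P P' Q Q')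
    (hJ : (J : M) = K) (p : ℤ) :
    ((J ^ p : Mˣ) : M) * s κ = s κ * ((J ^ (-p) : Mˣ) : M) := by
  rw [zpow_slide (b := J⁻¹), inv_zpow']
  rw [h.val_inv_eq d hJ, hJ, h.twist_antipode_right d c]

theorem zpow_antipode_left (h : StrictBraided s m η φ ε κ σ σ')
    (d : FlipData s m φ ε σ σ' k e K K' τ τ') (c : SlideData s m K K' τ τ' m₀ P P' Q Q')
    (hJ : (J : M) = K) (p : ℤ) :
    ((J ^ p : Mˣ) : M) * κ = κ * ((J ^ (-p) : Mˣ) : M) := by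
  rw [zpow_slide (b := J⁻¹), inv_zpow']
  rw [h.val_inv_eq d hJ, hJ, h.twist_antipode_left d c]

theorem zpow_flip_comul (h : StrictBraided s m η φ ε κ σ σ')
    (d : FlipData s m φ ε σ σ' k e K K' τ τ') (hJ : (J : M) = K) (p : ℤ) :
    ((J ^ p : Mˣ) : M) * (s τ * φ * s φ) = s τ * φ * s φ * ((J ^ p : Mˣ) : M) := by
  rw [zpow_slide]
  calc (J : M) * (s τ * φ * s φ) = s σ * φ * s φ := by
        rw [hJ, ← h.twist_flip_comul d]; simp only [mul_assoc]
    _ = s τ * (s K * φ * s φ) := by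
        rw [h.braiding_eq_flip_mul_twist d]; simp only [map_mul, mul_assoc]
    _ = s τ * φ * s φ * J := by rw [← h.comul_comul_twist d, hJ]; simp only [mul_assoc]

theorem shift_zpow_flip_comul (h : StrictBraided s m η φ ε κ σ σ')
    (d : FlipData s m φ ε σ σ' k e K K' τ τ') (hJ : (J : M) = K) (p : ℤ) :
    s (s ((J ^ p : Mˣ) : M)) * (s τ * φ * s φ) = s τ * φ * s φ * ((J ^ p : Mˣ) : M) := by
  rw [map_val_zpow, map_val_zpow, zpow_slide]
  calc s (s (J : M)) * (s τ * φ * s φ) = s σ * φ * s φ := by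
        rw [hJ, ← h.shift_twist_flip_comul d]; simp only [mul_assoc]
    _ = s τ * (s K * φ * s φ) := by
        rw [h.braiding_eq_flip_mul_twist d]; simp only [map_mul, mul_assoc]
    _ = s τ * φ * s φ * J := by rw [← h.comul_comul_twist d, hJ]; simp only [mul_assoc]

theorem comul_zpow (h : StrictBraided s m η φ ε κ σ σ')
    (d : FlipData s m φ ε σ σ' k e K K' τ τ') (c : SlideData s m K K' τ τ' m₀ P P' Q Q')
    (hJ : (J : M) = K) (hN : (N : M) = ε * K * φ) (p : ℤ) :
    φ * ((N ^ p : Mˣ) : M) = ((J ^ p : Mˣ) : M) * φ := by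
  rw [zpow_slide]
  rw [hJ, hN, h.twist_comul d c]

theorem comul_zpow_left (h : StrictBraided s m η φ ε κ σ σ')
    (d : FlipData s m φ ε σ σ' k e K K' τ τ') (c : SlideData s m K K' τ τ' m₀ P P' Q Q')
    (hJ : (J : M) = K) (hN : (N : M) = ε * K * φ) (p : ℤ) :
    ((N ^ p : Mˣ) : M) * φ = ((J ^ p : Mˣ) : M) * φ := by
  rw [zpow_slide (b := N), h.comul_zpow d c hJ hN]
  rw [hN, h.twist_comul_left d c, h.twist_comul d c]

theorem counit_zpow_comul (h : StrictBraided s m η φ ε κ σ σ')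
    (d : FlipData s m φ ε σ σ' k e K K' τ τ') (c : SlideData s m K K' τ τ' m₀ P P' Q Q')
    (hJ : (J : M) = K) (hN : (N : M) = ε * K * φ) (p : ℤ) :
    ε * ((J ^ p : Mˣ) : M) * φ = ((N ^ p : Mˣ) : M) := by
  rw [mul_assoc, ← h.comul_zpow d c hJ hN, ← mul_assoc, h.counit_left, one_mul]

theorem shift_counit_zpow_comul (h : StrictBraided s m η φ ε κ σ σ')
    (d : FlipData s m φ ε σ σ' k e K K' τ τ') (c : SlideData s m K K' τ τ' m₀ P P' Q Q')
    (hJ : (J : M) = K) (hN : (N : M) = ε * K * φ) (p : ℤ) :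
    s ε * ((J ^ p : Mˣ) : M) * φ = ((N ^ p : Mˣ) : M) := by
  rw [mul_assoc, ← h.comul_zpow d c hJ hN, ← mul_assoc, h.counit_right, one_mul]

theorem shift_zpow_comul (h : StrictBraided s m η φ ε κ σ σ')
    (d : FlipData s m φ ε σ σ' k e K K' τ τ') (c : SlideData s m K K' τ τ' m₀ P P' Q Q')
    (hJ : (J : M) = K) (hN : (N : M) = ε * K * φ) (p : ℤ) :
    s ((N ^ p : Mˣ) : M) * φ = ((J ^ p : Mˣ) : M) * φ :=
  calc s ((N ^ p : Mˣ) : M) * φ = s ε * s ((J ^ p : Mˣ) : M) * (s φ * φ) := by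
        rw [← h.counit_zpow_comul d c hJ hN]; simp only [map_mul, mul_assoc]
    _ = s ε * (φ * ((J ^ p : Mˣ) : M)) * φ := by
        rw [← h.coassoc, h.zpow_comul d hJ]; simp only [mul_assoc]
    _ = ((J ^ p : Mˣ) : M) * φ := by rw [← mul_assoc, h.counit_right, one_mul]

theorem mul_twist_zpow (c : SlideData s m K K' τ τ' m₀ P P' Q Q') (hJ : (J : M) = K) (n : ℤ) :
    m * ((J ^ (1 - n) : Mˣ) : M) = m₀ * ((J ^ (-n) : Mˣ) : M) := by
  rw [sub_eq_add_neg, zpow_add, zpow_one, Units.val_mul, hJ, c.mul_eq, mul_assoc]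

theorem flip_braiding_comul (h : StrictBraided s m η φ ε κ σ σ')
    (d : FlipData s m φ ε σ σ' k e K K' τ τ') :
    τ * s φ * τ' * s φ = s (s τ) * s φ * s τ' * φ :=
  calc τ * s φ * τ' * s φ = τ * (s φ * K) * σ' * s φ := by
        rw [d.coflip_eq]; simp only [mul_assoc]
    _ = σ * s φ * σ' * s φ := by
        rw [h.shift_comul_twist_eq d, h.braiding_eq_flip_mul_twist d]; simp only [mul_assoc]
    _ = s (s τ) * (s (s K) * s φ) * s σ' * φ := by
        rw [h.braiding_comul, h.braiding_eq_flip_mul_twist d]; simp only [map_mul, mul_assoc]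
    _ = s (s τ) * s φ * s τ' * φ := by
        rw [← map_mul s (s K), ← h.comul_twist_eq d, d.coflip_eq]
        simp only [map_mul, mul_assoc]

/-- The deformation of a braided quantum group by the powers of `K`. -/
theorem deform (h : StrictBraided s m η φ ε κ σ σ')
    (d : FlipData s m φ ε σ σ' k e K K' τ τ') (c : SlideData s m K K' τ τ' m₀ P P' Q Q')
    (hJ : (J : M) = K) (n : ℤ) :
    StrictBraided s (m * ((J ^ (1 - n) : Mˣ) : M)) η φ ε
      (κ * (ε * ((J ^ (1 - n) : Mˣ) : M) * φ)) (τ * ((J ^ n : Mˣ) : M))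
      (((J ^ (-n) : Mˣ) : M) * τ') := by
  obtain ⟨R, hR⟩ : ∃ R : Mˣ, (R : M) = P :=
    ⟨⟨P, P', h.left_mul_inv d c, h.left_inv_mul d c⟩, rfl⟩
  obtain ⟨N, hN⟩ : ∃ N : Mˣ, (N : M) = ε * K * φ :=
    ⟨⟨_, _, h.twist_comul_mul d c, h.cotwist_comul_mul d c⟩, rfl⟩
  have hloc (p : ℤ) : Local s 2 2 ((J ^ p : Mˣ) : M) := by
    refine Local.zpow ?_ p
    rw [hJ]; infer_instance
  rw [h.counit_zpow_comul d c hJ hN]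
  constructor
  · simp only [mul_assoc, cancel s (val_zpow_mul_neg J n), h.flip_mul_coflip d]
  · simp only [mul_assoc, cancel s (h.coflip_mul_flip d), val_zpow_neg_mul]
  · rw [mul_twist_zpow c hJ]
    calc m₀ * ((J ^ (-n) : Mˣ) : M) * (m₀ * ((J ^ (-n) : Mˣ) : M))
      _ = m₀ * (((J ^ (-n) : Mˣ) : M) * m₀) * ((J ^ (-n) : Mˣ) : M) := by
          simp only [mul_assoc]
      _ = (m₀ * m₀) * ((R ^ (-n) : Mˣ) : M) *
          (s ((J ^ (-n) : Mˣ) : M) * ((J ^ (-n) : Mˣ) : M)) := by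
          rw [h.zpow_mul_zero_left d c hJ hR]; simp only [mul_assoc]
      _ = m₀ * (s m₀ * ((R ^ (-n) : Mˣ) : M) * ((J ^ (-n) : Mˣ) : M)) *
          s ((J ^ (-n) : Mˣ) : M) := by
          rw [h.assoc_zero d c, ← h.zpow_commute d hJ]; simp only [mul_assoc]
      _ = m₀ * ((J ^ (-n) : Mˣ) : M) * s (m₀ * ((J ^ (-n) : Mˣ) : M)) := by
          rw [← h.zpow_mul_zero_right d c hJ hR]; simp only [map_mul, mul_assoc]
  · rw [mul_assoc, h.zpow_one_left d hJ, h.unit_left]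
  · rw [mul_assoc, h.zpow_one_right d hJ, h.unit_right]
  · exact h.coassoc
  · exact h.counit_left
  · exact h.counit_right
  -- Kⁿ meeting m₀ splits into K₁₃ⁿK₂₃ⁿ, which the two braidings absorb; K⁻ⁿ slides through τ₂₃ and
  -- τ₁₂ and joins the product as K₂₃⁻ⁿ.
  · rw [mul_twist_zpow c hJ]
    calc τ * ((J ^ n : Mˣ) : M) * (m₀ * ((J ^ (-n) : Mˣ) : M))
      _ = τ * (((J ^ n : Mˣ) : M) * m₀) * ((J ^ (-n) : Mˣ) : M) := by simp only [mul_assoc]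
      _ = (τ * m₀) * ((R ^ n : Mˣ) : M) * (s ((J ^ n : Mˣ) : M) * ((J ^ (-n) : Mˣ) : M)) := by
          rw [h.zpow_mul_zero_left d c hJ hR]; simp only [mul_assoc]
      _ = s m₀ * τ * s τ * (((R ^ n : Mˣ) : M) * ((J ^ (-n) : Mˣ) : M)) *
          s ((J ^ n : Mˣ) : M) := by
          rw [h.flip_mul_zero_left d c, ← h.zpow_commute d hJ]; simp only [mul_assoc]
      _ = s m₀ * τ * (s τ * ((J ^ (-n) : Mˣ) : M)) * ((R ^ n : Mˣ) : M) *
          s ((J ^ n : Mˣ) : M) := by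
          rw [h.left_zpow_commute_twist d c hJ hR]; simp only [mul_assoc]
      _ = s m₀ * (τ * ((R ^ (-n) : Mˣ) : M)) * (s τ * ((R ^ n : Mˣ) : M)) *
          s ((J ^ n : Mˣ) : M) := by
          rw [← h.left_zpow_shift_flip d c hJ hR]; simp only [mul_assoc]
      _ = s (m₀ * ((J ^ (-n) : Mˣ) : M)) * (τ * ((J ^ n : Mˣ) : M)) *
          s (τ * ((J ^ n : Mˣ) : M)) := by
          rw [← h.shift_zpow_flip d c hJ hR, ← h.zpow_shift_flip d c hJ hR]
          simp only [map_mul, mul_assoc]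
  · rw [mul_twist_zpow c hJ]
    calc τ * ((J ^ n : Mˣ) : M) * s (m₀ * ((J ^ (-n) : Mˣ) : M))
      _ = τ * (((J ^ n : Mˣ) : M) * s m₀) * s ((J ^ (-n) : Mˣ) : M) := by
          simp only [map_mul, mul_assoc]
      _ = (τ * s m₀) * ((R ^ n : Mˣ) : M) *
          (((J ^ n : Mˣ) : M) * s ((J ^ (-n) : Mˣ) : M)) := by
          rw [h.zpow_mul_zero_right d c hJ hR]; simp only [mul_assoc]
      _ = m₀ * s τ * τ * (((R ^ n : Mˣ) : M) * s ((J ^ (-n) : Mˣ) : M)) *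
          ((J ^ n : Mˣ) : M) := by
          rw [h.flip_mul_zero_right d c, h.zpow_commute d hJ]; simp only [mul_assoc]
      _ = m₀ * s τ * (τ * s ((J ^ (-n) : Mˣ) : M)) * ((R ^ n : Mˣ) : M) *
          ((J ^ n : Mˣ) : M) := by
          rw [h.left_zpow_commute d c hJ hR]; simp only [mul_assoc]
      _ = m₀ * (s τ * ((R ^ (-n) : Mˣ) : M)) * (τ * ((R ^ n : Mˣ) : M)) *
          ((J ^ n : Mˣ) : M) := by
          rw [← h.left_zpow_flip d c hJ hR]; simp only [mul_assoc]
      _ = m₀ * ((J ^ (-n) : Mˣ) : M) * s (τ * ((J ^ n : Mˣ) : M)) *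
          (τ * ((J ^ n : Mˣ) : M)) := by
          rw [← h.shift_zpow_flip d c hJ hR, ← h.zpow_shift_flip d c hJ hR]
          simp only [map_mul, mul_assoc]
  -- The given K⁻ⁿ leaves on strands 3 and 4. A second K⁻ⁿ is created on strands 1 and 2 together
  -- with a Kⁿ, which passes φ⊗φ to join τ in the middle.
  · rw [mul_twist_zpow c hJ]
    calc φ * (m₀ * ((J ^ (-n) : Mˣ) : M))
      _ = m₀ * s (s m₀) * (s τ * φ * s φ * ((J ^ (-n) : Mˣ) : M)) := by
          rw [← mul_assoc, h.comul_mul_zero d c]; simp only [mul_assoc]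
      _ = m₀ * s (s m₀) * s (s ((J ^ (-n) : Mˣ) : M)) *
          (((J ^ (-n) : Mˣ) : M) * (s τ * φ * s φ) * ((J ^ n : Mˣ) : M)) := by
          rw [← h.shift_zpow_flip_comul d hJ, h.zpow_flip_comul d hJ]
          simp only [mul_assoc, val_zpow_neg_mul, mul_one]
      _ = m₀ * ((J ^ (-n) : Mˣ) : M) * s (s (m₀ * ((J ^ (-n) : Mˣ) : M))) * s τ *
          (φ * s φ * ((J ^ n : Mˣ) : M)) := by
          simp only [interchange s]
      _ = m₀ * ((J ^ (-n) : Mˣ) : M) * s (s (m₀ * ((J ^ (-n) : Mˣ) : M))) * s τ *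
          (φ * ((J ^ n : Mˣ) : M) * s φ) := by
          rw [mul_assoc φ, h.zpow_shift_comul d hJ, mul_assoc φ]
      _ = _ := by rw [h.zpow_comul d hJ]; simp only [map_mul, mul_assoc]
  · calc τ * ((J ^ n : Mˣ) : M) * s φ * (((J ^ (-n) : Mˣ) : M) * τ') * s φ
      _ = τ * (((J ^ n : Mˣ) : M) * s φ) * ((J ^ (-n) : Mˣ) : M) * τ' * s φ := by
          simp only [mul_assoc]
      _ = τ * s φ * τ' * s φ := by
          rw [← h.zpow_shift_comul d hJ]
          simp only [mul_assoc, cancel s (val_zpow_mul_neg J n), one_mul]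
      _ = s (s τ) * s φ * s (((J ^ n : Mˣ) : M) * ((J ^ (-n) : Mˣ) : M)) * s τ' * φ := by
          rw [h.flip_braiding_comul d, val_zpow_mul_neg, map_one, mul_one]
      _ = s (s τ) * s (φ * ((J ^ n : Mˣ) : M)) * s (((J ^ (-n) : Mˣ) : M) * τ') * φ := by
          simp only [map_mul, mul_assoc]
      _ = _ := by rw [h.zpow_comul d hJ]; simp only [map_mul, mul_assoc]
  -- Passing κ inverts K¹⁻ⁿ, which then cancels the K¹⁻ⁿ that N¹⁻ⁿ produces next to φ.
  · calc m * ((J ^ (1 - n) : Mˣ) : M) * s (κ * ((N ^ (1 - n) : Mˣ) : M)) * φ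
      _ = m * (((J ^ (1 - n) : Mˣ) : M) * s κ) * (s ((N ^ (1 - n) : Mˣ) : M) * φ) := by
          simp only [map_mul, mul_assoc]
      _ = m * s κ * φ := by
          rw [h.zpow_antipode_right d c hJ, h.shift_zpow_comul d c hJ hN]
          simp only [mul_assoc, cancel s (val_zpow_neg_mul J (1 - n))]
      _ = η * ε := h.antipode_right
  · calc m * ((J ^ (1 - n) : Mˣ) : M) * (κ * ((N ^ (1 - n) : Mˣ) : M)) * φ
      _ = m * (((J ^ (1 - n) : Mˣ) : M) * κ) * (((N ^ (1 - n) : Mˣ) : M) * φ) := by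
          simp only [mul_assoc]
      _ = m * κ * φ := by
          rw [h.zpow_antipode_left d c hJ, h.comul_zpow_left d c hJ hN]
          simp only [mul_assoc, cancel s (val_zpow_neg_mul J (1 - n))]
      _ = η * ε := h.antipode_left

theorem counit_zpow_comul_eq (h : StrictBraided s m η φ ε κ σ σ')
    (d : FlipData s m φ ε σ σ' k e K K' τ τ') (c : SlideData s m K K' τ τ' m₀ P P' Q Q')
    (hJ : (J : M) = K) (p : ℤ) :
    ε * ((J ^ p : Mˣ) : M) * φ = s ε * ((J ^ p : Mˣ) : M) * φ := by
  obtain ⟨N, hN⟩ : ∃ N : Mˣ, (N : M) = ε * K * φ :=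
    ⟨⟨_, _, h.twist_comul_mul d c, h.cotwist_comul_mul d c⟩, rfl⟩
  rw [h.counit_zpow_comul d c hJ hN, h.shift_counit_zpow_comul d c hJ hN]

theorem counit_zpow_comul_inv (h : StrictBraided s m η φ ε κ σ σ')
    (d : FlipData s m φ ε σ σ' k e K K' τ τ') (c : SlideData s m K K' τ τ' m₀ P P' Q Q')
    (hJ : (J : M) = K) (p : ℤ) :
    (ε * ((J ^ p : Mˣ) : M) * φ) * (ε * ((J ^ (-p) : Mˣ) : M) * φ) = 1 := by
  obtain ⟨N, hN⟩ : ∃ N : Mˣ, (N : M) = ε * K * φ :=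
    ⟨⟨_, _, h.twist_comul_mul d c, h.cotwist_comul_mul d c⟩, rfl⟩
  rw [h.counit_zpow_comul d c hJ hN, h.counit_zpow_comul d c hJ hN, val_zpow_mul_neg]

end StrictBraided

end Deformation

end BraidedQG

namespace BraidedQG

/-! ### Statements free of the auxiliary operators -/

section Summary

variable {M : Type*} [Monoid M] {s : M →* M}

theorem Local.mul {j k l : ℕ} {x y : M} (hx : Local s k l x) (hy : Local s j k y) :
    Local s j l (x * y) where
  comm z := by rw [mul_assoc, hy.comm, ← mul_assoc, hx.comm, mul_assoc]

theorem Local.widen {k l : ℕ} {x : M} (hx : Local s k l x) : Local s (k + 1) (l + 1) x where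
  comm z := by rw [Function.iterate_succ_apply, Function.iterate_succ_apply, hx.comm]

/-- ST⁻¹ is the conjugate of T⁻¹S by T; with S = σ and T = τ this reads σₙ = τKⁿ. -/
theorem flip_zpow {G : Type*} [Group G] (S T : G) (n : ℤ) :
    (S * T⁻¹) ^ (n - 1) * S = T * (T⁻¹ * S) ^ n := by
  have h : S * T⁻¹ = T * (T⁻¹ * S) * T⁻¹ := by group
  rw [h, conj_zpow, zpow_sub_one]
  group

theorem flip_zpow_inv_mul {G : Type*} [Group G] (S T : G) (n : ℤ) :
    ((S * T⁻¹) ^ (n - 1) * S)⁻¹ * S = (T⁻¹ * S) ^ (1 - n) := by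
  rw [flip_zpow, sub_eq_add_neg, add_comm, zpow_add_one, zpow_neg, mul_inv_rev]
  group

/-- The operators built from the structure maps of a braided quantum group act locally. -/
theorem exists_flipData_slideData (m φ ε σ σ' : M) [Local s 2 1 m] [Local s 1 2 φ] [Local s 1 0 ε]
    [Local s 2 2 σ] [Local s 2 2 σ'] :
    ∃ k e K K' τ τ' m₀ P P' Q Q' : M,
      (Local s 2 0 k ∧ Local s 2 0 e ∧ Local s 2 2 K ∧ Local s 2 2 K' ∧ Local s 2 2 τ ∧
        Local s 2 2 τ' ∧ Local s 2 1 m₀ ∧ Local s 3 3 P ∧ Local s 3 3 P' ∧ Local s 3 3 Q ∧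
        Local s 3 3 Q') ∧
      FlipData s m φ ε σ σ' k e K K' τ τ' ∧ SlideData s m K K' τ τ' m₀ P P' Q Q' := by
  have lm : Local s 2 1 m := inferInstance
  have lφ : Local s 1 2 φ := inferInstance
  have lε : Local s 1 0 ε := inferInstance
  have lσ : Local s 2 2 σ := inferInstance
  have lσ' : Local s 2 2 σ' := inferInstance
  have lk : Local s 2 0 (ε * ε * σ) := (lε.mul lε.widen).mul lσ
  have le : Local s 2 0 (ε * m) := lε.mul lm
  have lK {k : M} (lk : Local s 2 0 k) : Local s 2 2 (s k * φ * s φ) :=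
    ((Local.shift s 2 0 k).widen.mul lφ.widen.widen).mul (Local.shift s 1 2 φ)
  have lτ : Local s 2 2 (s (s ε) * s σ' * φ * σ) :=
    ((Local.mul (Local.shift s 2 1 (s ε)) (Local.shift s 2 2 σ')).mul lφ.widen).mul lσ
  have lτ' : Local s 2 2 (s (ε * ε * σ) * φ * s φ * σ') := (lK lk).mul lσ'
  have lP {x y z : M} (hx : Local s 2 2 x) (hy : Local s 2 2 y) (hz : Local s 2 2 z) :
      Local s 3 3 (s x * y * s z) :=
    ((Local.shift s 2 2 x).mul hy.widen).mul (Local.shift s 2 2 z)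
  have lQ {x y z : M} (hx : Local s 2 2 x) (hy : Local s 2 2 y) (hz : Local s 2 2 z) :
      Local s 3 3 (x * s y * z) :=
    (hx.widen.mul (Local.shift s 2 2 y)).mul hz.widen
  exact ⟨_, _, _, _, _, _, _, _, _, _, _,
    ⟨lk, le, lK lk, lK le, lτ, lτ', lm.mul (lK lk), lP lτ' (lK lk) lτ, lP lτ' (lK le) lτ,
      lQ lτ' (lK lk) lτ, lQ lτ' (lK le) lτ⟩,
    ⟨rfl, rfl, rfl, rfl, rfl, rfl⟩, ⟨rfl, rfl, rfl, rfl, rfl⟩⟩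

variable {m η φ ε κ σ σ' : M} [Local s 2 1 m] [Local s 0 1 η] [Local s 1 2 φ] [Local s 1 0 ε]
  [Local s 1 1 κ] [Local s 2 2 σ] [Local s 2 2 σ']

/-- The inverse τ' = Kσ⁻¹ is the defining formula of τ with σ and σ⁻¹ exchanged, because K =
(id²⊗ε)(id⊗σ)(φ⊗id) by `braiding_counit_right`. -/
theorem StrictBraided.flip_inverse (h : StrictBraided s m η φ ε κ σ σ') :
    (s (s ε) * s σ' * φ * σ) * (s (s ε) * s σ * φ * σ') = 1 ∧
      (s (s ε) * s σ * φ * σ') * (s (s ε) * s σ' * φ * σ) = 1 := by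
  obtain ⟨k, e, K, K', τ, τ', m₀, P, P', Q, Q', ⟨_, _, _, _, _, _, _, _, _, _, _⟩, d, c⟩ :=
    exists_flipData_slideData (s := s) m φ ε σ σ'
  have h₁ : s (s ε) * s σ * φ * σ' = τ' :=
    calc s (s ε) * s σ * φ * σ' = s (s ε * σ) * φ * σ' := by rw [map_mul]
      _ = s k * φ * s φ * σ' := by
          rw [h.braiding_counit_right d]; simp only [interchange s]
      _ = τ' := by rw [d.coflip_eq, d.twist_eq]
  rw [h₁, ← d.flip_eq]
  exact ⟨h.flip_mul_coflip d, h.coflip_mul_flip d⟩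

/-- The family of deformed braided quantum groups in the strict calculus. -/
theorem StrictBraided.deformation (h : StrictBraided s m η φ ε κ σ σ') {S T : Mˣ}
    (hS : (S : M) = σ) (hT : (T : M) = s (s ε) * s σ' * φ * σ) (n : ℤ) {D : Mˣ}
    (hD : D = (S * T⁻¹) ^ (n - 1) * S) :
    StrictBraided s (m * (((D⁻¹ : Mˣ) : M) * S)) η φ ε (κ * (ε * (((D⁻¹ : Mˣ) : M) * S) * φ))
        (D : M) ((D⁻¹ : Mˣ) : M) ∧
      ε * (((D⁻¹ : Mˣ) : M) * S) * φ = s ε * (((D⁻¹ : Mˣ) : M) * S) * φ ∧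
      (ε * (((D⁻¹ : Mˣ) : M) * S) * φ) * (ε * (((S⁻¹ : Mˣ) : M) * D) * φ) = 1 ∧
      (ε * (((S⁻¹ : Mˣ) : M) * D) * φ) * (ε * (((D⁻¹ : Mˣ) : M) * S) * φ) = 1 := by
  obtain ⟨k, e, K, K', τ, τ', m₀, P, P', Q, Q', ⟨_, _, _, _, _, _, _, _, _, _, _⟩, d, c⟩ :=
    exists_flipData_slideData (s := s) m φ ε σ σ'
  rw [← d.flip_eq] at hT
  have hT' : ((T⁻¹ : Mˣ) : M) = τ' :=
    Units.inv_eq_of_mul_eq_one_left (by rw [hT, h.coflip_mul_flip d])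
  have hJ : ((T⁻¹ * S : Mˣ) : M) = K := by
    rw [Units.val_mul, hT', hS, h.braiding_eq_flip_mul_twist d, ← mul_assoc,
      h.coflip_mul_flip d, one_mul]
  have h₁ : ((D⁻¹ : Mˣ) : M) * S = (((T⁻¹ * S) ^ (1 - n) : Mˣ) : M) := by
    rw [← flip_zpow_inv_mul, ← hD, Units.val_mul]
  have h₂ : ((S⁻¹ : Mˣ) : M) * D = (((T⁻¹ * S) ^ (-(1 - n)) : Mˣ) : M) := by
    rw [zpow_neg, ← flip_zpow_inv_mul, ← hD, mul_inv_rev, inv_inv, Units.val_mul]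
  have h₃ : (D : M) = τ * (((T⁻¹ * S) ^ n : Mˣ) : M) := by
    rw [hD, flip_zpow, Units.val_mul, hT]
  have h₄ : ((D⁻¹ : Mˣ) : M) = (((T⁻¹ * S) ^ (-n) : Mˣ) : M) * τ' := by
    rw [hD, flip_zpow, mul_inv_rev, zpow_neg, Units.val_mul, hT']
  rw [h₁, h₂, h₃, h₄]
  refine ⟨h.deform d c hJ n, h.counit_zpow_comul_eq d c hJ _, h.counit_zpow_comul_inv d c hJ _, ?_⟩
  simpa only [neg_neg] using h.counit_zpow_comul_inv d c hJ (-(1 - n))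

theorem StrictBraided.counit_mul_flip (h : StrictBraided s m η φ ε κ σ σ') {T : Mˣ}
    (hT : (T : M) = s (s ε) * s σ' * φ * σ) : ε * (m * (((T⁻¹ : Mˣ) : M) * σ)) = ε * ε := by
  obtain ⟨k, e, K, K', τ, τ', m₀, P, P', Q, Q', ⟨_, _, _, _, _, _, _, _, _, _, _⟩, d, c⟩ :=
    exists_flipData_slideData (s := s) m φ ε σ σ'
  rw [← d.flip_eq] at hT
  have hT' : ((T⁻¹ : Mˣ) : M) = τ' :=
    Units.inv_eq_of_mul_eq_one_left (by rw [hT, h.coflip_mul_flip d])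
  rw [hT', h.braiding_eq_flip_mul_twist d, ← mul_assoc τ', h.coflip_mul_flip d, one_mul,
    ← c.mul_eq, h.counit_mul_zero d c]

end Summary

end BraidedQG

open scoped TensorProduct

noncomputable section

namespace BraidedQG

/-! ### Linear maps as endomorphisms of an absorbing space -/

section Model

/-- A way of absorbing the vector space `X` into the reservoir `W`. -/
class Absorbed (W X : Type*) [AddCommGroup W] [Module ℂ W] [AddCommGroup X] [Module ℂ X] where
  /-- The absorbing isomorphism. -/
  equiv : X ⊗[ℂ] W ≃ₗ[ℂ] W

variable {W X Y Z : Type*} [AddCommGroup W] [Module ℂ W] [AddCommGroup X] [Module ℂ X]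
  [AddCommGroup Y] [Module ℂ Y] [AddCommGroup Z] [Module ℂ Z]

instance Absorbed.scalar : Absorbed W ℂ where
  equiv := TensorProduct.lid ℂ W

instance Absorbed.tensor [Absorbed W X] [Absorbed W Y] : Absorbed W (X ⊗[ℂ] Y) where
  equiv := TensorProduct.assoc ℂ X Y W ≪≫ₗ
    TensorProduct.congr (LinearEquiv.refl ℂ X) Absorbed.equiv ≪≫ₗ Absorbed.equiv

/-- Absorption of the vector `x` by the reservoir. -/
def absorb [Absorbed W X] (x : X) : Module.End ℂ W :=
  Absorbed.equiv.toLinearMap ∘ₗ TensorProduct.mk ℂ X W x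

theorem absorb_apply [Absorbed W X] (x : X) (w : W) :
    absorb x w = Absorbed.equiv (x ⊗ₜ[ℂ] w) := rfl

theorem absorb_tmul [Absorbed W X] [Absorbed W Y] (x : X) (y : Y) (w : W) :
    absorb (x ⊗ₜ[ℂ] y) w = absorb x (absorb y w) := rfl

theorem absorb_scalar (c : ℂ) (w : W) : absorb c w = c • w :=
  TensorProduct.lid_tmul w c

theorem absorb_smul [Absorbed W X] (c : ℂ) (x : X) (w : W) :
    absorb (c • x) w = c • absorb x w := by
  rw [absorb_apply, absorb_apply, ← TensorProduct.smul_tmul', map_smul]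

variable (X Y Z) in
theorem absorb_ext [Absorbed W X] {u v : Module.End ℂ W}
    (h : ∀ (x : X) (w : W), u (absorb x w) = v (absorb x w)) : u = v := by
  have : u ∘ₗ (Absorbed.equiv (X := X)).toLinearMap = v ∘ₗ Absorbed.equiv.toLinearMap :=
    TensorProduct.ext' h
  ext w
  simpa using LinearMap.congr_fun this (Absorbed.equiv.symm w)

variable (X Y Z) in
theorem absorb_ext₂ [Absorbed W X] [Absorbed W Y] {u v : Module.End ℂ W}
    (h : ∀ (x : X) (y : Y) (w : W), u (absorb x (absorb y w)) = v (absorb x (absorb y w))) :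
    u = v := by
  refine absorb_ext X fun x w => ?_
  have : u * absorb x = v * absorb x := absorb_ext Y (h x)
  exact LinearMap.congr_fun this w

variable (X Y Z) in
theorem absorb_ext₃ [Absorbed W X] [Absorbed W Y] [Absorbed W Z] {u v : Module.End ℂ W}
    (h : ∀ (x : X) (y : Y) (z : Z) (w : W),
      u (absorb x (absorb y (absorb z w))) = v (absorb x (absorb y (absorb z w)))) :
    u = v := by
  refine absorb_ext X fun x w => ?_
  have : u * absorb x = v * absorb x := absorb_ext₂ Y Z (h x)
  exact LinearMap.congr_fun this w

/-- The endomorphism of the reservoir induced by a linear map. -/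
def induced (W : Type*) [AddCommGroup W] [Module ℂ W] [Absorbed W X] [Absorbed W Y]
    (f : X →ₗ[ℂ] Y) : Module.End ℂ W :=
  Absorbed.equiv.toLinearMap ∘ₗ f.rTensor W ∘ₗ Absorbed.equiv.symm.toLinearMap

theorem induced_absorb [Absorbed W X] [Absorbed W Y] (f : X →ₗ[ℂ] Y) (x : X) (w : W) :
    induced W f (absorb x w) = absorb (f x) w := by
  simp [induced, absorb_apply]

/-- Adding a strand `X` on the left of an endomorphism of the reservoir. -/
def strand (W X : Type*) [AddCommGroup W] [Module ℂ W] [AddCommGroup X] [Module ℂ X]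
    [Absorbed W X] : Module.End ℂ W →* Module.End ℂ W where
  toFun u := Absorbed.equiv.toLinearMap ∘ₗ u.lTensor X ∘ₗ Absorbed.equiv.symm.toLinearMap
  map_one' := absorb_ext X fun x w => by simp [absorb_apply]
  map_mul' u v := absorb_ext X fun x w => by simp [absorb_apply]

theorem strand_absorb [Absorbed W X] (u : Module.End ℂ W) (x : X) (w : W) :
    strand W X u (absorb x w) = absorb x (u w) := by
  simp [strand, absorb_apply]

theorem induced_injective [Absorbed W X] [Absorbed W Y] (hW : Nontrivial W ∨ Subsingleton X)
    {f g : X →ₗ[ℂ] Y} (h : induced W f = induced W g) : f = g := by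
  ext x
  rcases hW with hW | hW
  · obtain ⟨w, hw⟩ := exists_ne (0 : W)
    have h₁ : f x ⊗ₜ[ℂ] w = g x ⊗ₜ[ℂ] w := by
      apply (Absorbed.equiv (W := W) (X := Y)).injective
      have := LinearMap.congr_fun h (absorb x w)
      rwa [induced_absorb, induced_absorb] at this
    obtain ⟨l, hl⟩ : ∃ l : Module.Dual ℂ W, l w ≠ 0 := by
      by_contra! hl
      exact hw ((Module.forall_dual_apply_eq_zero_iff ℂ w).1 hl)
    have h₂ := congrArg (fun t => TensorProduct.rid ℂ Y (l.lTensor Y t)) h₁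
    simp only [LinearMap.lTensor_tmul, TensorProduct.rid_tmul] at h₂
    exact smul_right_injective Y hl h₂
  · rw [Subsingleton.elim x 0, map_zero, map_zero]

variable [Absorbed W X] [Absorbed W Y] [Absorbed W Z]

theorem induced_id : induced W (LinearMap.id : X →ₗ[ℂ] X) = 1 :=
  absorb_ext X fun x w => induced_absorb _ x w

theorem induced_comp (f : Y →ₗ[ℂ] Z) (g : X →ₗ[ℂ] Y) :
    induced W (f ∘ₗ g) = induced W f * induced W g :=
  absorb_ext X fun x w => by simp [induced_absorb]

theorem induced_lTensor (f : Y →ₗ[ℂ] Z) :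
    induced W (f.lTensor X) = strand W X (induced W f) :=
  absorb_ext₂ X Y fun x y w => by
    rw [← absorb_tmul, induced_absorb, LinearMap.lTensor_tmul, absorb_tmul, absorb_tmul,
      strand_absorb, induced_absorb]

/-- Spectators on the right are swallowed by W. For the same reason associators and unitors induce
the identity, which makes the calculus strict. -/
theorem induced_rTensor (f : Y →ₗ[ℂ] Z) : induced W (f.rTensor X) = induced W f :=
  absorb_ext₂ Y X fun y x w => by
    rw [← absorb_tmul, induced_absorb, LinearMap.rTensor_tmul, absorb_tmul, absorb_tmul,
      induced_absorb]

theorem induced_map {X' Y' : Type*} [AddCommGroup X'] [Module ℂ X'] [AddCommGroup Y']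
    [Module ℂ Y'] [Absorbed W X'] [Absorbed W Y'] (f : X →ₗ[ℂ] X') (g : Y →ₗ[ℂ] Y') :
    induced W (TensorProduct.map f g) = induced W f * strand W X (induced W g) := by
  rw [← LinearMap.rTensor_comp_lTensor, induced_comp, induced_lTensor, induced_rTensor]

theorem induced_assoc : induced W (TensorProduct.assoc ℂ X Y Z).toLinearMap = 1 :=
  absorb_ext₃ X Y Z fun x y z w => by
    rw [← absorb_tmul y z, ← absorb_tmul x, Module.End.one_apply]
    exact induced_absorb (TensorProduct.assoc ℂ X Y Z).toLinearMap ((x ⊗ₜ[ℂ] y) ⊗ₜ[ℂ] z) w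

theorem induced_assoc_symm : induced W (TensorProduct.assoc ℂ X Y Z).symm.toLinearMap = 1 :=
  absorb_ext₃ X Y Z fun x y z w =>
    induced_absorb (TensorProduct.assoc ℂ X Y Z).symm.toLinearMap (x ⊗ₜ[ℂ] (y ⊗ₜ[ℂ] z)) w

theorem induced_lid : induced W (TensorProduct.lid ℂ X).toLinearMap = 1 :=
  absorb_ext₂ ℂ X fun c x w => by
    rw [← absorb_tmul, induced_absorb, Module.End.one_apply, absorb_tmul, absorb_scalar,
      LinearEquiv.coe_coe, TensorProduct.lid_tmul, absorb_smul]

theorem induced_rid : induced W (TensorProduct.rid ℂ X).toLinearMap = 1 :=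
  absorb_ext₂ X ℂ fun x c w => by
    rw [← absorb_tmul, induced_absorb, Module.End.one_apply, absorb_tmul, absorb_scalar,
      LinearEquiv.coe_coe, TensorProduct.rid_tmul, absorb_smul, map_smul]

theorem strand_tensor (u : Module.End ℂ W) :
    strand W (X ⊗[ℂ] Y) u = strand W X (strand W Y u) :=
  absorb_ext₂ X Y fun x y w => by
    rw [strand_absorb, strand_absorb, ← absorb_tmul, strand_absorb, absorb_tmul]

theorem strand_scalar (u : Module.End ℂ W) : strand W ℂ u = u :=
  absorb_ext ℂ fun c w => by rw [strand_absorb, absorb_scalar, absorb_scalar, map_smul]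

/-- Bifunctoriality of ⊗: f acts on the strand and u on the reservoir. All `Local` instances of the
model are cases of this. -/
theorem induced_mul_strand (f : X →ₗ[ℂ] Y) (u : Module.End ℂ W) :
    induced W f * strand W X u = strand W Y u * induced W f :=
  absorb_ext X fun x w => by
    rw [Module.End.mul_apply, Module.End.mul_apply, strand_absorb, induced_absorb,
      induced_absorb, strand_absorb]

theorem induced_lid_symm : induced W (TensorProduct.lid ℂ X).symm.toLinearMap = 1 := by
  have h := induced_comp (W := W) (TensorProduct.lid ℂ X).symm.toLinearMap
    (TensorProduct.lid ℂ X).toLinearMap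
  rw [LinearEquiv.symm_comp, induced_id, induced_lid, mul_one] at h
  exact h.symm

theorem induced_rid_symm : induced W (TensorProduct.rid ℂ X).symm.toLinearMap = 1 := by
  have h := induced_comp (W := W) (TensorProduct.rid ℂ X).symm.toLinearMap
    (TensorProduct.rid ℂ X).toLinearMap
  rw [LinearEquiv.symm_comp, induced_id, induced_rid, mul_one] at h
  exact h.symm

instance Local.induced_unit (f : ℂ →ₗ[ℂ] X) : Local (strand W X) 0 1 (induced W f) where
  comm u := by
    have h := induced_mul_strand f u
    simp only [strand_scalar] at h
    exact h

instance Local.induced_counit (f : X →ₗ[ℂ] ℂ) : Local (strand W X) 1 0 (induced W f) where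
  comm u := by
    have h := induced_mul_strand f u
    simp only [strand_scalar] at h
    exact h

instance Local.induced_end (f : X →ₗ[ℂ] X) : Local (strand W X) 1 1 (induced W f) where
  comm u := induced_mul_strand f u

instance Local.induced_mul (f : X ⊗[ℂ] X →ₗ[ℂ] X) : Local (strand W X) 2 1 (induced W f) where
  comm u := by
    have h := induced_mul_strand f u
    simp only [strand_tensor] at h
    exact h

instance Local.induced_comul (f : X →ₗ[ℂ] X ⊗[ℂ] X) : Local (strand W X) 1 2 (induced W f) where
  comm u := by
    have h := induced_mul_strand f u
    simp only [strand_tensor] at h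
    exact h

instance Local.induced_braiding (f : X ⊗[ℂ] X →ₗ[ℂ] X ⊗[ℂ] X) :
    Local (strand W X) 2 2 (induced W f) where
  comm u := by
    have h := induced_mul_strand f u
    simp only [strand_tensor] at h
    exact h

variable (W X) in
/-- The action of linear automorphisms on the reservoir. -/
def inducedUnits : (X ≃ₗ[ℂ] X) →* (Module.End ℂ W)ˣ where
  toFun f :=
    ⟨induced W f.toLinearMap, induced W f.symm.toLinearMap,
      by rw [← induced_comp, LinearEquiv.comp_symm, induced_id],
      by rw [← induced_comp, LinearEquiv.symm_comp, induced_id]⟩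
  map_one' := Units.ext induced_id
  map_mul' f g := Units.ext (induced_comp f.toLinearMap g.toLinearMap)

theorem val_inducedUnits (f : X ≃ₗ[ℂ] X) :
    (inducedUnits W X f : Module.End ℂ W) = induced W f.toLinearMap := rfl

theorem val_inducedUnits_inv (f : X ≃ₗ[ℂ] X) :
    (((inducedUnits W X f)⁻¹ : (Module.End ℂ W)ˣ) : Module.End ℂ W) =
      induced W f.symm.toLinearMap := rfl

end Model

/-! ### Existence of the reservoir -/

section Reservoir

/-- Every vector space is absorbed by some reservoir, which is nonzero unless the space vanishes. -/
theorem exists_reservoir.{u} (A : Type u) [AddCommGroup A] [Module ℂ A] :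
    ∃ (W : Type u) (_ : AddCommGroup W) (_ : Module ℂ W) (_ : Absorbed W A),
      Nontrivial W ∨ Subsingleton A := by
  let b := Module.Basis.ofVectorSpace ℂ A
  let β := Module.Basis.ofVectorSpaceIndex ℂ A
  -- Prepending a term to a sequence of basis indices; on the free space over such sequences this
  -- becomes A⊗W ≅ W.
  let cons : β × (ℕ → β) ≃ (ℕ → β) :=
    { toFun p n := Nat.casesOn n p.1 p.2
      invFun f := (f 0, fun n => f (n + 1))
      left_inv _ := rfl
      right_inv f := by ext (_ | n) <;> rfl }
  refine ⟨(ℕ → β) →₀ ℂ, inferInstance, inferInstance,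
    ⟨TensorProduct.congr b.repr (LinearEquiv.refl ℂ _) ≪≫ₗ finsuppTensorFinsupp' ℂ β (ℕ → β) ≪≫ₗ
      Finsupp.domLCongr cons⟩, ?_⟩
  rcases subsingleton_or_nontrivial A with h | h
  · exact Or.inr h
  · have : Nonempty β := b.index_nonempty
    exact Or.inl inferInstance

end Reservoir

/-! ### Equivalence of the tensor axioms with the strict axioms -/

section Translation

variable {A : Type*} [AddCommGroup A] [Module ℂ A] {W : Type*} [AddCommGroup W] [Module ℂ W]
  [Absorbed W A]

theorem induced_onFirstTwo {V : Type*} [AddCommGroup V] [Module ℂ V] [Absorbed W V]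
    (f : A ⊗[ℂ] A →ₗ[ℂ] A ⊗[ℂ] A) : induced W (onFirstTwo V f) = induced W f := by
  simp only [onFirstTwo, induced_comp, induced_assoc, induced_assoc_symm, induced_rTensor,
    one_mul, mul_one]

theorem induced_mulLeft (f : A ⊗[ℂ] A →ₗ[ℂ] A) : induced W (mulLeft f) = induced W f := by
  simp only [mulLeft, induced_comp, induced_assoc_symm, induced_rTensor, mul_one]

theorem induced_comulLeft (f : A →ₗ[ℂ] A ⊗[ℂ] A) : induced W (comulLeft f) = induced W f := by
  simp only [comulLeft, induced_comp, induced_assoc, induced_rTensor, one_mul]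

theorem induced_onMiddle (f : A ⊗[ℂ] A →ₗ[ℂ] A ⊗[ℂ] A) :
    induced W (onMiddle f) = strand W A (induced W f) := by
  simp only [onMiddle, induced_comp, induced_assoc, induced_assoc_symm, induced_lTensor,
    induced_onFirstTwo, one_mul, mul_one]

theorem induced_secondaryFlip (φ : A →ₗ[ℂ] A ⊗[ℂ] A) (ε : A →ₗ[ℂ] ℂ)
    (σ : A ⊗[ℂ] A ≃ₗ[ℂ] A ⊗[ℂ] A) :
    induced W (secondaryFlip φ ε σ) = strand W A (strand W A (induced W ε)) *
      strand W A (induced W σ.symm.toLinearMap) * induced W φ * induced W σ.toLinearMap := by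
  simp only [secondaryFlip, induced_comp, induced_lTensor, induced_rid, induced_comulLeft,
    one_mul, mul_assoc]

theorem induced_inj (hW : Nontrivial W ∨ Subsingleton A) {Y : Type*} [AddCommGroup Y] [Module ℂ Y]
    [Absorbed W Y] {f g : A →ₗ[ℂ] Y} : induced W f = induced W g ↔ f = g :=
  ⟨induced_injective hW, congrArg _⟩

theorem induced_inj_tensor (hW : Nontrivial W ∨ Subsingleton A) {V Y : Type*} [AddCommGroup V]
    [Module ℂ V] [Absorbed W V] [AddCommGroup Y] [Module ℂ Y] [Absorbed W Y]
    {f g : A ⊗[ℂ] V →ₗ[ℂ] Y} : induced W f = induced W g ↔ f = g := by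
  refine ⟨fun h => ?_, congrArg _⟩
  rcases hW with hW | hW
  · exact induced_injective (Or.inl hW) h
  · exact TensorProduct.ext' fun a v => by
      rw [Subsingleton.elim a 0, TensorProduct.zero_tmul, map_zero, map_zero]

/-- Each equational axiom is equivalent to its image in End W by injectivity of `induced`.
Bijectivity of κ is not part of the strict calculus and is carried separately. -/
theorem isBraidedQuantumGroup_iff (hW : Nontrivial W ∨ Subsingleton A)
    {m : A ⊗[ℂ] A →ₗ[ℂ] A} {one : A} {φ : A →ₗ[ℂ] A ⊗[ℂ] A} {ε : A →ₗ[ℂ] ℂ} {κ : A →ₗ[ℂ] A}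
    {σ : A ⊗[ℂ] A ≃ₗ[ℂ] A ⊗[ℂ] A} :
    IsBraidedQuantumGroup m one φ ε κ σ ↔ Function.Bijective κ ∧
      StrictBraided (strand W A) (induced W m) (induced W (LinearMap.toSpanSingleton ℂ A one))
        (induced W φ) (induced W ε) (induced W κ) (induced W σ.toLinearMap)
        (induced W σ.symm.toLinearMap) := by
  -- The hole is filled by the induced equation, which the later simplification at all hypotheses
  -- brings to the form used in `StrictBraided`.
  have assoc_iff : m ∘ₗ mulLeft m = m ∘ₗ m.lTensor A ↔ _ := (induced_inj_tensor hW).symm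
  have one_mul_iff : (∀ a : A, m (one ⊗ₜ[ℂ] a) = a) ↔
      m ∘ₗ (LinearMap.toSpanSingleton ℂ A one).rTensor A ∘ₗ
        (TensorProduct.lid ℂ A).symm.toLinearMap = LinearMap.id := by
    simp [LinearMap.ext_iff]
  have mul_one_iff : (∀ a : A, m (a ⊗ₜ[ℂ] one) = a) ↔
      m ∘ₗ (LinearMap.toSpanSingleton ℂ A one).lTensor A ∘ₗ
        (TensorProduct.rid ℂ A).symm.toLinearMap = LinearMap.id := by
    simp [LinearMap.ext_iff]
  have coassoc_iff : comulLeft φ ∘ₗ φ = φ.lTensor A ∘ₗ φ ↔ _ := (induced_inj hW).symm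
  have counit_left_iff : (TensorProduct.lid ℂ A).toLinearMap ∘ₗ ε.rTensor A ∘ₗ φ = LinearMap.id ↔
      _ := (induced_inj hW).symm
  have counit_right_iff : (TensorProduct.rid ℂ A).toLinearMap ∘ₗ ε.lTensor A ∘ₗ φ =
      LinearMap.id ↔ _ := (induced_inj hW).symm
  have braiding_mul_left_iff : σ.toLinearMap ∘ₗ mulLeft m =
      m.lTensor A ∘ₗ onFirstTwo A σ.toLinearMap ∘ₗ σ.toLinearMap.lTensor A ↔ _ :=
    (induced_inj_tensor hW).symm
  have braiding_mul_right_iff : σ.toLinearMap ∘ₗ m.lTensor A =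
      mulLeft m ∘ₗ σ.toLinearMap.lTensor A ∘ₗ onFirstTwo A σ.toLinearMap ↔ _ :=
    (induced_inj_tensor hW).symm
  have comul_mul_iff : φ ∘ₗ m =
      TensorProduct.map m m ∘ₗ onMiddle σ.toLinearMap ∘ₗ TensorProduct.map φ φ ↔ _ :=
    (induced_inj_tensor hW).symm
  have braiding_comul_iff : onFirstTwo (A ⊗[ℂ] A) σ.toLinearMap ∘ₗ (comulLeft φ).lTensor A ∘ₗ
        onFirstTwo A σ.symm.toLinearMap ∘ₗ φ.lTensor A =
      (σ.toLinearMap.lTensor A).lTensor A ∘ₗ (comulLeft φ).lTensor A ∘ₗ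
        σ.symm.toLinearMap.lTensor A ∘ₗ comulLeft φ ↔ _ := (induced_inj_tensor hW).symm
  have antipode_right_iff : (∀ a : A, m (κ.lTensor A (φ a)) = ε a • one) ↔
      m ∘ₗ κ.lTensor A ∘ₗ φ = LinearMap.toSpanSingleton ℂ A one ∘ₗ ε := by
    simp [LinearMap.ext_iff]
  have antipode_left_iff : (∀ a : A, m (κ.rTensor A (φ a)) = ε a • one) ↔
      m ∘ₗ κ.rTensor A ∘ₗ φ = LinearMap.toSpanSingleton ℂ A one ∘ₗ ε := by
    simp [LinearMap.ext_iff]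
  rw [← induced_inj hW] at one_mul_iff mul_one_iff antipode_right_iff antipode_left_iff
  simp only [induced_comp, induced_lTensor, induced_rTensor, induced_map, induced_lid, induced_rid,
    induced_lid_symm, induced_rid_symm, induced_id, induced_onFirstTwo, induced_mulLeft,
    induced_comulLeft, induced_onMiddle, strand_tensor, one_mul, mul_one, ← mul_assoc] at *
  constructor
  · intro h
    exact ⟨h.antipode_bijective,
      (inducedUnits W _ σ).mul_inv, (inducedUnits W _ σ).inv_mul, assoc_iff.1 h.mul_assoc,
      one_mul_iff.1 h.one_mul, mul_one_iff.1 h.mul_one, coassoc_iff.1 h.coassoc,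
      counit_left_iff.1 h.counit_left, counit_right_iff.1 h.counit_right,
      braiding_mul_left_iff.1 h.braiding_mul_left, braiding_mul_right_iff.1 h.braiding_mul_right,
      comul_mul_iff.1 h.comul_mul, braiding_comul_iff.1 h.braiding_comul,
      antipode_right_iff.1 h.antipode_right, antipode_left_iff.1 h.antipode_left⟩
  · rintro ⟨hκ, h⟩
    exact ⟨assoc_iff.2 h.assoc, one_mul_iff.2 h.unit_left, mul_one_iff.2 h.unit_right,
      coassoc_iff.2 h.coassoc, counit_left_iff.2 h.counit_left,
      counit_right_iff.2 h.counit_right, hκ, braiding_mul_left_iff.2 h.braiding_mul_left,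
      braiding_mul_right_iff.2 h.braiding_mul_right, comul_mul_iff.2 h.comul_mul,
      braiding_comul_iff.2 h.braiding_comul, antipode_right_iff.2 h.antipode_right,
      antipode_left_iff.2 h.antipode_left⟩

end Translation

end BraidedQG

end

/-! ### Transfer of the results back to tensor powers of A -/

open scoped TensorProduct

noncomputable section

namespace BraidedQG

variable {A : Type*} [AddCommGroup A] [Module ℂ A] {W : Type*} [AddCommGroup W] [Module ℂ W]
  [Absorbed W A]

/-- The map `(ε ⊗ id) δ φ`. -/
def counitTwist (φ : A →ₗ[ℂ] A ⊗[ℂ] A) (ε : A →ₗ[ℂ] ℂ) (δ : A ⊗[ℂ] A →ₗ[ℂ] A ⊗[ℂ] A) :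
    A →ₗ[ℂ] A :=
  (TensorProduct.lid ℂ A).toLinearMap ∘ₗ ε.rTensor A ∘ₗ δ ∘ₗ φ

theorem induced_counitTwist (φ : A →ₗ[ℂ] A ⊗[ℂ] A) (ε : A →ₗ[ℂ] ℂ)
    (δ : A ⊗[ℂ] A →ₗ[ℂ] A ⊗[ℂ] A) :
    induced W (counitTwist φ ε δ) = induced W ε * induced W δ * induced W φ := by
  simp only [counitTwist, induced_comp, induced_lid, induced_rTensor, one_mul, mul_assoc]

theorem induced_mulSeq (m : A ⊗[ℂ] A →ₗ[ℂ] A) (σ τ : A ⊗[ℂ] A ≃ₗ[ℂ] A ⊗[ℂ] A) (n : ℤ) :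
    induced W (mulSeq m σ τ n) = induced W m *
      (induced W (braidingSeq σ τ n).symm.toLinearMap * induced W σ.toLinearMap) := by
  simp only [mulSeq, induced_comp]

theorem antipodeSeq_eq (φ : A →ₗ[ℂ] A ⊗[ℂ] A) (ε : A →ₗ[ℂ] ℂ) (κ : A →ₗ[ℂ] A)
    (σ τ : A ⊗[ℂ] A ≃ₗ[ℂ] A ⊗[ℂ] A) (n : ℤ) :
    antipodeSeq φ ε κ σ τ n =
      κ ∘ₗ counitTwist φ ε ((braidingSeq σ τ n).symm.toLinearMap ∘ₗ σ.toLinearMap) := by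
  have h : (TensorProduct.lid ℂ A).toLinearMap ∘ₗ TensorProduct.map ε κ =
      κ ∘ₗ (TensorProduct.lid ℂ A).toLinearMap ∘ₗ ε.rTensor A :=
    TensorProduct.ext' fun a b => by simp
  have h' := congrArg
    (· ∘ₗ (braidingSeq σ τ n).symm.toLinearMap ∘ₗ σ.toLinearMap ∘ₗ φ) h
  simpa only [antipodeSeq, counitTwist, LinearMap.comp_assoc] using h'

theorem induced_antipodeSeq (φ : A →ₗ[ℂ] A ⊗[ℂ] A) (ε : A →ₗ[ℂ] ℂ) (κ : A →ₗ[ℂ] A)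
    (σ τ : A ⊗[ℂ] A ≃ₗ[ℂ] A ⊗[ℂ] A) (n : ℤ) :
    induced W (antipodeSeq φ ε κ σ τ n) = induced W κ * (induced W ε *
      (induced W (braidingSeq σ τ n).symm.toLinearMap * induced W σ.toLinearMap) *
        induced W φ) := by
  rw [antipodeSeq_eq, induced_comp, induced_counitTwist, induced_comp]

theorem induced_antipodeSeq' (φ : A →ₗ[ℂ] A ⊗[ℂ] A) (ε : A →ₗ[ℂ] ℂ) (κ : A →ₗ[ℂ] A)
    (σ τ : A ⊗[ℂ] A ≃ₗ[ℂ] A ⊗[ℂ] A) (n : ℤ) :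
    induced W (antipodeSeq' φ ε κ σ τ n) = induced W κ * (strand W A (induced W ε) *
      (induced W (braidingSeq σ τ n).symm.toLinearMap * induced W σ.toLinearMap) *
        induced W φ) := by
  simp only [antipodeSeq', induced_comp, induced_rid, induced_map, one_mul, mul_assoc]

theorem inducedUnits_braidingSeq (σ τ : A ⊗[ℂ] A ≃ₗ[ℂ] A ⊗[ℂ] A) (n : ℤ) :
    inducedUnits W (A ⊗[ℂ] A) (braidingSeq σ τ n) =
      (inducedUnits W _ σ * (inducedUnits W _ τ)⁻¹) ^ (n - 1) * inducedUnits W _ σ := by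
  rw [braidingSeq, map_mul, map_zpow, map_mul, map_inv]

theorem braidingSeq_zero (σ τ : A ⊗[ℂ] A ≃ₗ[ℂ] A ⊗[ℂ] A) : braidingSeq σ τ 0 = τ := by
  simp [braidingSeq]

theorem IsBraidedQuantumGroup.exists_flip {m : A ⊗[ℂ] A →ₗ[ℂ] A} {one : A}
    {φ : A →ₗ[ℂ] A ⊗[ℂ] A} {ε : A →ₗ[ℂ] ℂ} {κ : A →ₗ[ℂ] A} {σ : A ⊗[ℂ] A ≃ₗ[ℂ] A ⊗[ℂ] A}
    (hW : Nontrivial W ∨ Subsingleton A) (hG : IsBraidedQuantumGroup m one φ ε κ σ) :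
    ∃ τ : A ⊗[ℂ] A ≃ₗ[ℂ] A ⊗[ℂ] A, τ.toLinearMap = secondaryFlip φ ε σ := by
  obtain ⟨h₁, h₂⟩ := ((isBraidedQuantumGroup_iff hW).1 hG).2.flip_inverse
  refine ⟨LinearEquiv.ofLinearMap (secondaryFlip φ ε σ) (secondaryFlip φ ε σ.symm) ?_ ?_, rfl⟩
  · rw [← induced_inj_tensor hW, induced_comp, induced_id, induced_secondaryFlip,
      induced_secondaryFlip]
    exact h₁
  · rw [← induced_inj_tensor hW, induced_comp, induced_id, induced_secondaryFlip,
      induced_secondaryFlip]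
    exact h₂

theorem IsBraidedQuantumGroup.deformation {m : A ⊗[ℂ] A →ₗ[ℂ] A} {one : A}
    {φ : A →ₗ[ℂ] A ⊗[ℂ] A} {ε : A →ₗ[ℂ] ℂ} {κ : A →ₗ[ℂ] A} {σ τ : A ⊗[ℂ] A ≃ₗ[ℂ] A ⊗[ℂ] A}
    (hW : Nontrivial W ∨ Subsingleton A) (hG : IsBraidedQuantumGroup m one φ ε κ σ)
    (hτ : τ.toLinearMap = secondaryFlip φ ε σ) (n : ℤ) :
    antipodeSeq φ ε κ σ τ n = antipodeSeq' φ ε κ σ τ n ∧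
      IsBraidedQuantumGroup (mulSeq m σ τ n) one φ ε (antipodeSeq φ ε κ σ τ n)
        (braidingSeq σ τ n) := by
  obtain ⟨hκ, h⟩ := (isBraidedQuantumGroup_iff hW).1 hG
  obtain ⟨h₁, h₂, h₃, h₄⟩ := h.deformation (S := inducedUnits W _ σ) (T := inducedUnits W _ τ) rfl
    (by rw [val_inducedUnits, hτ, induced_secondaryFlip]) n (inducedUnits_braidingSeq σ τ n)
  simp only [val_inducedUnits, val_inducedUnits_inv] at h₁ h₂ h₃ h₄
  -- κₙ is κ after this map, which is N¹⁻ⁿ; exchanging the roles of σₙ and σ gives its inverse.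
  have hρ : Function.Bijective
      (counitTwist φ ε ((braidingSeq σ τ n).symm.toLinearMap ∘ₗ σ.toLinearMap)) := by
    rw [← induced_comp (braidingSeq σ τ n).symm.toLinearMap, ← induced_comp σ.symm.toLinearMap,
      ← induced_counitTwist, ← induced_counitTwist, ← induced_comp, ← induced_id (X := A),
      induced_inj hW] at h₃ h₄
    exact Function.bijective_iff_has_inverse.2
      ⟨counitTwist φ ε (σ.symm.toLinearMap ∘ₗ (braidingSeq σ τ n).toLinearMap),
        LinearMap.congr_fun h₄, LinearMap.congr_fun h₃⟩
  refine ⟨?_, (isBraidedQuantumGroup_iff hW).2 ⟨?_, ?_⟩⟩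
  · rw [← induced_inj hW, induced_antipodeSeq, induced_antipodeSeq', h₂]
  · rw [antipodeSeq_eq]
    exact hκ.comp hρ
  · rw [induced_mulSeq, induced_antipodeSeq]
    exact h₁

theorem IsBraidedQuantumGroup.counit_mulSeq_zero {m : A ⊗[ℂ] A →ₗ[ℂ] A} {one : A}
    {φ : A →ₗ[ℂ] A ⊗[ℂ] A} {ε : A →ₗ[ℂ] ℂ} {κ : A →ₗ[ℂ] A} {σ τ : A ⊗[ℂ] A ≃ₗ[ℂ] A ⊗[ℂ] A}
    (hW : Nontrivial W ∨ Subsingleton A) (hG : IsBraidedQuantumGroup m one φ ε κ σ)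
    (hτ : τ.toLinearMap = secondaryFlip φ ε σ) (a b : A) :
    ε (mulSeq m σ τ 0 (a ⊗ₜ[ℂ] b)) = ε a * ε b := by
  obtain ⟨-, h⟩ := (isBraidedQuantumGroup_iff hW).1 hG
  have h₁ := h.counit_mul_flip (T := inducedUnits W _ τ)
    (by rw [val_inducedUnits, hτ, induced_secondaryFlip])
  have h₂ : ε ∘ₗ mulSeq m σ τ 0 =
      ε ∘ₗ (TensorProduct.lid ℂ A).toLinearMap ∘ₗ ε.rTensor A := by
    rw [← induced_inj_tensor hW, induced_comp, induced_mulSeq, braidingSeq_zero]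
    simp only [induced_comp, induced_lid, induced_rTensor]
    exact h₁
  simpa using LinearMap.congr_fun h₂ (a ⊗ₜ[ℂ] b)

end BraidedQG

end

theorem mainTheorem5 {A : Type*} [AddCommGroup A] [Module ℂ A]
    (m : A ⊗[ℂ] A →ₗ[ℂ] A) (one : A) (φ : A →ₗ[ℂ] A ⊗[ℂ] A) (ε : A →ₗ[ℂ] ℂ)
    (κ : A →ₗ[ℂ] A) (σ : A ⊗[ℂ] A ≃ₗ[ℂ] A ⊗[ℂ] A)
    (hG : BraidedQG.IsBraidedQuantumGroup m one φ ε κ σ) :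
    ∃ τ : A ⊗[ℂ] A ≃ₗ[ℂ] A ⊗[ℂ] A,
      τ.toLinearMap = BraidedQG.secondaryFlip φ ε σ ∧
      (∀ n : ℤ,
        BraidedQG.antipodeSeq φ ε κ σ τ n = BraidedQG.antipodeSeq' φ ε κ σ τ n ∧
        BraidedQG.IsBraidedQuantumGroup (BraidedQG.mulSeq m σ τ n) one φ ε
          (BraidedQG.antipodeSeq φ ε κ σ τ n) (BraidedQG.braidingSeq σ τ n)) ∧
      BraidedQG.braidingSeq σ τ 0 = τ ∧
      ∀ a b : A, ε (BraidedQG.mulSeq m σ τ 0 (a ⊗ₜ[ℂ] b)) = ε a * ε b := by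
  obtain ⟨W, _, _, _, hW⟩ := BraidedQG.exists_reservoir A
  obtain ⟨τ, hτ⟩ := hG.exists_flip hW
  exact ⟨τ, hτ, hG.deformation hW hτ, BraidedQG.braidingSeq_zero σ τ,
    hG.counit_mulSeq_zero hW hτ⟩
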